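/- Given $n$ matrices $M_1,\dots,M_n\in\mathbb{R}^{2\times 2}$ and vectors $w,y\in\mathbb{R}^2$, a permutation $\sigma$ of $\{1,\dots,n\}$ is called an optimal multiplication ordering if it minimizes $w^\top M_{\sigma(n)}M_{\sigma(n-1)}\cdots M_{\sigma(1)}y$ over all permutations. The matrices are called simultaneously triangularizable if there is an invertible $P\in\mathbb{R}^{2\times 2}$ such that $P^{-1}M_iP$ is upper triangular for every $i$. Running times are counted on a real RAM: a finite program, the same for all instances, works on arrays of real numbers and arrays of natural numbers; exact addition, subtraction, multiplication, division and comparison of real numbers, addition, truncated subtraction and comparison of natural numbers, and memory access at computed positions cost one unit each; the only constants are rational, and real numbers cannot be rounded or converted to natural numbers. The input is $n$, the entries of $M_1,\dots,M_n$, and $w$ and $y$ (the matrix $P$ is not given); the output is the list $\sigma(1),\dots,\sigma(n)$. Then the following hold. (i) There are a program and a constant $C$ such that, for every $n$, all simultaneously triangularizable $M_1,\dots,M_n\in\mathbb{R}^{2\times 2}$ with $\det M_i\ge 0$ for all $i$, and all $w,y\in\mathbb{R}^2$, the program computes an optimal multiplication ordering in at most $C\,(n\log n+1)$ steps. That is,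 the problem is solvable in $O(n\log n)$ time. (ii) There are a program and a constant $C$ such that, for every $n$, all simultaneously triangularizable $M_1,\dots,M_n\in\mathbb{R}^{2\times 2}$ with $\det M_i<0$ for at least one $i$, and all $w,y\in\mathbb{R}^2$, the program computes an optimal multiplication ordering in at most $C\,k\,2^k\,n^6$ steps, where $k$ is the number of indices $i$ with $\det M_i<0$. That is, the problem is solvable in $O(k2^kn^6)$ time. -/

import Mathlib

/-! ### The ordering problem -/

/-- The product `M_{σ(n)} ⋯ M_{σ(1)}` (the matrix with index `σ 0` is the rightmost factor); it is
the identity matrix for `n = 0`. -/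
def orderedProduct {m n : ℕ} (M : Fin n → Matrix (Fin m) (Fin m) ℝ) (σ : Equiv.Perm (Fin n)) :
    Matrix (Fin m) (Fin m) ℝ :=
  (List.ofFn fun i => M (σ i)).reverse.prod

/-- An instance of the multiplication ordering problem: `n` real `m × m` matrices and two vectors. -/
structure OrderingInstance (m n : ℕ) where
  M : Fin n → Matrix (Fin m) (Fin m) ℝ
  w : Fin m → ℝ
  y : Fin m → ℝ

/-- The objective value `wᵀ M_{σ(n)} ⋯ M_{σ(1)} y`. -/
def OrderingInstance.value {m n : ℕ} (I : OrderingInstance m n) (σ : Equiv.Perm (Fin n)) : ℝ :=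
  dotProduct I.w (Matrix.mulVec (orderedProduct I.M σ) I.y)

/-- `σ` is an optimal (minimum) multiplication ordering. -/
def OrderingInstance.IsOptimal {m n : ℕ} (I : OrderingInstance m n) (σ : Equiv.Perm (Fin n)) :
    Prop :=
  ∀ τ : Equiv.Perm (Fin n), I.value σ ≤ I.value τ

/-- Some invertible real `P` makes every `P⁻¹ Mᵢ P` upper triangular. -/
def SimultaneouslyTriangularizable {m n : ℕ} (M : Fin n → Matrix (Fin m) (Fin m) ℝ) : Prop :=
  ∃ P : Matrix (Fin m) (Fin m) ℝ, IsUnit P ∧ ∀ i, (P⁻¹ * M i * P).IsUpperTriangular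

/-- The number of matrices with negative determinant. -/
noncomputable def numNegDet {m n : ℕ} (M : Fin n → Matrix (Fin m) (Fin m) ℝ) : ℕ :=
  Set.ncard {i : Fin n | (M i).det < 0}

/-! ### The machine model: a real RAM

Programs are finite texts in a small imperative language. The memory consists of arrays of natural
numbers (used for counting and addressing) and arrays of real numbers. The name of an array is a
constant in the program text, so that a program uses finitely many arrays; positions inside an
array are computed at run time. Arithmetic on real numbers is exact, and every operation costs one
unit. The operations on natural numbers are addition, truncated subtraction and comparison. Real
numbers can be added, subtracted, multiplied, divided and compared; they cannot be rounded or
converted to natural numbers, and the only constants are rational. -/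

namespace RealRAM

/-- The memory: `s.nat a i` and `s.real a i` are the entries at position `i` of the arrays named
`a`. -/
structure State where
  nat : ℕ → ℕ → ℕ
  real : ℕ → ℕ → ℝ

/-- Expressions with a natural number as value. -/
inductive NExp where
  | lit (c : ℕ)
  | get (a : ℕ) (pos : NExp)
  | add (e f : NExp)
  | sub (e f : NExp)

/-- Expressions with a real number as value. -/
inductive RExp where
  | lit (c : ℚ)
  | get (a : ℕ) (pos : NExp)
  | add (e f : RExp)
  | sub (e f : RExp)
  | mul (e f : RExp)
  | div (e f : RExp)

/-- Tests. -/
inductive Test where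
  | natLe (e f : NExp)
  | realLe (e f : RExp)
  | not (b : Test)
  | and (b c : Test)

/-- Programs. -/
inductive Prog where
  | skip
  | setNat (a : ℕ) (pos e : NExp)
  | setReal (a : ℕ) (pos : NExp) (e : RExp)
  | seq (p q : Prog)
  | ite (b : Test) (p q : Prog)
  | while (b : Test) (p : Prog)

def NExp.eval (s : State) : NExp → ℕ
  | lit c => c
  | get a pos => s.nat a (pos.eval s)
  | add e f => e.eval s + f.eval s
  | sub e f => e.eval s - f.eval s

/-- The number of operations performed in an evaluation. -/
def NExp.cost : NExp → ℕ
  | lit _ => 1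
  | get _ pos => pos.cost + 1
  | add e f => e.cost + f.cost + 1
  | sub e f => e.cost + f.cost + 1

/-- Division by zero gives zero; a program can test the denominator beforehand. -/
noncomputable def RExp.eval (s : State) : RExp → ℝ
  | lit c => (c : ℝ)
  | get a pos => s.real a (pos.eval s)
  | add e f => e.eval s + f.eval s
  | sub e f => e.eval s - f.eval s
  | mul e f => e.eval s * f.eval s
  | div e f => e.eval s / f.eval s

/-- The number of operations performed in an evaluation. -/
def RExp.cost : RExp → ℕ
  | lit _ => 1
  | get _ pos => pos.cost + 1
  | add e f => e.cost + f.cost + 1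
  | sub e f => e.cost + f.cost + 1
  | mul e f => e.cost + f.cost + 1
  | div e f => e.cost + f.cost + 1

def Test.Holds (s : State) : Test → Prop
  | natLe e f => e.eval s ≤ f.eval s
  | realLe e f => e.eval s ≤ f.eval s
  | not b => ¬ b.Holds s
  | and b c => b.Holds s ∧ c.Holds s

/-- The number of operations performed in a test. -/
def Test.cost : Test → ℕ
  | natLe e f => e.cost + f.cost + 1
  | realLe e f => e.cost + f.cost + 1
  | not b => b.cost + 1
  | and b c => b.cost + c.cost + 1

/-- Write `v` at position `i` of the array of natural numbers named `a`. -/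
def State.setNat (s : State) (a i v : ℕ) : State :=
  { s with nat := Function.update s.nat a (Function.update (s.nat a) i v) }

/-- Write `v` at position `i` of the array of real numbers named `a`. -/
def State.setReal (s : State) (a i : ℕ) (v : ℝ) : State :=
  { s with real := Function.update s.real a (Function.update (s.real a) i v) }

/-- `Runs p s t s'`: the program `p`, started in the memory `s`, halts after exactly `t` steps with
the memory `s'`. -/
inductive Runs : Prog → State → ℕ → State → Prop
  | skip (s : State) : Runs .skip s 1 s
  | setNat (s : State) (a : ℕ) (pos e : NExp) :
      Runs (.setNat a pos e) s (pos.cost + e.cost + 1) (s.setNat a (pos.eval s) (e.eval s))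
  | setReal (s : State) (a : ℕ) (pos : NExp) (e : RExp) :
      Runs (.setReal a pos e) s (pos.cost + e.cost + 1) (s.setReal a (pos.eval s) (e.eval s))
  | seq {p q : Prog} {s s₁ s₂ : State} {t₁ t₂ : ℕ} :
      Runs p s t₁ s₁ → Runs q s₁ t₂ s₂ → Runs (.seq p q) s (t₁ + t₂) s₂
  | iteTrue {b : Test} {p q : Prog} {s s' : State} {t : ℕ} :
      b.Holds s → Runs p s t s' → Runs (.ite b p q) s (b.cost + 1 + t) s'
  | iteFalse {b : Test} {p q : Prog} {s s' : State} {t : ℕ} :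
      ¬ b.Holds s → Runs q s t s' → Runs (.ite b p q) s (b.cost + 1 + t) s'
  | whileTrue {b : Test} {p : Prog} {s s₁ s₂ : State} {t₁ t₂ : ℕ} :
      b.Holds s → Runs p s t₁ s₁ → Runs (.while b p) s₁ t₂ s₂ →
        Runs (.while b p) s (b.cost + 1 + t₁ + t₂) s₂
  | whileFalse {b : Test} {p : Prog} {s : State} :
      ¬ b.Holds s → Runs (.while b p) s (b.cost + 1) s

/-- Programs are deterministic: the number of steps and the final memory are determined by the
initial memory. -/
theorem Runs.unique {p : Prog} {s s₁ s₂ : State} {t₁ t₂ : ℕ} (h₁ : Runs p s t₁ s₁)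
    (h₂ : Runs p s t₂ s₂) : t₁ = t₂ ∧ s₁ = s₂ := by
  induction h₁ generalizing t₂ s₂ with
  | skip s => cases h₂; exact ⟨rfl, rfl⟩
  | setNat s a pos e => cases h₂; exact ⟨rfl, rfl⟩
  | setReal s a pos e => cases h₂; exact ⟨rfl, rfl⟩
  | seq _ _ ih₁ ih₂ =>
    cases h₂ with
    | seq h h' =>
      obtain ⟨rfl, rfl⟩ := ih₁ h
      obtain ⟨rfl, rfl⟩ := ih₂ h'
      exact ⟨rfl, rfl⟩
  | iteTrue hb _ ih =>
    cases h₂ with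
    | iteTrue _ h => obtain ⟨rfl, rfl⟩ := ih h; exact ⟨rfl, rfl⟩
    | iteFalse hb' _ => exact absurd hb hb'
  | iteFalse hb _ ih =>
    cases h₂ with
    | iteTrue hb' _ => exact absurd hb' hb
    | iteFalse _ h => obtain ⟨rfl, rfl⟩ := ih h; exact ⟨rfl, rfl⟩
  | whileTrue hb _ _ ih₁ ih₂ =>
    cases h₂ with
    | whileTrue _ h h' =>
      obtain ⟨rfl, rfl⟩ := ih₁ h
      obtain ⟨rfl, rfl⟩ := ih₂ h'
      exact ⟨rfl, rfl⟩
    | whileFalse hb' => exact absurd hb hb'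
  | whileFalse hb =>
    cases h₂ with
    | whileTrue hb' _ _ => exact absurd hb' hb
    | whileFalse _ => exact ⟨rfl, rfl⟩

/-- The initial memory for a `2 × 2` instance. Entry `0` of the natural array `0` is `n`; entry `i`
of the real arrays `0, 1, 2, 3` is the entry `(1,1)`, `(1,2)`, `(2,1)`, `(2,2)` of the `i`-th
matrix; the real arrays `4` and `5` hold `w` and `y`. Everything else is zero. -/
def input {n : ℕ} (I : OrderingInstance 2 n) : State where
  nat a i := if a = 0 ∧ i = 0 then n else 0
  real a i :=
    match a with
    | 0 => if h : i < n then I.M ⟨i, h⟩ 0 0 else 0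
    | 1 => if h : i < n then I.M ⟨i, h⟩ 0 1 else 0
    | 2 => if h : i < n then I.M ⟨i, h⟩ 1 0 else 0
    | 3 => if h : i < n then I.M ⟨i, h⟩ 1 1 else 0
    | 4 => if h : i < 2 then I.w ⟨i, h⟩ else 0
    | 5 => if h : i < 2 then I.y ⟨i, h⟩ else 0
    | _ => 0

/-- The program `p`, started on the instance `I`, halts after at most `T` steps, and then the
entries `0, …, n - 1` of the natural array `1` are `σ(0), …, σ(n - 1)` for an optimal `σ`. -/
def SolvesWithin {n : ℕ} (p : Prog) (I : OrderingInstance 2 n) (T : ℝ) : Prop :=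
  ∃ (t : ℕ) (s : State), Runs p (input I) t s ∧ (t : ℝ) ≤ T ∧
    ∃ σ : Equiv.Perm (Fin n), (∀ i : Fin n, s.nat 1 i = (σ i : ℕ)) ∧ I.IsOptimal σ

end RealRAM

/-!
If the matrices do not commute, a nonzero commutator of two of them is nilpotent and its image is
spanned by their common eigenvector, which is thus computed by rational operations
(`isEigen_commutator`). In the basis of the eigenvector and its perpendicular all matrices are
triangular, with entries `a`, `b`, `d`, and the objective is an affine function of the upper right
entry `offDiag a b d` of the product (`represents_of_isEigen`). By changes of signs, the slope of
this function becomes nonnegative, and the diagonal entries satisfy `0 ≤ a`, `0 ≤ d` (positive type)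
or `a < 0 < d` (negative type, negative determinant).

Exchanging two adjacent blocks `U`, `V` changes the upper right entry by a multiple of the cross
product `comm U V` of two plane vectors that belong to the blocks; the sign of the multiple depends
on the parity of the number of later factors of negative type. So the polygon attached to an optimal
sequence is locally convex, and the hexagon lemma `no_double_clockwise` excludes that three
elements of positive type occur in the wrong cyclic order of their directions
(`IsMinimal.not_cyclicOrder`). With the comparison of pairs in `IsMinimal.comm_pair` one obtains the
structure of the optimal sequences. Let `K` be the list of the elements of positive type, sorted by
the angle of the vector `(b, a - d)`. A contiguous block of `K` is used in a reversed cyclic order,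
the rest of `K` in cyclic order, and the elements of negative type are interspersed; without elements
of negative type, the block is empty (`IsMinimal.structured`). This is proved for generic instances,
and it carries over to all instances in the form that some optimal sequence is structured
(`hasStructuredMin`), because generic instances are dense and there are finitely many sequences.

For part (i), the program sorts the elements by angle and finds the best among the rotations of the
sorted list by means of the products along initial and final segments
(`ends_rotation_isOptimalList`). For part (ii), it tries all choices of the two rotations and of the
two ends of the block. For each of the at most `(n + 1) ^ 4` choices, a structured sequence is an
interleaving of `k + 2` given sequences, two of total length at most `n` and `k` of length one. The
best interleaving is found by dynamic programming: an entry of the table is a best interleaving of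
initial parts of the sequences, and such lists are extended at the front, where the new factor acts
first; this is monotone because `0 ≤ d`. There are at most `2 ^ k * (n + 1) ^ 2` entries with at most
`k + 2` predecessors each (`ends_tableProg`, `ends_search_isOptimalList`).

Statements about programs have the form `Prog.Ends p T s Q`: the program `p`, started in the memory
`s`, halts after at most `T` steps in a memory that satisfies `Q`. They are derived from weakest
preconditions for programs without loops (`Prog.ends_of_wp`), from invariants for loops
(`ends_forLoop`, `Prog.ends_while`), and from the fact that a program changes only the arrays it
writes to (`Frame`). A variable is the entry at position `0` of an array. From the preparation on,
the natural variables `4` and `5` are the numbers of indices of positive and of negative type, and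
the real arrays `8`, `9`, `10` hold `a`, `b`, `d`.
-/

namespace OrderingProof

/-! ### Products of triangular matrices -/

/-- The upper right entry of the product of the triangular matrices `[[a x, b x], [0, d x]]`, `x`
ranging over a list in the order of application: the head of the list is the rightmost factor. The
diagonal entries are the products of the values of `a` and of `d`. -/
def offDiag {ι : Type*} (a b d : ι → ℝ) : List ι → ℝ
  | [] => 0
  | x :: L => (L.map a).prod * b x + offDiag a b d L * d x

/-- The difference of the diagonal entries of a product of triangular matrices. -/
def gap {ι : Type*} (a d : ι → ℝ) (L : List ι) : ℝ := (L.map a).prod - (L.map d).prod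

/-- The upper right entry of the commutator of the products over `U` and over `V`, equivalently the
cross product of the plane vectors `(offDiag, gap)` of the two products. Its sign decides which of
two adjacent blocks should come first. -/
def comm {ι : Type*} (a b d : ι → ℝ) (U V : List ι) : ℝ :=
  gap a d U * offDiag a b d V - offDiag a b d U * gap a d V

section
variable {ι : Type*} {a b d : ι → ℝ}

@[simp] lemma offDiag_nil : offDiag a b d [] = 0 := rfl

@[simp] lemma offDiag_cons (x : ι) (L : List ι) :
    offDiag a b d (x :: L) = (L.map a).prod * b x + offDiag a b d L * d x := rfl

lemma offDiag_append (P Q : List ι) :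
    offDiag a b d (P ++ Q) =
      (Q.map a).prod * offDiag a b d P + offDiag a b d Q * (P.map d).prod := by
  induction P with
  | nil => simp
  | cons x P ih => simp [ih]; ring

/-- The effect of exchanging two adjacent blocks. -/
lemma offDiag_swap (P U V Q : List ι) :
    offDiag a b d (P ++ V ++ U ++ Q) - offDiag a b d (P ++ U ++ V ++ Q) =
      (Q.map a).prod * (P.map d).prod * comm a b d U V := by
  simp only [offDiag_append, List.map_append, List.prod_append, comm, gap]
  ring

lemma comm_nil_left (V : List ι) : comm a b d [] V = 0 := by simp [comm, gap]

lemma comm_nil_right (V : List ι) : comm a b d V [] = 0 := by simp [comm, gap]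

lemma comm_swap (U V : List ι) : comm a b d U V = - comm a b d V U := by simp [comm]; ring

lemma offDiag_neg (L : List ι) : offDiag a (fun x => - b x) d L = - offDiag a b d L := by
  induction L with
  | nil => simp
  | cons x L ih => simp [ih]; ring

lemma comm_neg (U V : List ι) : comm a (fun x => - b x) d U V = - comm a b d U V := by
  simp [comm, offDiag_neg]; ring

lemma offDiag_congr {a' b' d' : ι → ℝ} {L : List ι} (ha : ∀ x ∈ L, a x = a' x)
    (hb : ∀ x ∈ L, b x = b' x) (hd : ∀ x ∈ L, d x = d' x) :
    offDiag a b d L = offDiag a' b' d' L := by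
  induction L with
  | nil => rfl
  | cons x L ih =>
    simp only [List.mem_cons, forall_eq_or_imp] at ha hb hd
    rw [offDiag_cons, offDiag_cons, ih ha.2 hb.2 hd.2, hb.1, hd.1, List.map_congr_left ha.2]

lemma offDiag_mul (c : ι → ℝ) (L : List ι) :
    offDiag (fun x => c x * a x) (fun x => c x * b x) (fun x => c x * d x) L =
      (L.map c).prod * offDiag a b d L := by
  induction L with
  | nil => simp
  | cons x L ih => simp [ih, List.prod_map_mul]; ring

lemma prod_pos_of_forall {f : ι → ℝ} {L : List ι} (h : ∀ x ∈ L, 0 < f x) :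
    0 < (L.map f).prod := by
  apply List.prod_pos
  simpa using h

end

/-! ### Convex polygons -/

/-- Twice the signed area of the triangle `p q r`; it is nonnegative for a counterclockwise
triangle. -/
def orient (p q r : ℝ × ℝ) : ℝ :=
  (q.1 - p.1) * (r.2 - q.2) - (q.2 - p.2) * (r.1 - q.1)

lemma orient_rotate (p q r : ℝ × ℝ) : orient q r p = orient p q r := by simp only [orient]; ring

/-- The cross product of the vectors from `p` to `p'` and from `q` to `q'`. -/
def sideCross (p p' q q' : ℝ × ℝ) : ℝ :=
  (p'.1 - p.1) * (q'.2 - q.2) - (p'.2 - p.2) * (q'.1 - q.1)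

/-- In a convex hexagon `p₀ ⋯ p₅`, traversed counterclockwise, the sides `p₀p₁`, `p₂p₃`, `p₄p₅`
cannot turn clockwise twice in a row. Most of the inequalities are needed in the weak form only, so
that `p₁ = p₂` and `p₃ = p₄` are not excluded by the shape of the statement. -/
lemma no_double_clockwise {p₀ p₁ p₂ p₃ p₄ p₅ : ℝ × ℝ}
    (h₀₁₂ : 0 < orient p₀ p₁ p₂) (h₀₂₃ : 0 ≤ orient p₀ p₂ p₃) (h₁₂₄ : 0 < orient p₁ p₂ p₄)
    (h₀₁₄ : 0 ≤ orient p₀ p₁ p₄) (h₁₃₄ : 0 ≤ orient p₁ p₃ p₄) (h₁₄₅ : 0 ≤ orient p₁ p₄ p₅)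
    (h₃₄₅ : 0 < orient p₃ p₄ p₅) (h₂₃₅ : 0 ≤ orient p₂ p₃ p₅) :
    ¬ (sideCross p₀ p₁ p₂ p₃ < 0 ∧ sideCross p₂ p₃ p₄ p₅ < 0) := by
  rintro ⟨h₁, h₂⟩
  obtain ⟨a₀, b₀⟩ := p₀
  obtain ⟨a₁, b₁⟩ := p₁
  obtain ⟨a₂, b₂⟩ := p₂
  obtain ⟨a₃, b₃⟩ := p₃
  obtain ⟨a₄, b₄⟩ := p₄
  obtain ⟨a₅, b₅⟩ := p₅
  simp only [orient, sideCross] at *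
  have hVY : 0 < (a₂ - a₁) * (b₃ - b₂) - (b₂ - b₁) * (a₃ - a₂) := by linarith
  have hYZ : 0 < (a₃ - a₂) * (b₄ - b₃) - (b₃ - b₂) * (a₄ - a₃) := by linarith
  have e₁ := mul_pos (neg_pos.2 h₁) h₁₂₄
  have e₂ := mul_nonneg hVY.le h₀₁₄
  have e₃ := mul_nonneg hYZ.le h₁₄₅
  have e₄ := mul_nonneg (neg_pos.2 h₂).le h₁₃₄
  -- By the Plücker relations, the cross product of the side `p₂p₃` with the diagonal `p₁p₄` would
  -- have two contradictory signs.
  have hneg : (a₃ - a₂) * (b₄ - b₁) - (b₃ - b₂) * (a₄ - a₁) < 0 := by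
    by_contra! h
    have := mul_nonneg h h₀₁₂.le
    linarith
  have := mul_pos (neg_pos.2 hneg) h₃₄₅
  linarith

section
variable {ι : Type*} {a b d : ι → ℝ}

/-- The vertex between the prefix `P` and the suffix `Q` on the polygon attached to the sequence
`P ++ Q`. The side that belongs to an element or a block is a multiple of the vector
`(offDiag, - gap)` of this block, and the value of the sequence is the first coordinate of the
endpoint. -/
def vertex (a b d : ι → ℝ) (P Q : List ι) : ℝ × ℝ :=
  ((Q.map a).prod * offDiag a b d P, (Q.map a).prod * (P.map d).prod)

/-- The polygon turns at a vertex according to the sign of the commutator of the adjacent blocks. Thus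
it is convex if the sequence is optimal. -/
lemma orient_vertex (P U V Q : List ι) :
    orient (vertex a b d P (U ++ V ++ Q)) (vertex a b d (P ++ U) (V ++ Q))
      (vertex a b d (P ++ U ++ V) Q) =
    (Q.map a).prod ^ 2 * (P.map d).prod ^ 2 * (V.map a).prod * (U.map d).prod *
      comm a b d U V := by
  simp [orient, vertex, offDiag_append, gap, comm]
  ring

lemma sideCross_vertex (P U Q P' U' Q' : List ι) :
    sideCross (vertex a b d P (U ++ Q)) (vertex a b d (P ++ U) Q)
      (vertex a b d P' (U' ++ Q')) (vertex a b d (P' ++ U') Q') =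
    (Q.map a).prod * (P.map d).prod * ((Q'.map a).prod * (P'.map d).prod) * comm a b d U U' := by
  simp [sideCross, vertex, offDiag_append, gap, comm]
  ring

/-- In an optimal sequence of blocks with positive diagonals, `x`, `y`, `z` in this temporal order
are not in clockwise cyclic order: at most one of the three cross products is negative. -/
lemma not_clockwise_of_blocks {x y z : ι} {V Z : List ι}
    (hax : 0 < a x) (hay : 0 < a y) (haz : 0 < a z) (haV : 0 < (V.map a).prod)
    (haZ : 0 < (Z.map a).prod) (hd : ∀ x, 0 < d x)
    (h : ∀ P U U' Q : List (List ι), P ++ U ++ U' ++ Q = [[x], V, [y], Z, [z]] →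
      U.flatten ≠ [] → U'.flatten ≠ [] → 0 < comm a b d U.flatten U'.flatten) :
    ¬ (comm a b d [x] [y] < 0 ∧ comm a b d [y] [z] < 0) ∧
    ¬ (comm a b d [y] [z] < 0 ∧ comm a b d [z] [x] < 0) ∧
    ¬ (comm a b d [z] [x] < 0 ∧ comm a b d [x] [y] < 0) := by
  have hd' : ∀ L : List ι, 0 < (L.map d).prod := fun L => prod_pos_of_forall fun x _ => hd x
  have ha' : ∀ B ∈ [[x], V, [y], Z, [z]], 0 < (B.map a).prod := by simp [*]
  let pt : List (List ι) → List (List ι) → ℝ × ℝ := fun P Q => vertex a b d P.flatten Q.flatten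
  have key : ∀ P U U' Q : List (List ι), P ++ U ++ U' ++ Q = [[x], V, [y], Z, [z]] →
      0 ≤ orient (pt P (U ++ U' ++ Q)) (pt (P ++ U) (U' ++ Q)) (pt (P ++ U ++ U') Q) ∧
      (U.flatten ≠ [] → U'.flatten ≠ [] →
        0 < orient (pt P (U ++ U' ++ Q)) (pt (P ++ U) (U' ++ Q)) (pt (P ++ U ++ U') Q)) := by
    intro P U U' Q hB
    have haf : ∀ R : List (List ι), (∀ B ∈ R, B ∈ P ++ U ++ U' ++ Q) →
        0 < (R.flatten.map a).prod := by
      intro R hR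
      rw [List.map_flatten, List.prod_flatten]
      apply List.prod_pos
      simp only [List.mem_map]
      rintro _ ⟨_, ⟨B, hBR, rfl⟩, rfl⟩
      exact ha' B (hB ▸ hR B hBR)
    have h₁ := haf Q (by simp +contextual)
    have h₂ := haf U' (by simp +contextual)
    have h₃ := hd' P.flatten
    have h₄ := hd' U.flatten
    simp only [pt, List.flatten_append, orient_vertex]
    have hc : U.flatten ≠ [] → U'.flatten ≠ [] → 0 < comm a b d U.flatten U'.flatten :=
      h P U U' Q hB
    refine ⟨mul_nonneg (by positivity) ?_, fun hU hU' => mul_pos (by positivity) (hc hU hU')⟩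
    by_cases hU : U.flatten = []
    · rw [hU, comm_nil_left]
    by_cases hU' : U'.flatten = []
    · rw [hU', comm_nil_right]
    exact (hc hU hU').le
  let p₀ := pt [] [[x], V, [y], Z, [z]]
  let p₁ := pt [[x]] [V, [y], Z, [z]]
  let p₂ := pt [[x], V] [[y], Z, [z]]
  let p₃ := pt [[x], V, [y]] [Z, [z]]
  let p₄ := pt [[x], V, [y], Z] [[z]]
  let p₅ := pt [[x], V, [y], Z, [z]] []
  have o₀₁₂ : 0 ≤ orient p₀ p₁ p₂ ∧ (_ → _ → 0 < orient p₀ p₁ p₂) :=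
    key [] [[x]] [V] [[y], Z, [z]] rfl
  have o₀₁₃ : 0 ≤ orient p₀ p₁ p₃ ∧ _ := key [] [[x]] [V, [y]] [Z, [z]] rfl
  have o₀₁₄ : 0 ≤ orient p₀ p₁ p₄ ∧ _ := key [] [[x]] [V, [y], Z] [[z]] rfl
  have o₀₁₅ : 0 ≤ orient p₀ p₁ p₅ ∧ (_ → _ → 0 < orient p₀ p₁ p₅) :=
    key [] [[x]] [V, [y], Z, [z]] [] rfl
  have o₀₂₃ : 0 ≤ orient p₀ p₂ p₃ ∧ _ := key [] [[x], V] [[y]] [Z, [z]] rfl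
  have o₀₂₅ : 0 ≤ orient p₀ p₂ p₅ ∧ (_ → _ → 0 < orient p₀ p₂ p₅) :=
    key [] [[x], V] [[y], Z, [z]] [] rfl
  have o₀₃₄ : 0 ≤ orient p₀ p₃ p₄ ∧ (_ → _ → 0 < orient p₀ p₃ p₄) :=
    key [] [[x], V, [y]] [Z] [[z]] rfl
  have o₀₃₅ : 0 ≤ orient p₀ p₃ p₅ ∧ _ := key [] [[x], V, [y]] [Z, [z]] [] rfl
  have o₀₄₅ : 0 ≤ orient p₀ p₄ p₅ ∧ (_ → _ → 0 < orient p₀ p₄ p₅) :=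
    key [] [[x], V, [y], Z] [[z]] [] rfl
  have o₁₂₃ : 0 ≤ orient p₁ p₂ p₃ ∧ (_ → _ → 0 < orient p₁ p₂ p₃) :=
    key [[x]] [V] [[y]] [Z, [z]] rfl
  have o₁₂₄ : 0 ≤ orient p₁ p₂ p₄ ∧ (_ → _ → 0 < orient p₁ p₂ p₄) :=
    key [[x]] [V] [[y], Z] [[z]] rfl
  have o₁₂₅ : 0 ≤ orient p₁ p₂ p₅ ∧ _ := key [[x]] [V] [[y], Z, [z]] [] rfl
  have o₁₃₄ : 0 ≤ orient p₁ p₃ p₄ ∧ _ := key [[x]] [V, [y]] [Z] [[z]] rfl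
  have o₁₄₅ : 0 ≤ orient p₁ p₄ p₅ ∧ _ := key [[x]] [V, [y], Z] [[z]] [] rfl
  have o₂₃₄ : 0 ≤ orient p₂ p₃ p₄ ∧ (_ → _ → 0 < orient p₂ p₃ p₄) :=
    key [[x], V] [[y]] [Z] [[z]] rfl
  have o₂₃₅ : 0 ≤ orient p₂ p₃ p₅ ∧ _ := key [[x], V] [[y]] [Z, [z]] [] rfl
  have o₂₄₅ : 0 ≤ orient p₂ p₄ p₅ ∧ _ := key [[x], V] [[y], Z] [[z]] [] rfl
  have o₃₄₅ : 0 ≤ orient p₃ p₄ p₅ ∧ (_ → _ → 0 < orient p₃ p₄ p₅) :=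
    key [[x], V, [y]] [Z] [[z]] [] rfl
  have side : ∀ P U Q P' U' Q' : List (List ι), P ++ U ++ Q = [[x], V, [y], Z, [z]] →
      P' ++ U' ++ Q' = [[x], V, [y], Z, [z]] → comm a b d U.flatten U'.flatten < 0 →
      sideCross (pt P (U ++ Q)) (pt (P ++ U) Q) (pt P' (U' ++ Q')) (pt (P' ++ U') Q') < 0 := by
    intro P U Q P' U' Q' hB hB' hc
    have haf : ∀ R : List (List ι), (∀ B ∈ R, B ∈ [[x], V, [y], Z, [z]]) →
        0 < (R.flatten.map a).prod := by
      intro R hR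
      rw [List.map_flatten, List.prod_flatten]
      apply List.prod_pos
      simp only [List.mem_map]
      rintro _ ⟨_, ⟨B, hBR, rfl⟩, rfl⟩
      exact ha' B (hR B hBR)
    have h₁ := haf Q (by rw [← hB]; simp +contextual)
    have h₂ := haf Q' (by rw [← hB']; simp +contextual)
    have h₃ := hd' P.flatten
    have h₄ := hd' P'.flatten
    simp only [pt, List.flatten_append, sideCross_vertex]
    exact mul_neg_of_pos_of_neg (by positivity) hc
  have sxy : comm a b d [x] [y] < 0 → sideCross p₀ p₁ p₂ p₃ < 0 :=
    side [] [[x]] [V, [y], Z, [z]] [[x], V] [[y]] [Z, [z]] rfl rfl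
  have syz : comm a b d [y] [z] < 0 → sideCross p₂ p₃ p₄ p₅ < 0 :=
    side [[x], V] [[y]] [Z, [z]] [[x], V, [y], Z] [[z]] [] rfl rfl
  have szx : comm a b d [z] [x] < 0 → sideCross p₄ p₅ p₀ p₁ < 0 :=
    side [[x], V, [y], Z] [[z]] [] [] [[x]] [V, [y], Z, [z]] rfl rfl
  have hV : comm a b d [x] [y] < 0 → V ≠ [] := by
    rintro hxy rfl
    have := h [] [[x]] [[], [y]] [Z, [z]] rfl (by simp) (by simp)
    simp only [List.flatten_cons, List.flatten_nil, List.append_nil, List.nil_append] at this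
    linarith
  have hZ : comm a b d [y] [z] < 0 → Z ≠ [] := by
    rintro hyz rfl
    have := h [[x], V] [[y]] [[], [z]] [] rfl (by simp) (by simp)
    simp only [List.flatten_cons, List.flatten_nil, List.append_nil, List.nil_append] at this
    linarith
  have rot₁ : ∀ p q r : ℝ × ℝ, orient p q r = orient q r p := fun p q r => (orient_rotate p q r).symm
  have rot₂ : ∀ p q r : ℝ × ℝ, orient p q r = orient r p q := fun p q r => orient_rotate r p q
  refine ⟨fun ⟨h₁, h₂⟩ => ?_, fun ⟨h₁, h₂⟩ => ?_, fun ⟨h₁, h₂⟩ => ?_⟩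
  · have hV := hV h₁
    have hZ := hZ h₂
    exact no_double_clockwise (o₀₁₂.2 (by simp) (by simpa)) o₀₂₃.1 (o₁₂₄.2 (by simpa) (by simp))
      o₀₁₄.1 o₁₃₄.1 o₁₄₅.1 (o₃₄₅.2 (by simpa) (by simp)) o₂₃₅.1 ⟨sxy h₁, syz h₂⟩
  · have hZ := hZ h₁
    exact no_double_clockwise (o₂₃₄.2 (by simp) (by simpa)) o₂₄₅.1
      (rot₁ _ _ _ ▸ o₀₃₄.2 (by simp) (by simpa)) (rot₁ _ _ _ ▸ o₀₂₃.1) (rot₁ _ _ _ ▸ o₀₃₅.1)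
      (rot₂ _ _ _ ▸ o₀₁₃.1) (rot₂ _ _ _ ▸ o₀₁₅.2 (by simp) (by simp)) (rot₁ _ _ _ ▸ o₁₄₅.1)
      ⟨syz h₁, szx h₂⟩
  · have hV := hV h₂
    exact no_double_clockwise (rot₁ _ _ _ ▸ o₀₄₅.2 (by simp) (by simp)) (rot₂ _ _ _ ▸ o₀₁₄.1)
      (rot₂ _ _ _ ▸ o₀₂₅.2 (by simp) (by simp)) (rot₁ _ _ _ ▸ o₂₄₅.1) (rot₂ _ _ _ ▸ o₁₂₅.1)
      (rot₂ _ _ _ ▸ o₂₃₅.1) (o₁₂₃.2 (by simpa) (by simp)) o₀₁₃.1 ⟨szx h₁, sxy h₂⟩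

end

/-! ### Optimal sequences of a regular instance -/

section
variable {ι : Type*} {a b d : ι → ℝ}

/-- The sequence `W` minimises the upper right entry of the product among its rearrangements. -/
def IsMinimal (a b d : ι → ℝ) (W : List ι) : Prop :=
  ∀ W' : List ι, W'.Perm W → offDiag a b d W ≤ offDiag a b d W'

/-- Exchanging two adjacent blocks of an optimal sequence does not improve it. -/
lemma IsMinimal.comm_nonneg {W : List ι} (h : IsMinimal a b d W) (hd : ∀ x, 0 < d x)
    {P U V Q : List ι} (hW : W = P ++ U ++ V ++ Q) : 0 ≤ (Q.map a).prod * comm a b d U V := by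
  have hp : (P ++ V ++ U ++ Q).Perm W := by
    subst hW
    simp only [List.append_assoc]
    refine List.Perm.append_left _ ?_
    rw [← List.append_assoc, ← List.append_assoc]
    exact List.perm_append_comm.append_right _
  have h₁ := h _ hp
  have h₂ := offDiag_swap (a := a) (b := b) (d := d) P U V Q
  have h₃ : 0 < (P.map d).prod := prod_pos_of_forall fun x _ => hd x
  rw [← hW] at h₂
  have h₄ : 0 ≤ (P.map d).prod * ((Q.map a).prod * comm a b d U V) := by nlinarith
  exact nonneg_of_mul_nonneg_right h₄ h₃

lemma exists_append_of_triple_sublist {W : List ι} {x y z : ι} (h : [x, y, z].Sublist W) :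
    ∃ U V Z T, W = U ++ x :: V ++ y :: Z ++ z :: T := by
  obtain ⟨r₁, r₂, rfl, hx, h⟩ := List.cons_sublist_iff.1 h
  obtain ⟨r₃, r₄, rfl, hy, h⟩ := List.cons_sublist_iff.1 h
  have hz := List.singleton_sublist.1 h
  obtain ⟨U, V, rfl⟩ := List.append_of_mem hx
  obtain ⟨V', Z, rfl⟩ := List.append_of_mem hy
  obtain ⟨Z', T, rfl⟩ := List.append_of_mem hz
  exact ⟨U, V ++ V', Z ++ Z', T, by simp⟩

lemma exists_append_of_pair {W : List ι} {x y : ι} (hx : x ∈ W) (hy : y ∈ W) (hxy : x ≠ y) :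
    (∃ U Z T, W = U ++ x :: Z ++ y :: T) ∨ ∃ U Z T, W = U ++ y :: Z ++ x :: T := by
  obtain ⟨U, V, rfl⟩ := List.append_of_mem hx
  simp only [List.mem_append, List.mem_cons, hxy.symm, false_or] at hy
  rcases hy with hy | hy
  · obtain ⟨U, Z, rfl⟩ := List.append_of_mem hy
    exact Or.inr ⟨U, Z, V, by simp⟩
  · obtain ⟨Z, T, rfl⟩ := List.append_of_mem hy
    exact Or.inl ⟨U, Z, T, by simp⟩

/-- At least two of the three consecutive cross products are positive: the directions of `x`, `y`,
`z` are in strict counterclockwise cyclic order. -/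
def CyclicOrder (a b d : ι → ℝ) (x y z : ι) : Prop :=
  (0 < comm a b d [x] [y] ∧ 0 < comm a b d [y] [z]) ∨
  (0 < comm a b d [y] [z] ∧ 0 < comm a b d [z] [x]) ∨
  (0 < comm a b d [z] [x] ∧ 0 < comm a b d [x] [y])

lemma CyclicOrder.rotate {x y z : ι} (h : CyclicOrder a b d x y z) : CyclicOrder a b d y z x := by
  unfold CyclicOrder at *; tauto

/-- No two disjoint nonempty blocks of elements of `L` have proportional vectors. -/
def Generic (a b d : ι → ℝ) (L : List ι) : Prop :=
  ∀ U V : List ι, U ≠ [] → V ≠ [] → (U ++ V).Nodup → U ++ V ⊆ L → comm a b d U V ≠ 0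

lemma Generic.neg {L : List ι} (h : Generic a b d L) : Generic a (fun x => - b x) d L := by
  intro U V hU hV hn hs
  rw [comm_neg, neg_ne_zero]
  exact h U V hU hV hn hs

lemma not_cyclicOrder_of_comm_pos {W U V Z T : List ι} {x y z : ι}
    (hd : ∀ x, 0 < d x) (hnd : W.Nodup) (hgen : Generic a b d W)
    (hmin : ∀ P U V Q, W = P ++ U ++ V ++ (Q ++ T) → 0 ≤ (Q.map a).prod * comm a b d U V)
    (hW : W = U ++ x :: V ++ y :: Z ++ z :: T)
    (hax : 0 < a x) (hay : 0 < a y) (haz : 0 < a z) (haV : 0 < (V.map a).prod)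
    (haZ : 0 < (Z.map a).prod) : ¬ CyclicOrder a b d z y x := by
  have key := not_clockwise_of_blocks (a := a) (b := b) (d := d) (x := x) (y := y) (z := z)
    (V := V) (Z := Z) hax hay haz haV haZ hd ?_
  · unfold CyclicOrder
    rw [comm_swap [z] [y], comm_swap [y] [x], comm_swap [x] [z]]
    simp only [neg_pos]
    tauto
  intro P B B' Q hB hB₁ hB₂
  have hW' : W = (U ++ P.flatten) ++ B.flatten ++ B'.flatten ++ (Q.flatten ++ T) := by
    have := congrArg List.flatten hB
    simp only [List.flatten_append, List.flatten_cons, List.flatten_nil] at this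
    calc W = U ++ ([x] ++ (V ++ ([y] ++ (Z ++ ([z] ++ []))))) ++ T := by rw [hW]; simp
      _ = _ := by rw [← this]; simp
  have h := hmin _ _ _ _ hW'
  have hQ : 0 < (Q.flatten.map a).prod := by
    rw [List.map_flatten, List.prod_flatten]
    apply List.prod_pos
    simp only [List.mem_map]
    rintro _ ⟨_, ⟨C, hC, rfl⟩, rfl⟩
    have hC' : C ∈ [[x], V, [y], Z, [z]] := by rw [← hB]; simp [hC]
    simp only [List.mem_cons, List.not_mem_nil, or_false] at hC'
    rcases hC' with rfl | rfl | rfl | rfl | rfl <;> simpa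
  have h₁ := nonneg_of_mul_nonneg_right h hQ
  refine lt_of_le_of_ne h₁ (Ne.symm (hgen _ _ hB₁ hB₂ ?_ ?_))
  · refine List.Nodup.sublist ?_ hnd
    rw [hW']
    have h₂ : (U ++ P.flatten) ++ B.flatten ++ B'.flatten ++ (Q.flatten ++ T) =
        (U ++ P.flatten) ++ ((B.flatten ++ B'.flatten) ++ (Q.flatten ++ T)) := by simp
    rw [h₂]
    exact (List.sublist_append_left _ _).trans (List.sublist_append_right _ _)
  · rw [hW']
    intro u hu
    simp only [List.mem_append] at hu ⊢
    tauto

/-- In an optimal sequence, if the entries `a` of `x`, `y`, `z` and of the blocks between them are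
positive, the directions of `x`, `y`, `z` are not in reverse cyclic order or not in cyclic order,
according to the sign of the entry `a` of the part that follows. -/
lemma IsMinimal.not_cyclicOrder {W U V Z T : List ι} {x y z : ι} (hmin : IsMinimal a b d W)
    (hd : ∀ x, 0 < d x) (hnd : W.Nodup) (hgen : Generic a b d W)
    (hW : W = U ++ x :: V ++ y :: Z ++ z :: T)
    (hax : 0 < a x) (hay : 0 < a y) (haz : 0 < a z) (haV : 0 < (V.map a).prod)
    (haZ : 0 < (Z.map a).prod) :
    (0 < (T.map a).prod → ¬ CyclicOrder a b d z y x) ∧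
    ((T.map a).prod < 0 → ¬ CyclicOrder a b d x y z) := by
  constructor
  · intro hT
    refine not_cyclicOrder_of_comm_pos hd hnd hgen (fun P U V Q h => ?_) hW
      hax hay haz haV haZ
    have h₁ := hmin.comm_nonneg hd h
    rw [List.map_append, List.prod_append] at h₁
    exact nonneg_of_mul_nonneg_right (by linarith : 0 ≤ (T.map a).prod * _) hT
  · intro hT
    have key := not_cyclicOrder_of_comm_pos hd hnd hgen.neg (fun P U V Q h => ?_) hW
      hax hay haz haV haZ
    · simp only [CyclicOrder, comm_neg, ← comm_swap] at key ⊢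
      tauto
    have h₁ := hmin.comm_nonneg hd h
    rw [List.map_append, List.prod_append] at h₁
    rw [comm_neg]
    have h₂ : 0 ≤ -(T.map a).prod * ((Q.map a).prod * - comm a b d U V) := by linarith
    exact nonneg_of_mul_nonneg_right h₂ (neg_pos.2 hT)

/-- In an optimal sequence, if the diagonal entry `a` of everything after `e` is positive and that
of everything after `o` is negative, the direction of `e` precedes that of `o` in the upper half
plane and follows it in the lower half plane. -/
lemma IsMinimal.comm_pair {W : List ι} {e o : ι} (hmin : IsMinimal a b d W) (hd : ∀ x, 0 < d x)
    (hae : 0 < a e) (hao : 0 < a o) {Ue Te Uo To : List ι} (he : W = Ue ++ e :: Te)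
    (ho : W = Uo ++ o :: To) (hnd : W.Nodup) (hTe : 0 < (Te.map a).prod)
    (hTo : (To.map a).prod < 0) :
    (0 < gap a d [e] → 0 < gap a d [o] → 0 ≤ comm a b d [e] [o]) ∧
    (gap a d [e] < 0 → gap a d [o] < 0 → comm a b d [e] [o] ≤ 0) := by
  have hne : e ≠ o := by
    rintro rfl
    have hn := hnd
    rw [he] at hn ho
    have h₁ : e ∉ Ue := fun h => (List.nodup_append.1 hn).2.2 e h e (by simp) rfl
    have h₂ : e ∉ Te := (List.nodup_cons.1 (List.nodup_append.1 hn).2.1).1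
    obtain ⟨rfl, -, rfl⟩ := (List.append_cons_inj_of_notMem h₁ h₂).1 ho
    linarith
  have tail_unique : ∀ {x : ι} {U T U' T' : List ι}, W = U ++ x :: T → W = U' ++ x :: T' →
      T = T' := by
    intro x U T U' T' h h'
    have hn := hnd
    rw [h] at hn h'
    have h₁ : x ∉ U := fun h => (List.nodup_append.1 hn).2.2 x h x (by simp) rfl
    have h₂ : x ∉ T := (List.nodup_cons.1 (List.nodup_append.1 hn).2.1).1
    exact ((List.append_cons_inj_of_notMem h₁ h₂).1 h').2.2
  have hdl : ∀ L : List ι, 0 < (L.map d).prod := fun L => prod_pos_of_forall fun x _ => hd x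
  have heW : e ∈ W := by rw [he]; simp
  have hoW : o ∈ W := by rw [ho]; simp
  rcases exists_append_of_pair heW hoW hne with ⟨U, Z, T, h⟩ | ⟨U, Z, T, h⟩
  · obtain rfl : To = T := tail_unique ho h
    obtain rfl : Te = Z ++ o :: To := tail_unique (U' := U) he (by rw [h]; simp)
    simp only [List.map_append, List.map_cons, List.prod_append, List.prod_cons] at hTe
    have hZ : (Z.map a).prod < 0 := by
      by_contra! hZ
      have := mul_nonpos_of_nonneg_of_nonpos hZ (mul_neg_of_pos_of_neg hao hTo).le
      linarith
    have h₁ := hmin.comm_nonneg hd (P := U) (U := [e]) (V := Z) (Q := o :: To) (by rw [h]; simp)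
    have h₂ := hmin.comm_nonneg hd (P := U ++ [e]) (U := Z) (V := [o]) (Q := To)
      (by rw [h]; simp)
    rw [List.map_cons, List.prod_cons] at h₁
    have h₁' : comm a b d [e] Z ≤ 0 := by
      by_contra! hc
      have := mul_neg_of_neg_of_pos (mul_neg_of_pos_of_neg hao hTo) hc
      linarith
    have h₂' : comm a b d Z [o] ≤ 0 := by
      by_contra! hc
      have := mul_neg_of_neg_of_pos hTo hc
      linarith
    have hg : gap a d Z < 0 := by have := hdl Z; unfold gap; linarith
    simp only [comm] at h₁' h₂' ⊢
    constructor
    · intro ge go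
      have k₁ := mul_nonpos_of_nonneg_of_nonpos go.le h₁'
      have k₂ := mul_nonpos_of_nonneg_of_nonpos ge.le h₂'
      by_contra! hc
      have := mul_pos_of_neg_of_neg hg hc
      linarith
    · intro ge go
      have k₁ := mul_nonneg_of_nonpos_of_nonpos go.le h₁'
      have k₂ := mul_nonneg_of_nonpos_of_nonpos ge.le h₂'
      by_contra! hc
      have := mul_neg_of_neg_of_pos hg hc
      linarith
  · obtain rfl : Te = T := tail_unique he h
    obtain rfl : To = Z ++ e :: Te := tail_unique (U' := U) ho (by rw [h]; simp)
    simp only [List.map_append, List.map_cons, List.prod_append, List.prod_cons] at hTo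
    have hZ : (Z.map a).prod < 0 := by
      by_contra! hZ
      have := mul_nonneg hZ (mul_pos hae hTe).le
      linarith
    have h₁ := hmin.comm_nonneg hd (P := U) (U := [o]) (V := Z) (Q := e :: Te) (by rw [h]; simp)
    have h₂ := hmin.comm_nonneg hd (P := U ++ [o]) (U := Z) (V := [e]) (Q := Te)
      (by rw [h]; simp)
    rw [List.map_cons, List.prod_cons] at h₁
    have h₁' : 0 ≤ comm a b d [o] Z := nonneg_of_mul_nonneg_right h₁ (mul_pos hae hTe)
    have h₂' : 0 ≤ comm a b d Z [e] := nonneg_of_mul_nonneg_right h₂ hTe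
    have hg : gap a d Z < 0 := by have := hdl Z; unfold gap; linarith
    simp only [comm] at h₁' h₂' ⊢
    constructor
    · intro ge go
      have k₁ := mul_nonneg ge.le h₁'
      have k₂ := mul_nonneg go.le h₂'
      by_contra! hc
      have := mul_pos_of_neg_of_neg hg hc
      linarith
    · intro ge go
      have k₁ := mul_nonpos_of_nonpos_of_nonneg ge.le h₁'
      have k₂ := mul_nonpos_of_nonpos_of_nonneg go.le h₂'
      by_contra! hc
      have := mul_neg_of_neg_of_pos hg hc
      linarith

end

/-! ### Cyclically sorted lists -/

section
variable {ι : Type*} {a b d : ι → ℝ}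

lemma not_sublist_swap {l : List ι} (hl : l.Nodup) {y z : ι} (h : [y, z].Sublist l) :
    ¬ [z, y].Sublist l := by
  induction l with
  | nil => simp at h
  | cons x l ih =>
    rw [List.nodup_cons] at hl
    intro h'
    have hyz : y ≠ z := by
      rintro rfl
      have := h.nodup (List.nodup_cons.2 hl)
      simp at this
    rw [List.sublist_cons_iff] at h h'
    rcases h with h | ⟨r, hr, h⟩ <;> rcases h' with h' | ⟨r', hr', h'⟩
    · exact ih hl.2 h h'
    · simp only [List.cons.injEq] at hr'
      exact hl.1 (hr'.1 ▸ h.subset (by simp))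
    · simp only [List.cons.injEq] at hr
      exact hl.1 (hr.1 ▸ h'.subset (by simp))
    · simp only [List.cons.injEq] at hr hr'
      exact hyz (hr.1.trans hr'.1.symm)

/-- A cyclically sorted list stays cyclically sorted when it is rotated such that it begins with a
given element. -/
lemma CyclicOrder.of_rotation {A B : List ι} {x y z : ι}
    (hK : ∀ p q r, [p, q, r].Sublist (A ++ x :: B) → CyclicOrder a b d p q r)
    (h : [y, z].Sublist (B ++ A)) : CyclicOrder a b d x y z := by
  obtain ⟨l₁, l₂, hl, h₁, h₂⟩ := List.sublist_append_iff.1 h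
  match l₁, l₂, hl with
  | [], _, rfl => exact (hK y z x (h₂.append (List.singleton_sublist.2 (by simp)))).rotate.rotate
  | [_], [_], rfl =>
    exact (hK z x y (List.Sublist.append (l₁ := [z]) h₂ (h₁.cons_cons x))).rotate
  | [_, _], [], rfl => exact hK x y z ((h₁.cons_cons x).trans (List.sublist_append_right _ _))

/-- A rearrangement of a part of a cyclically sorted list `K` without triples in reverse cyclic
order is the corresponding part of a rotation of `K`. -/
lemma exists_eq_filter_rotate [DecidableEq ι] {K L : List ι} {p : ι → Bool} (hKn : K.Nodup)
    (hK : ∀ x y z, [x, y, z].Sublist K → CyclicOrder a b d x y z)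
    (hp : L.Perm (K.filter p)) (hL : ∀ x y z, [x, y, z].Sublist L → ¬ CyclicOrder a b d z y x) :
    ∃ m ≤ K.length, L = (K.rotate m).filter p := by
  cases L with
  | nil => exact ⟨0, by simp, by simpa using hp⟩
  | cons x L =>
    have hx : x ∈ K.filter p := hp.subset (by simp)
    obtain ⟨A, B, rfl⟩ := List.append_of_mem (List.mem_filter.1 hx).1
    have hrot : (A ++ x :: B).rotate A.length = x :: (B ++ A) := by
      rw [List.rotate_append_length_eq]; simp
    refine ⟨A.length, by simp, ?_⟩
    have hKn' : (x :: (B ++ A)).Nodup := by rw [← hrot]; exact List.nodup_rotate.2 hKn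
    have hp' : (x :: L).Perm ((x :: (B ++ A)).filter p) := by
      rw [← hrot]; exact hp.trans ((List.rotate_perm _ _).symm.filter p)
    have hLn : (x :: L).Nodup := hp'.nodup_iff.2 (hKn'.filter _)
    rw [hrot]
    refine List.Perm.eq_of_pairwise (le := fun y z => [y, z].Sublist (x :: (B ++ A)))
      (fun y z _ _ h h' => absurd h' (not_sublist_swap hKn' h)) ?_ ?_ hp'
    · have hmem : ∀ y ∈ L, y ∈ B ++ A := fun y hy => by
        have h₁ : y ∈ x :: (B ++ A) := (List.mem_filter.1 (hp'.subset (by simp [hy]))).1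
        have h₂ : y ≠ x := fun h => (List.nodup_cons.1 hLn).1 (h ▸ hy)
        simpa [h₂] using h₁
      rw [List.pairwise_cons]
      refine ⟨fun y hy => (List.singleton_sublist.2 (hmem y hy)).cons_cons x, ?_⟩
      rw [List.pairwise_iff_forall_sublist]
      intro y z hyz
      have hyz' : y ≠ z := by
        rintro rfl
        have := hyz.nodup (List.nodup_cons.1 hLn).2
        simp at this
      by_contra hc
      have hzy : [z, y].Sublist (B ++ A) := by
        rcases exists_append_of_pair (hmem y (hyz.subset (by simp))) (hmem z (hyz.subset (by simp)))
          hyz' with ⟨U, Z, T, h⟩ | ⟨U, Z, T, h⟩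
        · refine absurd ?_ hc
          refine List.Sublist.trans ?_ (List.sublist_cons_self x _)
          rw [h, List.append_assoc]
          refine List.Sublist.trans ?_ (List.sublist_append_right U _)
          exact List.Sublist.cons_cons y (List.singleton_sublist.2 (by simp))
        · rw [h, List.append_assoc]
          refine List.Sublist.trans ?_ (List.sublist_append_right U _)
          exact List.Sublist.cons_cons z (List.singleton_sublist.2 (by simp))
      exact hL x y z (hyz.cons_cons x) (CyclicOrder.of_rotation hK hzy).rotate
    · rw [List.pairwise_iff_forall_sublist]
      exact fun h => h.trans List.filter_sublist

lemma exists_split_of_pairwise {q : ι → Prop} {P : List ι}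
    (h : P.Pairwise fun x y => q x → q y) :
    ∃ P₁ P₂, P = P₁ ++ P₂ ∧ (∀ x ∈ P₁, ¬ q x) ∧ ∀ x ∈ P₂, q x := by
  induction P with
  | nil => exact ⟨[], [], by simp⟩
  | cons x P ih =>
    rw [List.pairwise_cons] at h
    by_cases hx : q x
    · exact ⟨[], x :: P, by simp, by simp, by simpa [hx] using fun y hy => h.1 y hy hx⟩
    · obtain ⟨P₁, P₂, rfl, h₁, h₂⟩ := ih h.2
      exact ⟨x :: P₁, P₂, by simp, by simpa [hx] using h₁, h₂⟩

end

section
variable {ι : Type*} {a b d : ι → ℝ}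

/-- A list that is sorted by angle is cyclically sorted. -/
lemma cyclicOrder_of_sublist {P N : List ι} (hP : ∀ x ∈ P, 0 < gap a d [x])
    (hN : ∀ x ∈ N, gap a d [x] < 0) (hPs : P.Pairwise fun x y => 0 < comm a b d [x] [y])
    (hNs : N.Pairwise fun x y => 0 < comm a b d [x] [y]) {x y z : ι}
    (h : [x, y, z].Sublist (P ++ N)) : CyclicOrder a b d x y z := by
  have hPs' : ∀ {x y : ι}, [x, y].Sublist P → 0 < comm a b d [x] [y] := fun h =>
    List.pairwise_iff_forall_sublist.1 hPs h
  have hNs' : ∀ {x y : ι}, [x, y].Sublist N → 0 < comm a b d [x] [y] := fun h =>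
    List.pairwise_iff_forall_sublist.1 hNs h
  obtain ⟨l₁, l₂, hl, h₁, h₂⟩ := List.sublist_append_iff.1 h
  -- If two directions lie in one half plane and the third, `u`, in the other one, the opposite of
  -- `u` cannot be both before the first and after the second.
  match l₁, l₂, hl with
  | [], _, rfl =>
    exact Or.inl ⟨hNs' (List.Sublist.trans (by simp) h₂), hNs' (List.Sublist.trans (by simp) h₂)⟩
  | [_], [_, _], rfl =>
    have c := hNs' h₂
    have gx := hP x (h₁.subset (by simp))
    have gy := hN y (h₂.subset (by simp))
    have gz := hN z (h₂.subset (by simp))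
    by_cases hxy : 0 < comm a b d [x] [y]
    · exact Or.inl ⟨hxy, c⟩
    refine Or.inr (Or.inl ⟨c, ?_⟩)
    by_contra! hzx
    simp only [comm] at *
    have := mul_pos gx c
    have := mul_nonneg_of_nonpos_of_nonpos gz.le (not_lt.1 hxy)
    have := mul_nonneg_of_nonpos_of_nonpos gy.le hzx
    linarith
  | [_, _], [_], rfl =>
    have c := hPs' h₁
    have gx := hP x (h₁.subset (by simp))
    have gy := hP y (h₁.subset (by simp))
    have gz := hN z (h₂.subset (by simp))
    by_cases hyz : 0 < comm a b d [y] [z]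
    · exact Or.inl ⟨c, hyz⟩
    refine Or.inr (Or.inr ⟨?_, c⟩)
    by_contra! hzx
    simp only [comm] at *
    have := mul_neg_of_neg_of_pos gz c
    have := mul_nonpos_of_nonneg_of_nonpos gx.le (not_lt.1 hyz)
    have := mul_nonpos_of_nonneg_of_nonpos gy.le hzx
    linarith
  | [_, _, _], [], rfl =>
    exact Or.inl ⟨hPs' (List.Sublist.trans (by simp) h₁), hPs' (List.Sublist.trans (by simp) h₁)⟩

/-! ### The structure of optimal sequences -/

/-- The shape of a candidate sequence `W`, for a sorted list `K` of the elements with nonnegative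
determinant and a list `negs` of those with negative determinant. A contiguous part `K₂` of `K` is
used in reverse cyclic order and the complementary part in cyclic order, both starting anywhere;
the elements of `negs` are interspersed arbitrarily. -/
def Structured [DecidableEq ι] (K negs W : List ι) : Prop :=
  W.Perm (K ++ negs) ∧ ∃ (K₁ K₂ K₃ : List ι) (m l : ℕ), K = K₁ ++ K₂ ++ K₃ ∧
    m ≤ K.length ∧ l ≤ K.length ∧
    W.filter (· ∈ K₁ ++ K₃) = (K.rotate m).filter (· ∈ K₁ ++ K₃) ∧
    (W.filter (· ∈ K₂)).reverse = (K.rotate l).filter (· ∈ K₂) ∧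
    (negs = [] → K₂ = [])

/-- The generic situation: nonzero diagonals, `P` and `N` strictly sorted by angle in the open
upper and lower half plane. The absence of coincidences between blocks is stated separately, by
`Generic`. -/
structure Regular (a b d : ι → ℝ) (P N negs : List ι) : Prop where
  d_pos : ∀ x, 0 < d x
  a_pos : ∀ x ∈ P ++ N, 0 < a x
  a_neg : ∀ x ∈ negs, a x < 0
  gap_pos : ∀ x ∈ P, 0 < gap a d [x]
  gap_neg : ∀ x ∈ N, gap a d [x] < 0
  sorted_pos : P.Pairwise fun x y => 0 < comm a b d [x] [y]
  sorted_neg : N.Pairwise fun x y => 0 < comm a b d [x] [y]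

/-- In a generic instance, every optimal sequence is structured. The block `K₂` consists of the
elements that are followed by an odd number of elements of `negs`: it is contiguous by
`IsMinimal.comm_pair`, and by `IsMinimal.not_cyclicOrder` it is used in reverse cyclic order and the
rest of `K` in cyclic order. -/
lemma IsMinimal.structured [DecidableEq ι] {P N negs W : List ι} (hmin : IsMinimal a b d W)
    (hreg : Regular a b d P N negs) (hgen : Generic a b d (P ++ N ++ negs))
    (hn : (P ++ N ++ negs).Nodup) (hW : W.Perm (P ++ N ++ negs)) :
    Structured (P ++ N) negs W := by
  classical
  have hWn : W.Nodup := hW.nodup_iff.2 hn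
  have hKn : (P ++ N).Nodup := (List.nodup_append.1 hn).1
  have hgenW : Generic a b d W := fun U V hU hV hUV hs =>
    hgen U V hU hV hUV fun u hu => hW.subset (hs hu)
  have hd := hreg.d_pos
  have ha0 : ∀ L : List ι, L ⊆ W → (L.map a).prod ≠ 0 := by
    intro L hL
    rw [Ne, List.prod_eq_zero_iff]
    simp only [List.mem_map, not_exists, not_and]
    intro x hx
    have := hW.subset (hL hx)
    rw [List.mem_append] at this
    rcases this with h | h
    · exact (hreg.a_pos x h).ne'
    · exact (hreg.a_neg x h).ne
  have hKW : ∀ x ∈ P ++ N, x ∈ W := fun x hx => hW.symm.subset (List.mem_append_left _ hx)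
  -- `q x`: the number of negative factors after `x` is odd.
  let q : ι → Prop := fun x => ∃ U T, W = U ++ x :: T ∧ (T.map a).prod < 0
  have tail_unique : ∀ {x : ι} {U T U' T' : List ι}, W = U ++ x :: T → W = U' ++ x :: T' →
      T = T' := by
    intro x U T U' T' h h'
    have hn := hWn
    rw [h] at hn h'
    have h₁ : x ∉ U := fun h => (List.nodup_append.1 hn).2.2 x h x (by simp) rfl
    have h₂ : x ∉ T := (List.nodup_cons.1 (List.nodup_append.1 hn).2.1).1
    exact ((List.append_cons_inj_of_notMem h₁ h₂).1 h').2.2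
  have q_iff : ∀ {x : ι} {U T : List ι}, W = U ++ x :: T → (q x ↔ (T.map a).prod < 0) := by
    intro x U T h
    refine ⟨?_, fun hT => ⟨U, T, h, hT⟩⟩
    rintro ⟨U', T', h', hT⟩
    rwa [tail_unique h h']
  have not_q_iff : ∀ {x : ι} {U T : List ι}, W = U ++ x :: T →
      (¬ q x ↔ 0 < (T.map a).prod) := by
    intro x U T h
    rw [q_iff h, not_lt]
    have := ha0 T (by rw [h]; intro; simp +contextual)
    exact ⟨fun h => lt_of_le_of_ne h this.symm, le_of_lt⟩
  have pair : ∀ e ∈ P ++ N, ∀ o ∈ P ++ N, ¬ q e → q o →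
      (0 < gap a d [e] → 0 < gap a d [o] → 0 ≤ comm a b d [e] [o]) ∧
      (gap a d [e] < 0 → gap a d [o] < 0 → comm a b d [e] [o] ≤ 0) := by
    intro e he o ho hqe hqo
    obtain ⟨Ue, Te, h₁⟩ := List.append_of_mem (hKW e he)
    obtain ⟨Uo, To, h₂⟩ := List.append_of_mem (hKW o ho)
    exact hmin.comm_pair hd (hreg.a_pos e he) (hreg.a_pos o ho) h₁ h₂ hWn ((not_q_iff h₁).1 hqe)
      ((q_iff h₂).1 hqo)
  obtain ⟨P₁, P₂, rfl, hP₁, hP₂⟩ : ∃ P₁ P₂, P = P₁ ++ P₂ ∧ (∀ x ∈ P₁, ¬ q x) ∧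
      ∀ x ∈ P₂, q x := by
    refine exists_split_of_pairwise (hreg.sorted_pos.imp_of_mem ?_)
    intro x y hx hy hxy hqx
    by_contra hqy
    have := (pair y (by simp [hy]) x (by simp [hx]) hqy hqx).1 (hreg.gap_pos y hy)
      (hreg.gap_pos x hx)
    rw [comm_swap] at this
    linarith
  obtain ⟨N₁, N₂, rfl, hN₁, hN₂⟩ : ∃ N₁ N₂, N = N₁ ++ N₂ ∧ (∀ x ∈ N₁, ¬ ¬ q x) ∧
      ∀ x ∈ N₂, ¬ q x := by
    refine exists_split_of_pairwise (hreg.sorted_neg.imp_of_mem ?_)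
    intro x y hx hy hxy hqx hqy
    have := (pair x (by simp [hx]) y (by simp [hy]) hqx hqy).2 (hreg.gap_neg x hx)
      (hreg.gap_neg y hy)
    linarith
  have hcyc : ∀ x y z, [x, y, z].Sublist (P₁ ++ P₂ ++ (N₁ ++ N₂)) → CyclicOrder a b d x y z :=
    fun x y z h => cyclicOrder_of_sublist hreg.gap_pos hreg.gap_neg hreg.sorted_pos
      hreg.sorted_neg h
  have prod_pos : ∀ {A B T : List ι} {x y : ι}, W = A ++ x :: B ++ y :: T → 0 < a y →
      (q x ↔ q y) → 0 < (B.map a).prod := by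
    intro A B T x y h hy hq
    have h₁ : W = A ++ x :: (B ++ y :: T) := by rw [h]; simp
    by_cases hqy : q y
    · have k₁ := (q_iff h).1 hqy
      have k₂ := (q_iff h₁).1 (hq.2 hqy)
      simp only [List.map_append, List.map_cons, List.prod_append, List.prod_cons] at k₂
      by_contra! hc
      have := mul_nonneg_of_nonpos_of_nonpos hc (mul_neg_of_pos_of_neg hy k₁).le
      linarith
    · have k₁ := (not_q_iff h).1 hqy
      have k₂ := (not_q_iff h₁).1 (fun h => hqy (hq.1 h))
      simp only [List.map_append, List.map_cons, List.prod_append, List.prod_cons] at k₂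
      exact pos_of_mul_pos_left k₂ (mul_pos hy k₁).le
  have triple : ∀ {x y z : ι}, [x, y, z].Sublist W → x ∈ P₁ ++ P₂ ++ (N₁ ++ N₂) →
      y ∈ P₁ ++ P₂ ++ (N₁ ++ N₂) → z ∈ P₁ ++ P₂ ++ (N₁ ++ N₂) → (q x ↔ q y) → (q y ↔ q z) →
      (¬ q z → ¬ CyclicOrder a b d z y x) ∧ (q z → ¬ CyclicOrder a b d x y z) := by
    intro x y z h hx hy hz hxy hyz
    obtain ⟨U, V, Z, T, hUV⟩ := exists_append_of_triple_sublist h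
    have hV := prod_pos (A := U) (B := V) (x := x) (y := y) (T := Z ++ z :: T)
      (by rw [hUV]; simp) (hreg.a_pos y hy) hxy
    have hZ := prod_pos (A := U ++ x :: V) (B := Z) (x := y) (y := z) (T := T)
      (by rw [hUV]) (hreg.a_pos z hz) hyz
    have := hmin.not_cyclicOrder hd hWn hgenW hUV (hreg.a_pos x hx) (hreg.a_pos y hy)
      (hreg.a_pos z hz) hV hZ
    exact ⟨fun h => this.1 ((not_q_iff hUV).1 h), fun h => this.2 ((q_iff hUV).1 h)⟩
  have hEq : ∀ x ∈ P₁ ++ N₂, ¬ q x := by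
    intro x hx; rw [List.mem_append] at hx; exact hx.elim (hP₁ x) (hN₂ x)
  have hOq : ∀ x ∈ P₂ ++ N₁, q x := by
    intro x hx; rw [List.mem_append] at hx; exact hx.elim (hP₂ x) (fun h => not_not.1 (hN₁ x h))
  have hEK : ∀ x ∈ P₁ ++ N₂, x ∈ P₁ ++ P₂ ++ (N₁ ++ N₂) := by intro x; simp; tauto
  have hOK : ∀ x ∈ P₂ ++ N₁, x ∈ P₁ ++ P₂ ++ (N₁ ++ N₂) := by intro x; simp; tauto
  have hdisj : ∀ x ∈ P₁ ++ P₂ ++ (N₁ ++ N₂), x ∉ negs := fun x hx h =>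
    (List.nodup_append.1 hn).2.2 x hx x h rfl
  have filt : ∀ p : ι → Bool, (∀ x ∈ negs, p x = false) →
      (W.filter p).Perm ((P₁ ++ P₂ ++ (N₁ ++ N₂)).filter p) := by
    intro p hp
    refine (hW.filter p).trans ?_
    have h₀ : negs.filter p = [] := List.filter_eq_nil_iff.2 (by simpa using hp)
    rw [List.filter_append (P₁ ++ P₂ ++ (N₁ ++ N₂)) negs, h₀, List.append_nil]
  obtain ⟨m, hm, hmE⟩ := exists_eq_filter_rotate (a := a) (b := b) (d := d)
    (K := P₁ ++ P₂ ++ (N₁ ++ N₂)) (L := W.filter (· ∈ P₁ ++ N₂)) (p := (· ∈ P₁ ++ N₂)) hKn hcyc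
    (filt _ fun x hx => by
      rw [decide_eq_false_iff_not]; exact fun h => hdisj x (hEK x h) hx)
    (by
      intro x y z h
      have hs : ∀ u ∈ [x, y, z], u ∈ P₁ ++ N₂ := fun u hu => by
        simpa using (List.mem_filter.1 (h.subset hu)).2
      have hx := hs x (by simp)
      have hy := hs y (by simp)
      have hz := hs z (by simp)
      refine (triple (h.trans List.filter_sublist) (hEK x hx) (hEK y hy) (hEK z hz) ?_ ?_).1
        (hEq z hz)
      · simp [hEq x hx, hEq y hy]
      · simp [hEq z hz, hEq y hy])
  obtain ⟨l, hl, hlO⟩ := exists_eq_filter_rotate (a := a) (b := b) (d := d)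
    (K := P₁ ++ P₂ ++ (N₁ ++ N₂)) (L := (W.filter (· ∈ P₂ ++ N₁)).reverse) (p := (· ∈ P₂ ++ N₁)) hKn hcyc
    ((List.reverse_perm _).trans (filt _ fun x hx => by
      rw [decide_eq_false_iff_not]; exact fun h => hdisj x (hOK x h) hx))
    (by
      intro x y z h
      replace h : [z, y, x].Sublist (W.filter (· ∈ P₂ ++ N₁)) := by
        simpa using h.reverse
      have hs : ∀ u ∈ [z, y, x], u ∈ P₂ ++ N₁ := fun u hu => by
        simpa using (List.mem_filter.1 (h.subset hu)).2
      have hx := hs x (by simp)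
      have hy := hs y (by simp)
      have hz := hs z (by simp)
      refine (triple (h.trans List.filter_sublist) (hOK z hz) (hOK y hy) (hOK x hx) ?_ ?_).2
        (hOq x hx)
      · simp [hOq z hz, hOq y hy]
      · simp [hOq x hx, hOq y hy])
  refine ⟨hW, P₁, P₂ ++ N₁, N₂, m, l, by simp, hm, hl, hmE, hlO, ?_⟩
  rintro rfl
  rw [List.eq_nil_iff_forall_not_mem]
  intro x hx
  obtain ⟨U, T, hUT, hT⟩ := hOq x hx
  refine absurd hT (not_lt.2 (prod_pos_of_forall fun y hy => ?_).le)
  refine hreg.a_pos y ?_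
  have : y ∈ W := by rw [hUT]; simp [hy]
  simpa using hW.subset this

end

/-! ### Existence of a structured optimal sequence -/

section
variable {ι : Type*} {d : ι → ℝ}

open Filter Topology

/-- The parameters `a`, `b` of a family of triangular matrices; `d` stays fixed. -/
abbrev Params (ι : Type*) := (ι → ℝ) × (ι → ℝ)

lemma continuous_prod_map_fst (L : List ι) :
    Continuous fun θ : Params ι => (L.map θ.1).prod := by
  induction L with
  | nil => simpa using continuous_const
  | cons x L ih =>
    simp only [List.map_cons, List.prod_cons]
    exact ((continuous_apply x).comp continuous_fst).mul ih

lemma continuous_offDiag (L : List ι) :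
    Continuous fun θ : Params ι => offDiag θ.1 θ.2 d L := by
  induction L with
  | nil => simpa using continuous_const
  | cons x L ih =>
    simp only [offDiag_cons]
    exact ((continuous_prod_map_fst L).mul
      ((continuous_apply x).comp continuous_snd)).add (ih.mul continuous_const)

lemma continuous_gap (L : List ι) : Continuous fun θ : Params ι => gap θ.1 d L :=
  (continuous_prod_map_fst L).sub continuous_const

lemma continuous_comm (U V : List ι) :
    Continuous fun θ : Params ι => comm θ.1 θ.2 d U V :=
  ((continuous_gap U).mul (continuous_offDiag V)).sub
    ((continuous_offDiag U).mul (continuous_gap V))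

lemma eventually_update_mem [DecidableEq ι] {O : Set (Params ι)} (hO : IsOpen O) {θ : Params ι}
    (hθ : θ ∈ O) (x : ι) :
    (∀ᶠ t in 𝓝 (0 : ℝ), (Function.update θ.1 x (θ.1 x + t), θ.2) ∈ O) ∧
    ∀ᶠ t in 𝓝 (0 : ℝ), (θ.1, Function.update θ.2 x (θ.2 x + t)) ∈ O := by
  have hc : ∀ f : ι → ℝ, Continuous fun t : ℝ => Function.update f x (f x + t) := fun f =>
    continuous_const.update x (continuous_const.add continuous_id)
  constructor
  · refine ((hc θ.1).prodMk continuous_const).continuousAt.eventually_mem (hO.mem_nhds ?_)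
    simpa using hθ
  · refine (continuous_const.prodMk (hc θ.2)).continuousAt.eventually_mem
      (hO.mem_nhds ?_)
    simpa using hθ

/-- The commutator is, in the parameters, not constantly zero on a nonempty open set. -/
lemma exists_comm_ne_zero [DecidableEq ι] {O : Set (Params ι)} (hO : IsOpen O) {θ : Params ι}
    (hθ : θ ∈ O) {U V : List ι} (hU : U ≠ []) (hV : V ≠ []) (hn : (U ++ V).Nodup)
    (ha : ∀ θ ∈ O, ∀ x ∈ U ++ V, θ.1 x ≠ 0) :
    ∃ θ ∈ O, comm θ.1 θ.2 d U V ≠ 0 := by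
  have hprod : ∀ θ ∈ O, ∀ L ⊆ U ++ V, (L.map θ.1).prod ≠ 0 := by
    intro θ hθ L hL
    rw [Ne, List.prod_eq_zero_iff]
    simp only [List.mem_map, not_exists, not_and]
    exact fun x hx => ha θ hθ x (hL hx)
  have hnU := (List.nodup_append.1 hn).1
  have hnV := (List.nodup_append.1 hn).2.1
  have hdis := (List.nodup_append.1 hn).2.2
  have hupd : ∀ (f : ι → ℝ) (x : ι) (r : ℝ) (L : List ι), x ∉ L →
      L.map (Function.update f x r) = L.map f := by
    intro f x r L hx
    refine List.map_congr_left fun y hy => Function.update_of_ne ?_ _ _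
    rintro rfl
    exact hx hy
  -- Moving one diagonal entry makes the gap of `V` nonzero.
  obtain ⟨θ, hθ, hgap⟩ : ∃ θ ∈ O, gap θ.1 d V ≠ 0 := by
    by_contra! hc
    obtain ⟨v, V', rfl⟩ := List.exists_cons_of_ne_nil hV
    obtain ⟨t, ht, ht0⟩ := ((eventually_update_mem hO hθ v).1.filter_mono
      (nhdsWithin_le_nhds (s := {0}ᶜ))).and (self_mem_nhdsWithin) |>.exists
    have h₁ := hc _ hθ
    have h₂ := hc _ ht
    have hv : v ∉ V' := (List.nodup_cons.1 hnV).1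
    simp only [gap, List.map_cons, List.prod_cons, Function.update_self, hupd _ _ _ _ hv] at h₁ h₂
    have h₃ : t * (V'.map θ.1).prod = 0 := by linarith
    exact (mul_ne_zero ht0 (hprod θ hθ V' (by intro; simp +contextual))) h₃
  by_contra! hc
  obtain ⟨u, U', rfl⟩ := List.exists_cons_of_ne_nil hU
  obtain ⟨t, ht, ht0⟩ := ((eventually_update_mem hO hθ u).2.filter_mono
    (nhdsWithin_le_nhds (s := {0}ᶜ))).and (self_mem_nhdsWithin) |>.exists
  have h₁ := hc _ hθ
  have h₂ := hc _ ht
  have huU : u ∉ U' := (List.nodup_cons.1 hnU).1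
  have huV : u ∉ V := fun h => hdis u (by simp) u h rfl
  have hoff : ∀ L : List ι, u ∉ L → offDiag θ.1 (Function.update θ.2 u (θ.2 u + t)) d L =
      offDiag θ.1 θ.2 d L := fun L hL => offDiag_congr (fun _ _ => rfl)
        (fun x hx => Function.update_of_ne (by rintro rfl; exact hL hx) _ _) fun _ _ => rfl
  simp only [comm, offDiag_cons, hoff _ huU, hoff _ huV, Function.update_self] at h₁ h₂
  have h₃ : t * (U'.map θ.1).prod * gap θ.1 d V = 0 := by linarith
  exact mul_ne_zero (mul_ne_zero ht0 (hprod θ hθ U' (by intro; simp +contextual))) hgap h₃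

/-- A nonempty open set of parameters contains generic ones. -/
lemma exists_generic [DecidableEq ι] {O : Set (Params ι)} (hO : IsOpen O) (hne : O.Nonempty)
    {L : List ι} (ha : ∀ θ ∈ O, ∀ x ∈ L, θ.1 x ≠ 0) :
    ∃ θ ∈ O, Generic θ.1 θ.2 d L := by
  have main : ∀ B : List (List ι × List ι), ∃ O' ⊆ O, IsOpen O' ∧ O'.Nonempty ∧
      ∀ q ∈ B, q.1 ≠ [] → q.2 ≠ [] → (q.1 ++ q.2).Nodup → q.1 ++ q.2 ⊆ L →
        ∀ θ ∈ O', comm θ.1 θ.2 d q.1 q.2 ≠ 0 := by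
    intro B
    induction B with
    | nil => exact ⟨O, subset_rfl, hO, hne, by simp⟩
    | cons q B ih =>
      obtain ⟨O', hsub, hO', hne', h⟩ := ih
      by_cases hq : q.1 ≠ [] ∧ q.2 ≠ [] ∧ (q.1 ++ q.2).Nodup ∧ q.1 ++ q.2 ⊆ L
      · obtain ⟨θ, hθ⟩ := hne'
        obtain ⟨θ', hθ', hc⟩ := exists_comm_ne_zero hO' hθ hq.1 hq.2.1 hq.2.2.1
          fun θ hθ x hx => ha θ (hsub hθ) x (hq.2.2.2 hx)
        refine ⟨O' ∩ {θ | comm θ.1 θ.2 d q.1 q.2 ≠ 0},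
          Set.inter_subset_left.trans hsub,
          hO'.inter ((continuous_comm q.1 q.2).isOpen_preimage _ isOpen_ne), ⟨θ', hθ', hc⟩, ?_⟩
        rintro p hp h₁ h₂ h₃ h₄ θ'' ⟨hθ'', hc''⟩
        rcases List.mem_cons.1 hp with rfl | hp
        · exact hc''
        · exact h p hp h₁ h₂ h₃ h₄ θ'' hθ''
      · refine ⟨O', hsub, hO', hne', ?_⟩
        intro p hp h₁ h₂ h₃ h₄
        rcases List.mem_cons.1 hp with rfl | hp
        · exact absurd ⟨h₁, h₂, h₃, h₄⟩ hq
        · exact h p hp h₁ h₂ h₃ h₄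
  let F := L.sublists.flatMap List.permutations
  have hF : ∀ U : List ι, U.Nodup → U ⊆ L → U ∈ F := by
    intro U hU hs
    obtain ⟨l, hl, hlL⟩ := List.subperm_of_subset hU hs
    exact List.mem_flatMap.2 ⟨l, List.mem_sublists.2 hlL, List.mem_permutations.2 hl.symm⟩
  obtain ⟨O', hsub, -, ⟨θ, hθ⟩, h⟩ := main (F ×ˢ F)
  refine ⟨θ, hsub hθ, fun U V hU hV hn hs => h (U, V) ?_ hU hV hn hs θ hθ⟩
  exact List.mem_product.2 ⟨hF U (List.nodup_append.1 hn).1 fun x hx => hs (by simp [hx]),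
    hF V (List.nodup_append.1 hn).2.1 fun x hx => hs (by simp [hx])⟩

lemma eventually_pairwise {α : Type*} {f : Filter α} {p : α → ι → ι → Prop} {l : List ι}
    (h : l.Pairwise fun x y => ∀ᶠ ε in f, p ε x y) : ∀ᶠ ε in f, l.Pairwise (p ε) := by
  induction l with
  | nil => simp
  | cons x l ih =>
    simp only [List.pairwise_cons] at h ⊢
    exact ((List.finite_toSet l).eventually_all.2 h.1).and (ih h.2)

lemma eventually_forall_mem {α : Type*} {f : Filter α} {p : α → ι → Prop} {l : List ι}
    (h : ∀ x ∈ l, ∀ᶠ ε in f, p ε x) : ∀ᶠ ε in f, ∀ x ∈ l, p ε x :=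
  (List.finite_toSet l).eventually_all.2 h

lemma isOpen_regular {P N negs : List ι} (hd : ∀ x, 0 < d x) :
    IsOpen {θ : Params ι | Regular θ.1 θ.2 d P N negs} := by
  rw [isOpen_iff_eventually]
  rintro θ ⟨-, h₁, h₂, h₃, h₄, h₅, h₆⟩
  have ca : ∀ x, Continuous fun θ : Params ι => θ.1 x := fun x =>
    (continuous_apply x).comp continuous_fst
  filter_upwards [eventually_forall_mem fun x hx =>
      (ca x).continuousAt.eventually (lt_mem_nhds (h₁ x hx)),
    eventually_forall_mem fun x hx => (ca x).continuousAt.eventually (gt_mem_nhds (h₂ x hx)),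
    eventually_forall_mem fun x hx =>
      (continuous_gap [x]).continuousAt.eventually (lt_mem_nhds (h₃ x hx)),
    eventually_forall_mem fun x hx =>
      (continuous_gap [x]).continuousAt.eventually (gt_mem_nhds (h₄ x hx)),
    eventually_pairwise (h₅.imp fun {x y} h =>
      (continuous_comm [x] [y]).continuousAt.eventually (lt_mem_nhds h)),
    eventually_pairwise (h₆.imp fun {x y} h =>
      (continuous_comm [x] [y]).continuousAt.eventually (lt_mem_nhds h))]
    with θ' h₁ h₂ h₃ h₄ h₅ h₆
  exact ⟨hd, h₁, h₂, h₃, h₄, h₅, h₆⟩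

/-- There is an optimal sequence that is structured. -/
def HasStructuredMin [DecidableEq ι] (a b d : ι → ℝ) (K negs : List ι) : Prop :=
  ∃ W, Structured K negs W ∧ IsMinimal a b d W

lemma tendsto_offDiag {α : Type*} {f : Filter α} {as bs ds : α → ι → ℝ} {a b : ι → ℝ}
    (ha : ∀ x, Tendsto (fun s => as s x) f (𝓝 (a x)))
    (hb : ∀ x, Tendsto (fun s => bs s x) f (𝓝 (b x)))
    (hd : ∀ x, Tendsto (fun s => ds s x) f (𝓝 (d x))) (L : List ι) :
    Tendsto (fun s => offDiag (as s) (bs s) (ds s) L) f (𝓝 (offDiag a b d L)) := by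
  have hp : ∀ L : List ι, Tendsto (fun s => (L.map (as s)).prod) f (𝓝 (L.map a).prod) := by
    intro L
    induction L with
    | nil => simpa using tendsto_const_nhds
    | cons x L ih => simpa using (ha x).mul ih
  induction L with
  | nil => simpa using tendsto_const_nhds
  | cons x L ih => exact ((hp L).mul (hb x)).add (ih.mul (hd x))

/-- The existence of a structured optimal sequence passes to limits, as there are finitely many
sequences. -/
lemma HasStructuredMin.of_frequently [DecidableEq ι] {α : Type*} {f : Filter α}
    {as bs ds : α → ι → ℝ} {a b : ι → ℝ} {K negs : List ι}
    (ha : ∀ x, Tendsto (fun s => as s x) f (𝓝 (a x)))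
    (hb : ∀ x, Tendsto (fun s => bs s x) f (𝓝 (b x)))
    (hd : ∀ x, Tendsto (fun s => ds s x) f (𝓝 (d x)))
    (h : ∃ᶠ s in f, HasStructuredMin (as s) (bs s) (ds s) K negs) :
    HasStructuredMin a b d K negs := by
  by_contra hc
  have key : ∀ᶠ s in f, ∀ W ∈ (K ++ negs).permutations, Structured K negs W →
      ¬ IsMinimal (as s) (bs s) (ds s) W := by
    refine eventually_forall_mem fun W _ => ?_
    by_cases hs : Structured K negs W
    · have hm : ¬ IsMinimal a b d W := fun hm => hc ⟨W, hs, hm⟩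
      unfold IsMinimal at hm
      push Not at hm
      obtain ⟨W', hp, hlt⟩ := hm
      filter_upwards [(tendsto_offDiag ha hb hd W').eventually_lt (tendsto_offDiag ha hb hd W) hlt]
        with s hs _ hmin
      exact absurd (hmin W' hp) (not_le.2 hs)
    · exact Eventually.of_forall fun s h => absurd h hs
  obtain ⟨s, ⟨W, hs, hm⟩, hk⟩ := (h.and_eventually key).exists
  exact hk W (List.mem_permutations.2 hs.1) hs hm

lemma exists_isMinimal [DecidableEq ι] {a b : ι → ℝ} (L : List ι) :
    ∃ W, W.Perm L ∧ IsMinimal a b d W := by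
  obtain ⟨W, hW, hm⟩ := L.permutations.toFinset.exists_min_image (offDiag a b d)
    ⟨L, by simp⟩
  simp only [List.mem_toFinset, List.mem_permutations] at hW hm
  exact ⟨W, hW, fun W' h => hm W' (h.trans hW)⟩

/-- Limits of regular instances have a structured optimal sequence, because the generic instances are
dense among the regular ones. -/
lemma Regular.hasStructuredMin_of_mem_closure [DecidableEq ι] {P N negs : List ι}
    (hn : (P ++ N ++ negs).Nodup) (hd : ∀ x, 0 < d x) {θ : Params ι}
    (hθ : θ ∈ closure {θ : Params ι | Regular θ.1 θ.2 d P N negs}) :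
    HasStructuredMin θ.1 θ.2 d (P ++ N) negs := by
  have ca : ∀ x, Tendsto (fun θ : Params ι => θ.1 x) (𝓝 θ) (𝓝 (θ.1 x)) := fun x =>
    ((continuous_apply x).comp continuous_fst).tendsto θ
  have cb : ∀ x, Tendsto (fun θ : Params ι => θ.2 x) (𝓝 θ) (𝓝 (θ.2 x)) := fun x =>
    ((continuous_apply x).comp continuous_snd).tendsto θ
  refine HasStructuredMin.of_frequently ca cb (fun x => tendsto_const_nhds) ?_
  rw [frequently_iff]
  intro O hO
  obtain ⟨O', hO'O, hO', hθ'⟩ := mem_nhds_iff.1 hO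
  obtain ⟨θ', hθ', hgen⟩ := exists_generic (d := d) (L := P ++ N ++ negs)
    (hO'.inter (isOpen_regular (P := P) (N := N) (negs := negs) hd))
    (mem_closure_iff.1 hθ O' hO' hθ') (by
      rintro θ ⟨-, hr⟩ x hx
      rcases List.mem_append.1 hx with hx | hx
      · exact (hr.a_pos x hx).ne'
      · exact (hr.a_neg x hx).ne)
  obtain ⟨W, hW, hm⟩ := exists_isMinimal (a := θ'.1) (b := θ'.2) (d := d) (P ++ N ++ negs)
  exact ⟨θ', hO'O hθ'.1, W, hm.structured hθ'.2 hgen hn hW, hm⟩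

/-- `P ++ N` is sorted by angle with respect to the nonzero keys `(kb, kg)`: `P` contains the keys
in the upper half plane, including the negative horizontal axis, and `N` those in the opposite half
plane. -/
structure SortedKeys (kb kg : ι → ℝ) (P N : List ι) : Prop where
  upper : ∀ x ∈ P, 0 < kg x ∨ (kg x = 0 ∧ kb x < 0)
  lower : ∀ x ∈ N, kg x < 0 ∨ (kg x = 0 ∧ 0 < kb x)
  sorted_upper : P.Pairwise fun x y => 0 ≤ kg x * kb y - kb x * kg y
  sorted_lower : N.Pairwise fun x y => 0 ≤ kg x * kb y - kb x * kg y

lemma exists_rank [DecidableEq ι] {K : List ι} (hK : K.Nodup) :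
    ∃ r : ι → ℝ, (∀ x, 0 < r x) ∧ K.Pairwise fun x y => r x < r y := by
  refine ⟨fun x => K.idxOf x + 1, fun x => by positivity, ?_⟩
  rw [List.pairwise_iff_getElem]
  intro i j hi hj hij
  simp only [hK.idxOf_getElem]
  exact_mod_cast Nat.succ_lt_succ hij

/-- Parallel vectors in the same half-open half plane have the same direction. -/
lemma dot_pos_of_upper {x₁ x₂ y₁ y₂ : ℝ} (hx : 0 < x₂ ∨ (x₂ = 0 ∧ x₁ < 0))
    (hy : 0 < y₂ ∨ (y₂ = 0 ∧ y₁ < 0)) (h : x₂ * y₁ - x₁ * y₂ = 0) : 0 < x₁ * y₁ + x₂ * y₂ := by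
  rcases hx with hx | ⟨rfl, hx⟩
  · rcases hy with hy | ⟨rfl, hy⟩
    · have h₁ : x₂ * (x₁ * y₁) = x₁ ^ 2 * y₂ := by linear_combination x₁ * h
      have h₂ : 0 ≤ x₁ * y₁ := nonneg_of_mul_nonneg_right (by rw [h₁]; positivity) hx
      have := mul_pos hx hy
      linarith
    · have := mul_neg_of_pos_of_neg hx hy
      linarith
  · rcases hy with hy | ⟨rfl, hy⟩
    · have := mul_neg_of_neg_of_pos hx hy
      linarith
    · have := mul_pos_of_neg_of_neg hx hy
      linarith

/-- If the diagonal entries are not zero, a sorted instance is the limit of regular ones: ties between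
directions are broken according to the positions in the list. -/
lemma hasStructuredMin_of_pos [DecidableEq ι] {a b kb kg t : ι → ℝ} {P N negs : List ι}
    (hn : (P ++ N ++ negs).Nodup) (hd : ∀ x, 0 < d x) (ha : ∀ x ∈ P ++ N, 0 < a x)
    (hneg : ∀ x ∈ negs, a x < 0) (ht : ∀ x ∈ P ++ N, 0 ≤ t x)
    (hb : ∀ x ∈ P ++ N, b x = t x * kb x) (hg : ∀ x ∈ P ++ N, a x - d x = t x * kg x)
    (hK : SortedKeys kb kg P N) : HasStructuredMin a b d (P ++ N) negs := by
  obtain ⟨r, hr, hrK⟩ := exists_rank (List.nodup_append.1 hn).1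
  -- The keys are rotated by small angles increasing along `K`, and the vectors that vanish are
  -- replaced by small multiples of their keys.
  let path : ℝ → Params ι := fun ε =>
    (fun x => if x ∈ P ++ N then d x + (t x + ε) * (kg x - ε * r x * kb x) else a x,
      fun x => if x ∈ P ++ N then (t x + ε) * (kb x + ε * r x * kg x) else b x)
  have hpath : Continuous path := by
    refine (continuous_pi fun x => ?_).prodMk (continuous_pi fun x => ?_) <;> split_ifs <;>
      fun_prop
  have hpath0 : path 0 = (a, b) := by
    refine Prod.ext (funext fun x => ?_) (funext fun x => ?_)
    · by_cases hx : x ∈ P ++ N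
      · have := hg x hx
        simp only [path, if_pos hx]
        linarith
      · simp only [path, if_neg hx]
    · by_cases hx : x ∈ P ++ N
      · have := hb x hx
        simp only [path, if_pos hx]
        linarith
      · simp only [path, if_neg hx]
  have hmain := Regular.hasStructuredMin_of_mem_closure (negs := negs) (P := P) (N := N)
    (θ := (a, b)) hn hd
  refine hmain ?_
  have htend : Tendsto path (𝓝[>] 0) (𝓝 (a, b)) := by
    rw [← hpath0]
    exact hpath.continuousAt.tendsto.mono_left nhdsWithin_le_nhds
  refine mem_closure_of_tendsto htend ?_
  have hpos : ∀ᶠ ε in 𝓝[>] (0 : ℝ), 0 < ε := self_mem_nhdsWithin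
  have hgap : ∀ x ∈ P ++ N, ∀ ε, gap (path ε).1 d [x] = (t x + ε) * (kg x - ε * r x * kb x) := by
    intro x hx ε
    simp only [gap, path, List.map_cons, List.map_nil, List.prod_cons, List.prod_nil, if_pos hx]
    ring
  have hoff : ∀ x ∈ P ++ N, ∀ ε, offDiag (path ε).1 (path ε).2 d [x] =
      (t x + ε) * (kb x + ε * r x * kg x) := by
    intro x hx ε
    simp only [path, offDiag_cons, List.map_nil, List.prod_nil, offDiag_nil, if_pos hx]
    ring
  have hcomm : ∀ x ∈ P ++ N, ∀ y ∈ P ++ N, ∀ ε, comm (path ε).1 (path ε).2 d [x] [y] =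
      (t x + ε) * (t y + ε) * ((kg x * kb y - kb x * kg y) * (1 + ε ^ 2 * r x * r y) +
        ε * (r y - r x) * (kb x * kb y + kg x * kg y)) := by
    intro x hx y hy ε
    simp only [comm, hgap x hx, hgap y hy, hoff x hx, hoff y hy]
    ring
  have hsort : ∀ x ∈ P ++ N, ∀ y ∈ P ++ N, r x < r y → 0 ≤ kg x * kb y - kb x * kg y →
      (kg x * kb y - kb x * kg y = 0 → 0 < kb x * kb y + kg x * kg y) →
      ∀ᶠ ε in 𝓝[>] (0 : ℝ), 0 < comm (path ε).1 (path ε).2 d [x] [y] := by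
    intro x hx y hy hxy hc hdot
    have hfac : ∀ᶠ ε in 𝓝[>] (0 : ℝ), 0 < (kg x * kb y - kb x * kg y) * (1 + ε ^ 2 * r x * r y) +
        ε * (r y - r x) * (kb x * kb y + kg x * kg y) := by
      rcases hc.eq_or_lt with hc | hc
      · filter_upwards [hpos] with ε hε
        rw [← hc, zero_mul, zero_add]
        exact mul_pos (mul_pos hε (sub_pos.2 hxy)) (hdot hc.symm)
      · have hcont : Continuous fun ε : ℝ => (kg x * kb y - kb x * kg y) *
            (1 + ε ^ 2 * r x * r y) + ε * (r y - r x) * (kb x * kb y + kg x * kg y) := by fun_prop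
        refine (hcont.continuousAt.eventually (lt_mem_nhds ?_)).filter_mono nhdsWithin_le_nhds
        simpa using hc
    filter_upwards [hpos, hfac] with ε hε hf
    rw [hcomm x hx y hy]
    have := ht x hx
    have := ht y hy
    positivity
  have hP : ∀ {x}, x ∈ P → x ∈ P ++ N := fun h => List.mem_append_left _ h
  have hN : ∀ {x}, x ∈ N → x ∈ P ++ N := fun h => List.mem_append_right _ h
  have e₁ : ∀ᶠ ε in 𝓝[>] (0 : ℝ), ∀ x ∈ P ++ N, 0 < (path ε).1 x := by
    refine eventually_forall_mem fun x hx => ?_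
    have hcont : Continuous fun ε => (path ε).1 x :=
      (continuous_apply x).comp (continuous_fst.comp hpath)
    refine (hcont.continuousAt.eventually (lt_mem_nhds ?_)).filter_mono nhdsWithin_le_nhds
    change 0 < (path 0).1 x
    rw [hpath0]
    exact ha x hx
  have e₃ : ∀ᶠ ε in 𝓝[>] (0 : ℝ), ∀ x ∈ P, 0 < gap (path ε).1 d [x] := by
    refine eventually_forall_mem fun x hx => ?_
    have hfac : ∀ᶠ ε in 𝓝[>] (0 : ℝ), 0 < kg x - ε * r x * kb x := by
      rcases hK.upper x hx with h | ⟨h, h'⟩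
      · have hcont : Continuous fun ε : ℝ => kg x - ε * r x * kb x := by fun_prop
        refine (hcont.continuousAt.eventually (lt_mem_nhds ?_)).filter_mono nhdsWithin_le_nhds
        simpa using h
      · filter_upwards [hpos] with ε hε
        have := mul_neg_of_pos_of_neg (mul_pos hε (hr x)) h'
        linarith
    filter_upwards [hpos, hfac] with ε hε hf
    rw [hgap x (hP hx)]
    have := ht x (hP hx)
    positivity
  have e₄ : ∀ᶠ ε in 𝓝[>] (0 : ℝ), ∀ x ∈ N, gap (path ε).1 d [x] < 0 := by
    refine eventually_forall_mem fun x hx => ?_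
    have hfac : ∀ᶠ ε in 𝓝[>] (0 : ℝ), kg x - ε * r x * kb x < 0 := by
      rcases hK.lower x hx with h | ⟨h, h'⟩
      · have hcont : Continuous fun ε : ℝ => kg x - ε * r x * kb x := by fun_prop
        refine (hcont.continuousAt.eventually (gt_mem_nhds ?_)).filter_mono nhdsWithin_le_nhds
        simpa using h
      · filter_upwards [hpos] with ε hε
        have := mul_pos (mul_pos hε (hr x)) h'
        linarith
    filter_upwards [hpos, hfac] with ε hε hf
    rw [hgap x (hN hx)]
    have := ht x (hN hx)
    exact mul_neg_of_pos_of_neg (by positivity) hf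
  have e₅ : ∀ᶠ ε in 𝓝[>] (0 : ℝ), P.Pairwise
      fun x y => 0 < comm (path ε).1 (path ε).2 d [x] [y] := by
    refine eventually_pairwise
      ((hK.sorted_upper.and (List.pairwise_append.1 hrK).1).imp_of_mem ?_)
    rintro x y hx hy ⟨hc, hxy⟩
    exact hsort x (hP hx) y (hP hy) hxy hc
      (dot_pos_of_upper (hK.upper x hx) (hK.upper y hy))
  have e₆ : ∀ᶠ ε in 𝓝[>] (0 : ℝ), N.Pairwise
      fun x y => 0 < comm (path ε).1 (path ε).2 d [x] [y] := by
    refine eventually_pairwise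
      ((hK.sorted_lower.and (List.pairwise_append.1 hrK).2.1).imp_of_mem ?_)
    rintro x y hx hy ⟨hc, hxy⟩
    refine hsort x (hN hx) y (hN hy) hxy hc fun h0 => ?_
    have := dot_pos_of_upper (x₁ := - kb x) (x₂ := - kg x) (y₁ := - kb y) (y₂ := - kg y)
      (by simpa using hK.lower x hx) (by simpa using hK.lower y hy) (by linarith)
    linarith
  filter_upwards [e₁, e₃, e₄, e₅, e₆] with ε e₁ e₃ e₄ e₅ e₆
  refine ⟨hd, e₁, fun x hx => ?_, e₃, e₄, e₅, e₆⟩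
  have hx' : x ∉ P ++ N := fun h => (List.nodup_append.1 hn).2.2 x h x hx rfl
  simp only [path, if_neg hx']
  exact hneg x hx

/-- Every sorted instance has a structured optimal sequence. The factors `t` relate the vectors of the
elements to the keys, so that zero vectors can have keys, too. -/
theorem hasStructuredMin [DecidableEq ι] {a b kb kg t : ι → ℝ} {P N negs : List ι}
    (hn : (P ++ N ++ negs).Nodup) (hd : ∀ x ∈ P ++ N, 0 ≤ d x) (ha : ∀ x ∈ P ++ N, 0 ≤ a x)
    (hneg : ∀ x ∈ negs, a x < 0) (hneg' : ∀ x ∈ negs, 0 < d x) (ht : ∀ x ∈ P ++ N, 0 ≤ t x)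
    (hb : ∀ x ∈ P ++ N, b x = t x * kb x) (hg : ∀ x ∈ P ++ N, a x - d x = t x * kg x)
    (hK : SortedKeys kb kg P N) : HasStructuredMin a b d (P ++ N) negs := by
  have key : HasStructuredMin a b (fun x => if x ∈ P ++ N ++ negs then d x else 1)
      (P ++ N) negs := by
    refine HasStructuredMin.of_frequently (f := 𝓝[>] (0 : ℝ)) (as := fun ε x => a x + ε)
      (bs := fun _ => b) (ds := fun ε x => (if x ∈ P ++ N ++ negs then d x else 1) + ε) ?_ ?_ ?_ ?_
    · intro x
      have : Continuous fun ε : ℝ => a x + ε := by fun_prop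
      simpa using (this.tendsto 0).mono_left nhdsWithin_le_nhds
    · exact fun x => tendsto_const_nhds
    · intro x
      have : Continuous fun ε : ℝ => (if x ∈ P ++ N ++ negs then d x else 1) + ε := by fun_prop
      simpa using (this.tendsto 0).mono_left nhdsWithin_le_nhds
    refine Eventually.frequently ?_
    have hpos : ∀ᶠ ε in 𝓝[>] (0 : ℝ), 0 < ε := self_mem_nhdsWithin
    have hsmall : ∀ᶠ ε in 𝓝[>] (0 : ℝ), ∀ x ∈ negs, a x + ε < 0 := by
      refine eventually_forall_mem fun x hx => ?_
      have hcont : Continuous fun ε : ℝ => a x + ε := by fun_prop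
      refine (hcont.continuousAt.eventually (gt_mem_nhds ?_)).filter_mono nhdsWithin_le_nhds
      simpa using hneg x hx
    filter_upwards [hpos, hsmall] with ε hε hs
    refine hasStructuredMin_of_pos hn ?_ (fun x hx => by linarith [ha x hx]) hs ht hb ?_ hK
    · intro x
      split_ifs with hx
      · rcases List.mem_append.1 hx with hx | hx
        · linarith [hd x hx]
        · linarith [hneg' x hx]
      · linarith
    · intro x hx
      rw [if_pos (List.mem_append_left _ hx), ← hg x hx]
      ring
  obtain ⟨W, hW, hm⟩ := key
  refine ⟨W, hW, fun W' hp => ?_⟩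
  have hcong : ∀ L : List ι, L.Perm W → offDiag a b d L =
      offDiag a b (fun x => if x ∈ P ++ N ++ negs then d x else 1) L := fun L hL =>
    offDiag_congr (fun _ _ => rfl) (fun _ _ => rfl) fun x hx => by
      rw [if_pos (hW.1.subset (hL.subset hx))]
  rw [hcong W (List.Perm.refl _), hcong W' hp]
  exact hm W' hp

end

/-! ### Reduction to triangular matrices -/

/-- The matrices of an instance, indexed by all natural numbers. -/
noncomputable def mat {n : ℕ} (I : OrderingInstance 2 n) (i : ℕ) : Matrix (Fin 2) (Fin 2) ℝ :=
  if h : i < n then I.M ⟨i, h⟩ else 0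

/-- The product of the matrices along a list in the order of application. -/
noncomputable def listProduct (M : ℕ → Matrix (Fin 2) (Fin 2) ℝ) (L : List ℕ) :
    Matrix (Fin 2) (Fin 2) ℝ :=
  (L.map M).reverse.prod

/-- The objective value of an ordering given as a list. -/
noncomputable def listValue {n : ℕ} (I : OrderingInstance 2 n) (L : List ℕ) : ℝ :=
  dotProduct I.w (Matrix.mulVec (listProduct (mat I) L) I.y)

/-- The list is an optimal multiplication ordering. -/
def IsOptimalList {n : ℕ} (I : OrderingInstance 2 n) (L : List ℕ) : Prop :=
  L.Perm (List.range n) ∧ ∀ L' : List ℕ, L'.Perm (List.range n) → listValue I L ≤ listValue I L'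

lemma listValue_ofFn {n : ℕ} (I : OrderingInstance 2 n) (σ : Equiv.Perm (Fin n)) :
    listValue I (List.ofFn fun i => (σ i : ℕ)) = I.value σ := by
  unfold listValue OrderingInstance.value listProduct orderedProduct
  rw [List.map_ofFn]
  have h : (mat I ∘ fun i => (σ i : ℕ)) = fun i => I.M (σ i) := by
    funext i
    simp [mat]
  rw [h]

lemma ofFn_perm_range {n : ℕ} (σ : Equiv.Perm (Fin n)) :
    (List.ofFn fun i => (σ i : ℕ)).Perm (List.range n) := by
  rw [List.perm_ext_iff_of_nodup _ List.nodup_range]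
  · intro x
    simp only [List.mem_ofFn, List.mem_range]
    constructor
    · rintro ⟨i, rfl⟩
      exact (σ i).2
    · intro hx
      exact ⟨σ.symm ⟨x, hx⟩, by simp⟩
  · rw [List.nodup_ofFn]
    exact Fin.val_injective.comp σ.injective

lemma exists_perm_of_isOptimalList {n : ℕ} {I : OrderingInstance 2 n} {L : List ℕ}
    (hL : IsOptimalList I L) :
    ∃ σ : Equiv.Perm (Fin n), (∀ i : Fin n, L[(i : ℕ)]? = some (σ i : ℕ)) ∧ I.IsOptimal σ := by
  have hlen : L.length = n := by rw [hL.1.length_eq, List.length_range]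
  have hlt : ∀ i : Fin n, L[(i : ℕ)]'(by omega) < n := fun i =>
    List.mem_range.1 (hL.1.subset (List.getElem_mem _))
  let f : Fin n → Fin n := fun i => ⟨L[(i : ℕ)]'(by omega), hlt i⟩
  have hf : Function.Injective f := by
    intro i j hij
    have h₁ : L[(i : ℕ)]'(by omega) = L[(j : ℕ)]'(by omega) := congrArg Fin.val hij
    have hn : L.Nodup := hL.1.nodup_iff.2 List.nodup_range
    exact Fin.ext ((hn.getElem_inj_iff).1 h₁)
  let σ : Equiv.Perm (Fin n) := Equiv.ofBijective f (Finite.injective_iff_bijective.1 hf)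
  have hσ : (List.ofFn fun i => (σ i : ℕ)) = L := by
    apply List.ext_getElem
    · simp [hlen]
    · intro i h₁ h₂
      simp [σ, f]
  refine ⟨σ, fun i => ?_, fun τ => ?_⟩
  · rw [List.getElem?_eq_getElem (by omega)]
    simp [σ, f]
  · rw [← listValue_ofFn, ← listValue_ofFn, hσ]
    exact hL.2 _ (ofFn_perm_range τ)

lemma listProduct_cons (M : ℕ → Matrix (Fin 2) (Fin 2) ℝ) (x : ℕ) (L : List ℕ) :
    listProduct M (x :: L) = listProduct M L * M x := by
  simp [listProduct]

/-- The vector `(p, q)` is zero or an eigenvector of `A`, in coordinates. -/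
def IsEigen (A : Matrix (Fin 2) (Fin 2) ℝ) (p q : ℝ) : Prop :=
  p * (A 1 0 * p + A 1 1 * q) = q * (A 0 0 * p + A 0 1 * q)

lemma exists_isEigen {n : ℕ} {I : OrderingInstance 2 n} (h : SimultaneouslyTriangularizable I.M) :
    ∃ p q : ℝ, ¬ (p = 0 ∧ q = 0) ∧ ∀ i, IsEigen (mat I i) p q := by
  obtain ⟨P, hP, h⟩ := h
  refine ⟨P 0 0, P 1 0, ?_, ?_⟩
  · rintro ⟨h₀, h₁⟩
    have := (Matrix.isUnit_iff_isUnit_det P).1 hP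
    rw [Matrix.det_fin_two, h₀, h₁] at this
    simp at this
  · intro i
    unfold mat
    split_ifs with hi
    · have hT := h ⟨i, hi⟩
      set T := P⁻¹ * I.M ⟨i, hi⟩ * P with hTdef
      have hdet : IsUnit P.det := (Matrix.isUnit_iff_isUnit_det P).1 hP
      have hMP : I.M ⟨i, hi⟩ * P = P * T := by
        rw [hTdef, Matrix.mul_assoc, Matrix.mul_nonsing_inv_cancel_left _ _ hdet]
      have h10 : T 1 0 = 0 := hT (by decide)
      have e₀ := congrFun (congrFun hMP 0) 0
      have e₁ := congrFun (congrFun hMP 1) 0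
      simp only [Matrix.mul_apply, Fin.sum_univ_two, h10, mul_zero, add_zero] at e₀ e₁
      unfold IsEigen
      rw [e₀, e₁]
      ring
    · simp [IsEigen]

lemma IsEigen.of_parallel {A : Matrix (Fin 2) (Fin 2) ℝ} {p q p' q' : ℝ} (h : IsEigen A p q)
    (hpq : ¬ (p = 0 ∧ q = 0)) (hpar : p * q' = q * p') : IsEigen A p' q' := by
  unfold IsEigen at *
  by_cases hp : p = 0
  · have hq : q ≠ 0 := fun hq => hpq ⟨hp, hq⟩
    have : p' = 0 := by
      have : q * p' = 0 := by rw [← hpar, hp, zero_mul]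
      exact (mul_eq_zero.1 this).resolve_left hq
    subst hp this
    have : A 0 1 = 0 := by
      have h₁ : A 0 1 * (q * q) = 0 := by linarith
      exact (mul_eq_zero.1 h₁).resolve_right (mul_ne_zero hq hq)
    rw [this]; ring
  · have : q' = q * p' / p := by field_simp; linarith
    subst this
    field_simp
    linear_combination p' ^ 2 * h

lemma IsEigen.exists_eigenvalue {A : Matrix (Fin 2) (Fin 2) ℝ} {p q : ℝ} (h : IsEigen A p q)
    (hpq : ¬ (p = 0 ∧ q = 0)) :
    ∃ t, A 0 0 * p + A 0 1 * q = t * p ∧ A 1 0 * p + A 1 1 * q = t * q := by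
  unfold IsEigen at h
  by_cases hp : p = 0
  · have hq : q ≠ 0 := fun hq => hpq ⟨hp, hq⟩
    refine ⟨(A 1 0 * p + A 1 1 * q) / q, ?_, by field_simp⟩
    field_simp
    linarith
  · refine ⟨(A 0 0 * p + A 0 1 * q) / p, by field_simp, ?_⟩
    field_simp
    linarith

/-- The entries of the commutator `A B - B A` of two matrices with a common eigenvector determine
the eigenvector unless the commutator vanishes. -/
lemma isEigen_commutator {A B : Matrix (Fin 2) (Fin 2) ℝ} {p q : ℝ} (hpq : ¬ (p = 0 ∧ q = 0))
    (hA : IsEigen A p q) (hB : IsEigen B p q) {x y z : ℝ}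
    (hx : x = A 0 1 * B 1 0 - B 0 1 * A 1 0)
    (hy : y = (A 0 0 - A 1 1) * B 0 1 - A 0 1 * (B 0 0 - B 1 1))
    (hz : z = A 1 0 * (B 0 0 - B 1 1) - B 1 0 * (A 0 0 - A 1 1)) :
    p * z = q * x ∧ (z = 0 → q * y = 0) ∧ (z = 0 → y = 0 → A * B = B * A) := by
  obtain ⟨t, ht₀, ht₁⟩ := hA.exists_eigenvalue hpq
  obtain ⟨s, hs₀, hs₁⟩ := hB.exists_eigenvalue hpq
  have h₀ : x * p + y * q = 0 := by
    subst hx hy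
    linear_combination A 0 0 * hs₀ + A 0 1 * hs₁ - B 0 0 * ht₀ - B 0 1 * ht₁ + s * ht₀ - t * hs₀
  have h₁ : z * p - x * q = 0 := by
    subst hx hz
    linear_combination A 1 0 * hs₀ + A 1 1 * hs₁ - B 1 0 * ht₀ - B 1 1 * ht₁ + s * ht₁ - t * hs₁
  refine ⟨by linarith, fun hz0 => ?_, fun hz0 hy0 => ?_⟩
  · have h₂ : q * (q * y) = 0 := by rw [hz0] at h₁; linear_combination q * h₀ + p * h₁
    rcases mul_eq_zero.1 h₂ with h | h
    · rw [h, zero_mul]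
    · exact h
  · have hx0 : x = 0 := by
      by_contra hne
      rw [hz0, zero_mul, zero_sub, neg_eq_zero, mul_eq_zero] at h₁
      rw [hy0, zero_mul, add_zero, mul_eq_zero] at h₀
      exact hpq ⟨h₀.resolve_left hne, h₁.resolve_left hne⟩
    ext i j
    fin_cases i <;> fin_cases j <;> simp [Matrix.mul_apply, Fin.sum_univ_two] <;> linarith

/-- A scalar matrix. -/
def IsScalar (A : Matrix (Fin 2) (Fin 2) ℝ) : Prop := A 0 1 = 0 ∧ A 1 0 = 0 ∧ A 0 0 = A 1 1

lemma IsScalar.commute {A : Matrix (Fin 2) (Fin 2) ℝ} (h : IsScalar A)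
    (B : Matrix (Fin 2) (Fin 2) ℝ) : A * B = B * A := by
  obtain ⟨h₁, h₂, h₃⟩ := h
  ext i j
  fin_cases i <;> fin_cases j <;> simp [Matrix.mul_apply, Fin.sum_univ_two, h₁, h₂, h₃] <;> ring

/-- The centraliser of a matrix that is not scalar is commutative. -/
lemma commute_of_commute {A B C : Matrix (Fin 2) (Fin 2) ℝ} (hA : ¬ IsScalar A)
    (hB : A * B = B * A) (hC : A * C = C * A) : B * C = C * B := by
  have b₀ := congrFun (congrFun hB 0) 0
  have b₁ := congrFun (congrFun hB 0) 1
  have b₂ := congrFun (congrFun hB 1) 0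
  have c₀ := congrFun (congrFun hC 0) 0
  have c₁ := congrFun (congrFun hC 0) 1
  have c₂ := congrFun (congrFun hC 1) 0
  simp only [Matrix.mul_apply, Fin.sum_univ_two] at b₀ b₁ b₂ c₀ c₁ c₂
  -- `(B 0 1, B 1 0, B 0 0 - B 1 1)` is a multiple of the corresponding vector of `A`.
  have key : ∀ D : Matrix (Fin 2) (Fin 2) ℝ, A * D = D * A → ∃ t, D 0 1 = t * A 0 1 ∧
      D 1 0 = t * A 1 0 ∧ D 0 0 - D 1 1 = t * (A 0 0 - A 1 1) := by
    intro D hD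
    have d₀ := congrFun (congrFun hD 0) 0
    have d₁ := congrFun (congrFun hD 0) 1
    have d₂ := congrFun (congrFun hD 1) 0
    simp only [Matrix.mul_apply, Fin.sum_univ_two] at d₀ d₁ d₂
    by_cases h₁ : A 0 1 = 0
    · by_cases h₂ : A 1 0 = 0
      · have h₃ : A 0 0 - A 1 1 ≠ 0 := fun h => hA ⟨h₁, h₂, by linarith⟩
        refine ⟨(D 0 0 - D 1 1) / (A 0 0 - A 1 1), ?_, ?_, ?_⟩ <;> field_simp <;> linarith
      · refine ⟨D 1 0 / A 1 0, ?_, ?_, ?_⟩ <;> field_simp <;> linarith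
    · refine ⟨D 0 1 / A 0 1, ?_, ?_, ?_⟩ <;> field_simp <;> linarith
  obtain ⟨t, ht₁, ht₂, ht₃⟩ := key B hB
  obtain ⟨s, hs₁, hs₂, hs₃⟩ := key C hC
  ext i j
  fin_cases i <;> fin_cases j <;>
    simp only [Matrix.mul_apply, Fin.sum_univ_two, Fin.zero_eta, Fin.mk_one, Fin.isValue]
  · rw [ht₁, ht₂, hs₁, hs₂]; ring
  · have : B 0 1 * (C 0 0 - C 1 1) = C 0 1 * (B 0 0 - B 1 1) := by
      rw [ht₁, ht₃, hs₁, hs₃]; ring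
    linarith
  · have : B 1 0 * (C 0 0 - C 1 1) = C 1 0 * (B 0 0 - B 1 1) := by
      rw [ht₂, ht₃, hs₂, hs₃]; ring
    linarith
  · rw [ht₁, ht₂, hs₁, hs₂]; ring

lemma listValue_eq_of_commute {n : ℕ} {I : OrderingInstance 2 n}
    (h : ∀ i < n, ∀ j < n, mat I i * mat I j = mat I j * mat I i) {L L' : List ℕ}
    (hL : L.Perm (List.range n)) (hL' : L'.Perm (List.range n)) : listValue I L = listValue I L' := by
  unfold listValue listProduct
  congr 2
  refine List.Perm.prod_eq' ?_ ?_
  · exact (List.reverse_perm _).trans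
      (((hL.trans hL'.symm).map _).trans (List.reverse_perm _).symm)
  · rw [List.pairwise_reverse, List.pairwise_map]
    refine List.Pairwise.imp_of_mem (R := fun _ _ => True) ?_ (List.pairwise_of_forall (by simp))
    intro i j hi hj _
    exact h j (List.mem_range.1 (hL.subset hj)) i (List.mem_range.1 (hL.subset hi))

/-- `A`, `B`, `D` represent the instance: rearrangements minimising the upper right entry of the
product of the triangular matrices are optimal orderings. -/
def Represents {n : ℕ} (I : OrderingInstance 2 n) (A B D : ℕ → ℝ) : Prop :=
  ∀ L : List ℕ, L.Perm (List.range n) → IsMinimal A B D L → IsOptimalList I L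

lemma listProduct_triangular {M : ℕ → Matrix (Fin 2) (Fin 2) ℝ} {p q : ℝ} {a b d : ℕ → ℝ}
    (ha : ∀ i, a i = p * (M i 0 0 * p + M i 0 1 * q) + q * (M i 1 0 * p + M i 1 1 * q))
    (hb : ∀ i, b i = p * (M i 0 1 * p - M i 0 0 * q) + q * (M i 1 1 * p - M i 1 0 * q))
    (hd : ∀ i, d i = p * (M i 1 1 * p - M i 1 0 * q) - q * (M i 0 1 * p - M i 0 0 * q))
    (hM : ∀ i, IsEigen (M i) p q) (L : List ℕ) :
    ((p ^ 2 + q ^ 2) ^ L.length • (listProduct M L).mulVec ![p, q] = (L.map a).prod • ![p, q]) ∧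
    (p ^ 2 + q ^ 2) ^ L.length • (listProduct M L).mulVec ![-q, p] =
      offDiag a b d L • ![p, q] + (L.map d).prod • ![-q, p] := by
  induction L with
  | nil => simp [listProduct]
  | cons x L ih =>
    have h₁ : (p ^ 2 + q ^ 2) • (M x).mulVec ![p, q] = a x • ![p, q] := by
      have := hM x
      unfold IsEigen at this
      ext i
      fin_cases i <;> simp [ha]
      · linear_combination -q * this
      · linear_combination p * this
    have h₂ : (p ^ 2 + q ^ 2) • (M x).mulVec ![-q, p] = b x • ![p, q] + d x • ![-q, p] := by
      ext i
      fin_cases i <;> simp [hb, hd] <;> ring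
    constructor
    · rw [listProduct_cons, ← Matrix.mulVec_mulVec, List.length_cons, pow_succ, mul_smul,
        ← Matrix.mulVec_smul, h₁, Matrix.mulVec_smul, smul_comm, ih.1, smul_smul]
      simp
    · rw [listProduct_cons, ← Matrix.mulVec_mulVec, List.length_cons, pow_succ, mul_smul,
        ← Matrix.mulVec_smul, h₂, Matrix.mulVec_add, Matrix.mulVec_smul, Matrix.mulVec_smul,
        smul_add, smul_comm, ih.1, smul_comm _ (d x), ih.2]
      simp only [smul_add, smul_smul, offDiag_cons, List.map_cons, List.prod_cons, add_smul]
      rw [← add_assoc, mul_comm (b x), mul_comm (d x) (offDiag a b d L)]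

/-- In the basis of a common eigenvector and its perpendicular, the objective is an affine function
of the upper right entry. The signs `c i` and `s` normalise the triangular matrices and make the
slope of this function nonnegative. -/
lemma represents_of_isEigen {n : ℕ} {I : OrderingInstance 2 n} {p q : ℝ} {a b d c : ℕ → ℝ} {s : ℝ}
    (hpq : ¬ (p = 0 ∧ q = 0))
    (ha : ∀ i, a i = p * (mat I i 0 0 * p + mat I i 0 1 * q) +
      q * (mat I i 1 0 * p + mat I i 1 1 * q))
    (hb : ∀ i, b i = p * (mat I i 0 1 * p - mat I i 0 0 * q) +
      q * (mat I i 1 1 * p - mat I i 1 0 * q))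
    (hd : ∀ i, d i = p * (mat I i 1 1 * p - mat I i 1 0 * q) -
      q * (mat I i 0 1 * p - mat I i 0 0 * q))
    (hM : ∀ i, IsEigen (mat I i) p q) (hc : ∀ i, c i * c i = 1) (hs : s * s = 1)
    (hκ : 0 ≤ s * ((((List.range n).map c).prod) *
      ((I.w 0 * p + I.w 1 * q) * (I.y 1 * p - I.y 0 * q)))) {A B D : ℕ → ℝ}
    (hA : ∀ i < n, A i = c i * a i) (hB : ∀ i < n, B i = s * (c i * b i))
    (hD : ∀ i < n, D i = c i * d i) : Represents I A B D := by
  intro L hL hmin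
  refine ⟨hL, fun L' hL' => ?_⟩
  have hρ : 0 < p ^ 2 + q ^ 2 := by
    rcases not_and_or.1 hpq with h | h <;> positivity
  have hoff : ∀ L : List ℕ, L.Perm (List.range n) →
      offDiag A B D L = s * (((List.range n).map c).prod * offDiag a b d L) := by
    intro L hL
    have hlt : ∀ x ∈ L, x < n := fun x hx => List.mem_range.1 (hL.subset hx)
    rw [offDiag_congr (a' := fun i => c i * a i) (b' := fun i => c i * (s * b i))
      (d' := fun i => c i * d i) (fun x hx => hA x (hlt x hx))
      (fun x hx => by rw [hB x (hlt x hx)]; ring) (fun x hx => hD x (hlt x hx)), offDiag_mul,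
      (hL.map c).prod_eq]
    have : ∀ L : List ℕ, offDiag a (fun i => s * b i) d L = s * offDiag a b d L := by
      intro L
      induction L with
      | nil => simp
      | cons x L ih => simp [ih]; ring
    rw [this]; ring
  have hval : ∀ L : List ℕ, L.Perm (List.range n) →
      (p ^ 2 + q ^ 2) ^ (n + 1) * listValue I L =
        (I.w 0 * p + I.w 1 * q) * (I.y 0 * p + I.y 1 * q) * ((List.range n).map a).prod +
        (I.w 1 * p - I.w 0 * q) * (I.y 1 * p - I.y 0 * q) * ((List.range n).map d).prod +
        (I.w 0 * p + I.w 1 * q) * (I.y 1 * p - I.y 0 * q) * offDiag a b d L := by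
    intro L hL
    obtain ⟨h₁, h₂⟩ := listProduct_triangular ha hb hd hM L
    have hy : (p ^ 2 + q ^ 2) • I.y =
        (I.y 0 * p + I.y 1 * q) • ![p, q] + (I.y 1 * p - I.y 0 * q) • ![-q, p] := by
      ext i
      fin_cases i <;> simp <;> ring
    have hlen : L.length = n := by rw [hL.length_eq, List.length_range]
    rw [hlen] at h₁ h₂
    have hvec : (p ^ 2 + q ^ 2) ^ (n + 1) • (listProduct (mat I) L).mulVec I.y =
        (I.y 0 * p + I.y 1 * q) • ((L.map a).prod • ![p, q]) + (I.y 1 * p - I.y 0 * q) •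
          (offDiag a b d L • ![p, q] + (L.map d).prod • ![-q, p]) := by
      rw [pow_succ, mul_smul, ← Matrix.mulVec_smul, hy, Matrix.mulVec_add, Matrix.mulVec_smul,
        Matrix.mulVec_smul, smul_add, smul_comm, smul_comm _ (I.y 1 * p - I.y 0 * q),
        h₁, h₂]
    have e₀ := congrFun hvec 0
    have e₁ := congrFun hvec 1
    simp only [Pi.smul_apply, Pi.add_apply, smul_eq_mul, Matrix.cons_val_zero,
      Matrix.cons_val_one, (hL.map a).prod_eq, (hL.map d).prod_eq] at e₀ e₁
    unfold listValue
    rw [dotProduct, Fin.sum_univ_two]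
    linear_combination I.w 0 * e₀ + I.w 1 * e₁
  have h := hmin L' (hL'.trans hL.symm)
  rw [hoff L hL, hoff L' hL'] at h
  have e := hval L hL
  have e' := hval L' hL'
  set π := ((List.range n).map c).prod
  have hπ : π * π = 1 := by
    rw [← List.prod_map_mul]
    simp [hc]
  set κ := (I.w 0 * p + I.w 1 * q) * (I.y 1 * p - I.y 0 * q)
  have h₁ := mul_le_mul_of_nonneg_left h hκ
  have h₂ : ∀ t : ℝ, s * (π * κ) * (s * (π * t)) = κ * t := by
    intro t
    linear_combination (π * π * κ * t) * hs + κ * t * hπ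
  rw [h₂, h₂] at h₁
  refine le_of_mul_le_mul_left ?_ (pow_pos hρ (n + 1))
  linarith

lemma represents_of_commute {n : ℕ} {I : OrderingInstance 2 n}
    (h : ∀ i < n, ∀ j < n, mat I i * mat I j = mat I j * mat I i) (A B D : ℕ → ℝ) :
    Represents I A B D :=
  fun _ hL _ => ⟨hL, fun _ hL' => (listValue_eq_of_commute h hL hL').le⟩

end OrderingProof

namespace RealRAM

/-! ### Reasoning about programs -/

attribute [simp] NExp.eval RExp.eval Test.Holds

/-- The program `p`, started in the memory `s`, halts after at most `T` steps in a memory that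
satisfies `Q`. -/
def Prog.Ends (p : Prog) (T : ℕ) (s : State) (Q : State → Prop) : Prop :=
  ∃ t s', Runs p s t s' ∧ t ≤ T ∧ Q s'

/-- The weakest precondition of a program without loops. -/
@[simp] def Prog.wp : Prog → (State → Prop) → State → Prop
  | skip, Q, s => Q s
  | setNat a pos e, Q, s => Q (s.setNat a (pos.eval s) (e.eval s))
  | setReal a pos e, Q, s => Q (s.setReal a (pos.eval s) (e.eval s))
  | seq p q, Q, s => p.wp (q.wp Q) s
  | ite b p q, Q, s => (b.Holds s → p.wp Q s) ∧ (¬ b.Holds s → q.wp Q s)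
  | .while _ _, _, _ => False

/-- A bound for the number of steps of a program without loops. -/
def Prog.steps : Prog → ℕ
  | skip => 1
  | setNat _ pos e => pos.cost + e.cost + 1
  | setReal _ pos e => pos.cost + e.cost + 1
  | seq p q => p.steps + q.steps
  | ite b p q => b.cost + 1 + max p.steps q.steps
  | .while _ _ => 0

/-- The names of the arrays of natural numbers that a program may write to. -/
def Prog.natWrites : Prog → List ℕ
  | skip => []
  | setNat a _ _ => [a]
  | setReal _ _ _ => []
  | seq p q => p.natWrites ++ q.natWrites
  | ite _ p q => p.natWrites ++ q.natWrites
  | .while _ p => p.natWrites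

/-- The names of the arrays of real numbers that a program may write to. -/
def Prog.realWrites : Prog → List ℕ
  | skip => []
  | setNat _ _ _ => []
  | setReal a _ _ => [a]
  | seq p q => p.realWrites ++ q.realWrites
  | ite _ p q => p.realWrites ++ q.realWrites
  | .while _ p => p.realWrites

/-- The memories `s` and `s'` agree on the arrays that `p` does not write to. -/
structure Frame (p : Prog) (s s' : State) : Prop where
  nat : ∀ a, a ∉ p.natWrites → s'.nat a = s.nat a
  real : ∀ a, a ∉ p.realWrites → s'.real a = s.real a

@[simp] lemma State.nat_setNat_same (s : State) (a i v : ℕ) :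
    (s.setNat a i v).nat a = Function.update (s.nat a) i v := by simp [State.setNat]

@[simp] lemma State.nat_setNat_of_ne (s : State) {a b : ℕ} (i v : ℕ) (h : b ≠ a) :
    (s.setNat a i v).nat b = s.nat b := by simp [State.setNat, h]

@[simp] lemma State.real_setNat (s : State) (a i v : ℕ) : (s.setNat a i v).real = s.real := rfl

@[simp] lemma State.nat_setReal (s : State) (a i : ℕ) (v : ℝ) :
    (s.setReal a i v).nat = s.nat := rfl

@[simp] lemma State.real_setReal_same (s : State) (a i : ℕ) (v : ℝ) :
    (s.setReal a i v).real a = Function.update (s.real a) i v := by simp [State.setReal]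

@[simp] lemma State.real_setReal_of_ne (s : State) {a b : ℕ} (i : ℕ) (v : ℝ) (h : b ≠ a) :
    (s.setReal a i v).real b = s.real b := by simp [State.setReal, h]

lemma Runs.frame {p : Prog} {s s' : State} {t : ℕ} (h : Runs p s t s') : Frame p s s' := by
  induction h with
  | skip s => exact ⟨fun _ _ => rfl, fun _ _ => rfl⟩
  | setNat s a pos e =>
    refine ⟨fun b hb => ?_, fun _ _ => rfl⟩
    exact State.nat_setNat_of_ne _ _ _ (by simpa [Prog.natWrites] using hb)
  | setReal s a pos e =>
    refine ⟨fun _ _ => rfl, fun b hb => ?_⟩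
    exact State.real_setReal_of_ne _ _ _ (by simpa [Prog.realWrites] using hb)
  | seq _ _ ih₁ ih₂ =>
    constructor
    · intro a ha
      simp only [Prog.natWrites, List.mem_append, not_or] at ha
      rw [ih₂.nat a ha.2, ih₁.nat a ha.1]
    · intro a ha
      simp only [Prog.realWrites, List.mem_append, not_or] at ha
      rw [ih₂.real a ha.2, ih₁.real a ha.1]
  | iteTrue _ _ ih =>
    constructor
    · intro a ha
      simp only [Prog.natWrites, List.mem_append, not_or] at ha
      exact ih.nat a ha.1
    · intro a ha
      simp only [Prog.realWrites, List.mem_append, not_or] at ha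
      exact ih.real a ha.1
  | iteFalse _ _ ih =>
    constructor
    · intro a ha
      simp only [Prog.natWrites, List.mem_append, not_or] at ha
      exact ih.nat a ha.2
    · intro a ha
      simp only [Prog.realWrites, List.mem_append, not_or] at ha
      exact ih.real a ha.2
  | whileTrue _ _ _ ih₁ ih₂ =>
    constructor
    · intro a ha
      rw [ih₂.nat a ha, ih₁.nat a ha]
    · intro a ha
      rw [ih₂.real a ha, ih₁.real a ha]
  | whileFalse _ => exact ⟨fun _ _ => rfl, fun _ _ => rfl⟩

lemma Prog.Ends.mono {p : Prog} {T T' : ℕ} {s : State} {Q Q' : State → Prop} (h : p.Ends T s Q)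
    (hT : T ≤ T') (hQ : ∀ s', Frame p s s' → Q s' → Q' s') : p.Ends T' s Q' := by
  obtain ⟨t, s', hr, ht, hq⟩ := h
  exact ⟨t, s', hr, ht.trans hT, hQ s' hr.frame hq⟩

lemma Prog.Ends.seq {p q : Prog} {T T₁ T₂ : ℕ} {s : State} {Q : State → Prop}
    (h : p.Ends T₁ s fun s' => q.Ends T₂ s' Q) (hT : T₁ + T₂ ≤ T) : (p.seq q).Ends T s Q := by
  obtain ⟨t₁, s₁, hr₁, ht₁, t₂, s₂, hr₂, ht₂, hq⟩ := h
  exact ⟨t₁ + t₂, s₂, hr₁.seq hr₂, by omega, hq⟩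

lemma Prog.Ends.ite {b : Test} {p q : Prog} {T T' : ℕ} {s : State} {Q : State → Prop}
    (hp : b.Holds s → p.Ends T s Q) (hq : ¬ b.Holds s → q.Ends T s Q) (hT : b.cost + 1 + T ≤ T') :
    (Prog.ite b p q).Ends T' s Q := by
  by_cases hb : b.Holds s
  · obtain ⟨t, s', hr, ht, h⟩ := hp hb
    exact ⟨_, s', Runs.iteTrue hb hr, by omega, h⟩
  · obtain ⟨t, s', hr, ht, h⟩ := hq hb
    exact ⟨_, s', Runs.iteFalse hb hr, by omega, h⟩

lemma Prog.ends_of_wp {p : Prog} {T : ℕ} {s : State} {Q : State → Prop} (h : p.wp Q s)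
    (hT : p.steps ≤ T) : p.Ends T s Q := by
  suffices H : p.Ends p.steps s Q from H.mono hT fun _ _ h => h
  clear hT
  induction p generalizing s Q with
  | skip => exact ⟨1, s, .skip s, le_rfl, h⟩
  | setNat a pos e => exact ⟨_, _, .setNat s a pos e, le_rfl, h⟩
  | setReal a pos e => exact ⟨_, _, .setReal s a pos e, le_rfl, h⟩
  | seq p q ihp ihq =>
    exact ((ihp h).mono le_rfl fun s' _ h' => ihq h').seq le_rfl
  | ite b p q ihp ihq =>
    exact Prog.Ends.ite (T := max p.steps q.steps)
      (fun hb => (ihp (h.1 hb)).mono (le_max_left _ _) fun _ _ h => h)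
      (fun hb => (ihq (h.2 hb)).mono (le_max_right _ _) fun _ _ h => h) le_rfl
  | _ => exact h.elim

/-- The rule for loops with a variant: the invariant `J k` has to hold when `k` further iterations
are due. -/
lemma Prog.ends_while {b : Test} {p : Prog} {Q : State → Prop} {c : ℕ} (J : ℕ → State → Prop)
    (hstep : ∀ k s, J (k + 1) s → b.Holds s ∧ p.Ends c s (J k))
    (hdone : ∀ s, J 0 s → ¬ b.Holds s ∧ Q s) (N : ℕ) {T : ℕ} {s : State} (h : J N s)
    (hT : N * (c + b.cost + 1) + (b.cost + 1) ≤ T) : (Prog.while b p).Ends T s Q := by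
  suffices H : (Prog.while b p).Ends (N * (c + b.cost + 1) + (b.cost + 1)) s Q from
    H.mono hT fun _ _ h => h
  clear hT
  induction N generalizing s with
  | zero =>
    obtain ⟨hb, hq⟩ := hdone s h
    exact ⟨_, s, .whileFalse hb, by simp, hq⟩
  | succ N ih =>
    obtain ⟨hb, t₁, s₁, hr₁, ht₁, h₁⟩ := hstep N s h
    obtain ⟨t₂, s₂, hr₂, ht₂, h₂⟩ := ih h₁
    refine ⟨_, s₂, .whileTrue hb hr₁ hr₂, ?_, h₂⟩
    rw [Nat.succ_mul]
    omega

/-- The entry at position `0` of an array of natural numbers, used as a variable. -/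
abbrev nvar (v : ℕ) : NExp := .get v (.lit 0)

/-- The entry at position `0` of an array of real numbers, used as a variable. -/
abbrev rvar (v : ℕ) : RExp := .get v (.lit 0)

/-- Assignment to a variable. -/
abbrev letNat (v : ℕ) (e : NExp) : Prog := .setNat v (.lit 0) e

/-- Assignment to a variable. -/
abbrev letReal (v : ℕ) (e : RExp) : Prog := .setReal v (.lit 0) e

/-- Sequential composition of a list of programs. -/
@[simp] def block : List Prog → Prog
  | [] => .skip
  | [p] => p
  | p :: q :: l => .seq p (block (q :: l))

/-- `for v := 0, 1, …` while `v < e`. -/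
def forLoop (v : ℕ) (e : NExp) (p : Prog) : Prog :=
  .seq (letNat v (.lit 0))
    (.while (.not (.natLe e (nvar v))) (.seq p (letNat v (.add (nvar v) (.lit 1)))))

/-- The rule for counting loops; `c i` bounds the steps of the iteration number `i`. -/
lemma ends_forLoop {v : ℕ} {e : NExp} {p : Prog} {T : ℕ} {s₀ : State} {Q : State → Prop}
    (N : ℕ) (c : ℕ → ℕ) (J : ℕ → State → Prop) (hv : v ∉ p.natWrites)
    (h₀ : J 0 (s₀.setNat v 0 0))
    (he : ∀ i s, i ≤ N → Frame (forLoop v e p) s₀ s → s.nat v 0 = i → J i s → e.eval s = N)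
    (hstep : ∀ i s, i < N → Frame (forLoop v e p) s₀ s → s.nat v 0 = i → J i s →
      p.Ends (c i) s fun s' => J (i + 1) (s'.setNat v 0 (i + 1)))
    (hQ : ∀ s, Frame (forLoop v e p) s₀ s → s.nat v 0 = N → J N s → Q s)
    (hT : ∑ i ∈ Finset.range N, c i + N * (e.cost + 11) + (e.cost + 8) ≤ T) :
    (forLoop v e p).Ends T s₀ Q := by
  -- The induction runs over the number `k` of iterations that are still due.
  have key : ∀ k s i, i + k = N → Frame (forLoop v e p) s₀ s → s.nat v 0 = i → J i s →
      (Prog.while (.not (.natLe e (nvar v))) (.seq p (letNat v (.add (nvar v) (.lit 1))))).Ends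
        (∑ j ∈ Finset.Ico i N, c j + k * (e.cost + 11) + (e.cost + 5)) s Q := by
    intro k
    induction k with
    | zero =>
      intro s i hi hF hs hJ
      obtain rfl : i = N := by omega
      refine ⟨_, s, .whileFalse ?_, ?_, hQ s hF hs hJ⟩
      · simp [Test.Holds, NExp.eval, hs, he i s le_rfl hF hs hJ]
      · simp [Test.cost, NExp.cost]
    | succ k ih =>
      intro s i hi hF hs hJ
      have hlt : i < N := by omega
      obtain ⟨t₁, s₁, hr₁, ht₁, hJ₁⟩ := hstep i s hlt hF hs hJ
      have hinc := Runs.setNat s₁ v (.lit 0) (.add (nvar v) (.lit 1))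
      have hv₁ : s₁.nat v 0 = i := by rw [hr₁.frame.nat v hv, hs]
      simp only [NExp.eval, hv₁] at hinc
      have hF₁ : Frame (forLoop v e p) s₀ (s₁.setNat v 0 (i + 1)) := by
        constructor
        · intro a ha
          simp only [forLoop, Prog.natWrites, List.mem_append, List.mem_singleton, not_or]
            at ha
          rw [State.nat_setNat_of_ne _ _ _ ha.1, hr₁.frame.nat a (by tauto), hF.nat a ?_]
          simp only [forLoop, Prog.natWrites, List.mem_append, List.mem_singleton]
          tauto
        · intro a ha
          have ha' := ha
          simp only [forLoop, Prog.realWrites, List.mem_append, List.not_mem_nil, or_false,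
            false_or] at ha'
          rw [State.real_setNat, hr₁.frame.real a ha', hF.real a ha]
      obtain ⟨t₂, s₂, hr₂, ht₂, hq⟩ := ih (s₁.setNat v 0 (i + 1)) (i + 1) (by omega) hF₁
        (by simp) hJ₁
      refine ⟨_, s₂, .whileTrue ?_ (hr₁.seq hinc) hr₂, ?_, hq⟩
      · simp [Test.Holds, NExp.eval, hs, he i s hlt.le hF hs hJ, hlt]
      · rw [Finset.sum_eq_sum_Ico_succ_bot hlt, Nat.succ_mul]
        simp only [Test.cost, NExp.cost]
        omega
  have hF : Frame (forLoop v e p) s₀ (s₀.setNat v 0 0) := by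
    refine ⟨fun a ha => State.nat_setNat_of_ne _ _ _ ?_, fun _ _ => rfl⟩
    rintro rfl
    exact ha (by simp [forLoop, Prog.natWrites])
  obtain ⟨t, s', hr, ht, hq⟩ := key N _ 0 (by omega) hF (by simp) h₀
  refine ⟨_, s', (Runs.setNat s₀ v (.lit 0) (.lit 0)).seq hr, ?_, hq⟩
  simp only [Finset.range_eq_Ico] at hT
  simp only [NExp.cost]
  omega

/-- The rule for counting loops with a uniform bound for the iterations. -/
lemma ends_forLoop_const {v : ℕ} {e : NExp} {p : Prog} {T : ℕ} {s₀ : State} {Q : State → Prop}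
    (N c : ℕ) (J : ℕ → State → Prop) (hv : v ∉ p.natWrites)
    (h₀ : J 0 (s₀.setNat v 0 0))
    (he : ∀ i s, i ≤ N → Frame (forLoop v e p) s₀ s → s.nat v 0 = i → J i s → e.eval s = N)
    (hstep : ∀ i s, i < N → Frame (forLoop v e p) s₀ s → s.nat v 0 = i → J i s →
      p.Ends c s fun s' => J (i + 1) (s'.setNat v 0 (i + 1)))
    (hQ : ∀ s, Frame (forLoop v e p) s₀ s → s.nat v 0 = N → J N s → Q s)
    (hT : N * (c + e.cost + 11) + (e.cost + 8) ≤ T) :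
    (forLoop v e p).Ends T s₀ Q := by
  refine ends_forLoop N (fun _ => c) J hv h₀ he hstep hQ ?_
  rw [Finset.sum_const, Finset.card_range, smul_eq_mul, ← Nat.mul_add]
  rw [add_assoc] at hT
  exact hT

/-- The entries `f lo, …, f (lo + k - 1)` of an array. -/
def seg (f : ℕ → ℕ) (lo k : ℕ) : List ℕ := (List.range' lo k).map f

@[simp] lemma length_seg (f : ℕ → ℕ) (lo k : ℕ) : (seg f lo k).length = k := by simp [seg]

@[simp] lemma seg_zero (f : ℕ → ℕ) (lo : ℕ) : seg f lo 0 = [] := by simp [seg]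

lemma seg_succ (f : ℕ → ℕ) (lo k : ℕ) : seg f lo (k + 1) = f lo :: seg f (lo + 1) k := by
  simp [seg, List.range'_succ]

lemma seg_concat (f : ℕ → ℕ) (lo k : ℕ) : seg f lo (k + 1) = seg f lo k ++ [f (lo + k)] := by
  simp [seg, List.range'_concat]

lemma seg_append (f : ℕ → ℕ) (lo k l : ℕ) : seg f lo (k + l) = seg f lo k ++ seg f (lo + k) l := by
  induction l with
  | zero => simp
  | succ l ih => rw [← add_assoc, seg_concat, ih, seg_concat, List.append_assoc, add_assoc]

lemma seg_congr {f g : ℕ → ℕ} {lo k : ℕ} (h : ∀ i, lo ≤ i → i < lo + k → f i = g i) :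
    seg f lo k = seg g lo k := by
  refine List.map_congr_left fun i hi => ?_
  rw [List.mem_range'_1] at hi
  exact h i hi.1 hi.2

lemma seg_update {f : ℕ → ℕ} {lo k j x : ℕ} (h : j < lo ∨ lo + k ≤ j) :
    seg (Function.update f j x) lo k = seg f lo k :=
  seg_congr fun i h₁ h₂ => Function.update_of_ne (by omega) _ _

lemma seg_update_concat (f : ℕ → ℕ) (lo k x : ℕ) :
    seg (Function.update f (lo + k) x) lo (k + 1) = seg f lo k ++ [x] := by
  rw [seg_concat, seg_update (by omega), Function.update_self]

lemma getElem_seg (f : ℕ → ℕ) (lo k i : ℕ) (h : i < (seg f lo k).length) :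
    (seg f lo k)[i] = f (lo + i) := by
  simp [seg]

lemma seg_eq_iff {f : ℕ → ℕ} {lo : ℕ} {L : List ℕ} :
    seg f lo L.length = L ↔ ∀ i (h : i < L.length), f (lo + i) = L[i] := by
  constructor
  · intro hL i h
    rw [← getElem_seg f lo L.length i (by simpa using h)]
    exact List.getElem_of_eq hL _
  · intro h
    refine List.ext_getElem (by simp) fun i h₁ h₂ => ?_
    rw [getElem_seg, h i h₂]

open OrderingProof

/-! ### The common eigenvector -/

/-- The entry at the position stored in a variable. -/
abbrev nat_ (a v : ℕ) : NExp := .get a (nvar v)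

/-- The entry at the position stored in a variable. -/
abbrev real_ (a v : ℕ) : RExp := .get a (nvar v)

/-- The test whether a real number is zero. -/
def Test.isZero (e : RExp) : Test := .and (.realLe e (.lit 0)) (.realLe (.lit 0) e)

@[simp] lemma Test.holds_isZero (e : RExp) (s : State) :
    (Test.isZero e).Holds s ↔ e.eval s = 0 := by
  simp only [Test.isZero, Test.Holds, RExp.eval, Rat.cast_zero]
  exact le_antisymm_iff.symm

/-- The memory contains the instance `I` where the input has been placed. -/
structure Loaded {n : ℕ} (I : OrderingInstance 2 n) (s : State) : Prop where
  size : s.nat 0 0 = n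
  m00 : ∀ i, s.real 0 i = mat I i 0 0
  m01 : ∀ i, s.real 1 i = mat I i 0 1
  m10 : ∀ i, s.real 2 i = mat I i 1 0
  m11 : ∀ i, s.real 3 i = mat I i 1 1
  w0 : s.real 4 0 = I.w 0
  w1 : s.real 4 1 = I.w 1
  y0 : s.real 5 0 = I.y 0
  y1 : s.real 5 1 = I.y 1

lemma loaded_input {n : ℕ} (I : OrderingInstance 2 n) : Loaded I (input I) := by
  constructor <;> simp only [input, mat] <;> try intro i
  all_goals first | rfl | (split_ifs <;> rfl)

lemma Loaded.frame {n : ℕ} {I : OrderingInstance 2 n} {s s' : State} {p : Prog} (h : Loaded I s)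
    (hF : Frame p s s') (hn : 0 ∉ p.natWrites)
    (hr : ∀ a ∈ [0, 1, 2, 3, 4, 5], a ∉ p.realWrites) : Loaded I s' := by
  obtain ⟨h₀, h₁, h₂, h₃, h₄, h₅, h₆, h₇, h₈⟩ := h
  have r : ∀ a ∈ [0, 1, 2, 3, 4, 5], s'.real a = s.real a := fun a ha => hF.real a (hr a ha)
  constructor
  · rwa [hF.nat 0 hn]
  all_goals rw [r _ (by decide)]; assumption

/-- Computes the commutator of the matrix number `i` and a reference matrix. If it does not vanish,
it determines the common eigenvector. As long as all commutators vanish, the reference matrix is the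
first one that is not scalar. -/
def eigenStep : Prog := block [
  .setReal 14 (.lit 0)
    (.sub (.mul (real_ 1 3) (real_ 2 2)) (.mul (real_ 1 2) (real_ 2 3))),
  .setReal 15 (.lit 0)
    (.sub (.mul (.sub (real_ 0 3) (real_ 3 3)) (real_ 1 2))
      (.mul (real_ 1 3) (.sub (real_ 0 2) (real_ 3 2)))),
  .setReal 16 (.lit 0)
    (.sub (.mul (real_ 2 3) (.sub (real_ 0 2) (real_ 3 2)))
      (.mul (real_ 2 2) (.sub (real_ 0 3) (real_ 3 3)))),
  .ite (.isZero (rvar 16))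
    (.ite (.isZero (rvar 15)) .skip (block [letReal 6 (.lit 1), letReal 7 (.lit 0)]))
    (block [letReal 6 (rvar 14), letReal 7 (rvar 16)]),
  .ite (.and (.isZero (real_ 1 3)) (.and (.isZero (real_ 2 3))
      (.isZero (.sub (real_ 0 3) (real_ 3 3)))))
    (letNat 3 (nvar 2)) .skip]

/-- Computes a common eigenvector, or the zero vector if all matrices commute. The coordinates are
the variables 6 and 7. -/
def eigenProg : Prog := forLoop 2 (nvar 0) eigenStep

/-- The vector `(p, q)` is a common eigenvector of all matrices, or it is zero and the matrices
commute. -/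
def IsCommonEigen {n : ℕ} (I : OrderingInstance 2 n) (p q : ℝ) : Prop :=
  (¬ (p = 0 ∧ q = 0) → ∀ i, IsEigen (mat I i) p q) ∧
  (p = 0 ∧ q = 0 → ∀ i < n, ∀ j < n, mat I i * mat I j = mat I j * mat I i)

/-- The invariant of `eigenProg`; `r` is the position of the reference matrix. -/
def EigenInv {n : ℕ} (I : OrderingInstance 2 n) (i r : ℕ) (p q : ℝ) : Prop :=
  (¬ (p = 0 ∧ q = 0) → ∀ i, IsEigen (mat I i) p q) ∧
  (p = 0 ∧ q = 0 → ∀ j < i, mat I r * mat I j = mat I j * mat I r ∧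
    (IsScalar (mat I r) → IsScalar (mat I j)))

lemma EigenInv.isCommonEigen {n : ℕ} {I : OrderingInstance 2 n} {r : ℕ} {p q : ℝ}
    (h : EigenInv I n r p q) : IsCommonEigen I p q := by
  refine ⟨h.1, fun h₀ i hi j hj => ?_⟩
  by_cases hr : IsScalar (mat I r)
  · exact (((h.2 h₀ i hi).2 hr).commute _)
  · exact commute_of_commute hr (h.2 h₀ i hi).1 (h.2 h₀ j hj).1

/-- The reference matrix is replaced when it is scalar. -/
lemma EigenInv.succ {n : ℕ} {I : OrderingInstance 2 n} {i r : ℕ} {p q : ℝ}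
    (h : EigenInv I i r p q)
    (hc : p = 0 ∧ q = 0 → mat I r * mat I i = mat I i * mat I r) :
    (IsScalar (mat I r) → EigenInv I (i + 1) i p q) ∧
      (¬ IsScalar (mat I r) → EigenInv I (i + 1) r p q) := by
  refine ⟨fun hr => ⟨h.1, fun h₀ j hj => ?_⟩, fun hr => ⟨h.1, fun h₀ j hj => ?_⟩⟩
  · rcases Nat.lt_succ_iff_lt_or_eq.1 hj with hj | rfl
    · have := (h.2 h₀ j hj).2 hr
      exact ⟨(this.commute _).symm, fun _ => this⟩
    · exact ⟨rfl, fun h => h⟩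
  · rcases Nat.lt_succ_iff_lt_or_eq.1 hj with hj | rfl
    · exact h.2 h₀ j hj
    · exact ⟨hc h₀, fun h => absurd h hr⟩

lemma ends_eigenStep {n : ℕ} {I : OrderingInstance 2 n} {s : State} {i : ℕ}
    (hI : SimultaneouslyTriangularizable I.M) (hs : Loaded I s) (hi : s.nat 2 0 = i)
    (h : EigenInv I i (s.nat 3 0) (s.real 6 0) (s.real 7 0)) :
    eigenStep.Ends 150 s fun s' => EigenInv I (i + 1) (s'.nat 3 0) (s'.real 6 0) (s'.real 7 0) := by
  obtain ⟨p, q, hpq, he⟩ := exists_isEigen hI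
  refine Prog.ends_of_wp ?_ (by decide)
  obtain ⟨hp, h₁, h₂⟩ := isEigen_commutator hpq (he (s.nat 3 0)) (he i) rfl rfl rfl
  generalize hx : mat I (s.nat 3 0) 0 1 * mat I i 1 0 - mat I i 0 1 * mat I (s.nat 3 0) 1 0 = x
    at *
  generalize hy : (mat I (s.nat 3 0) 0 0 - mat I (s.nat 3 0) 1 1) * mat I i 0 1 -
    mat I (s.nat 3 0) 0 1 * (mat I i 0 0 - mat I i 1 1) = y at *
  generalize hz : mat I (s.nat 3 0) 1 0 * (mat I i 0 0 - mat I i 1 1) -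
    mat I i 1 0 * (mat I (s.nat 3 0) 0 0 - mat I (s.nat 3 0) 1 1) = z at *
  -- The vector that is found is parallel to `(p, q)`.
  have main : ∀ p' q' : ℝ, p * q' = q * p' → ¬ (p' = 0 ∧ q' = 0) →
      EigenInv I i (s.nat 3 0) p' q' := fun p' q' h h' =>
    ⟨fun _ j => (he j).of_parallel hpq h, fun h₀ => absurd h₀ h'⟩
  have k₁ : z = 0 → y = 0 → _ := fun hz hy => h.succ fun _ => h₂ hz hy
  have k₂ : z = 0 → y ≠ 0 → _ := fun hz hy => (main 1 0
    (by simp [(mul_eq_zero.1 (h₁ hz)).resolve_right hy]) (by simp)).succ fun h => absurd h (by simp)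
  have k₃ : z ≠ 0 → _ := fun hz => (main x z hp (by simp [hz])).succ
    fun h => absurd h (by simp [hz])
  have hsc : IsScalar (mat I (s.nat 3 0)) ↔ (mat I (s.nat 3 0) 0 1 = 0 ∧
    mat I (s.nat 3 0) 1 0 = 0 ∧ mat I (s.nat 3 0) 0 0 - mat I (s.nat 3 0) 1 1 = 0) := by
    rw [sub_eq_zero]; rfl
  rw [hsc] at k₁ k₂ k₃
  simp only [eigenStep, block, Prog.wp, NExp.eval, RExp.eval, Test.Holds, Test.holds_isZero,
    State.nat_setReal, State.real_setReal_same, State.real_setReal_of_ne, ne_eq,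
    Nat.reduceEqDiff, not_false_eq_true, Function.update_self,
    hs.m00, hs.m01, hs.m10, hs.m11, hi, hx, hy, hz, State.nat_setNat_same, State.real_setNat,
    Rat.cast_one, Rat.cast_zero]
  exact ⟨fun hz => ⟨fun hy => k₁ hz hy, fun hy => k₂ hz hy⟩, fun hz => k₃ hz⟩

lemma ends_eigenProg {n : ℕ} {I : OrderingInstance 2 n}
    (hI : SimultaneouslyTriangularizable I.M) :
    eigenProg.Ends (200 * (n + 1)) (input I) fun s =>
      Loaded I s ∧ IsCommonEigen I (s.real 6 0) (s.real 7 0) := by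
  have hL : ∀ s, Frame eigenProg (input I) s → Loaded I s := fun s hF =>
    (loaded_input I).frame hF (by decide) (by decide)
  refine ends_forLoop_const n 150
    (fun i s => EigenInv I i (s.nat 3 0) (s.real 6 0) (s.real 7 0)) (by decide) ?_ ?_ ?_ ?_ ?_
  · simp [EigenInv, input]
  · intro i s _ hF _ _
    exact (hL s hF).size
  · intro i s _ hF hi h
    refine (ends_eigenStep hI (hL s hF) hi h).mono le_rfl fun s' _ h' => ?_
    simpa using h'
  · intro s hF _ h
    exact ⟨hL s hF, h.isCommonEigen⟩
  · simp only [NExp.cost]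
    omega

/-! ### Triangular coordinates -/

/-- The upper left entry of the matrix `M`, in the basis `(p, q)`, `(-q, p)` and up to a factor. -/
def eigA (M : Matrix (Fin 2) (Fin 2) ℝ) (p q : ℝ) : ℝ :=
  p * (M 0 0 * p + M 0 1 * q) + q * (M 1 0 * p + M 1 1 * q)

/-- The upper right entry of the matrix `M`, in the basis `(p, q)`, `(-q, p)` and up to a factor. -/
def eigB (M : Matrix (Fin 2) (Fin 2) ℝ) (p q : ℝ) : ℝ :=
  p * (M 0 1 * p - M 0 0 * q) + q * (M 1 1 * p - M 1 0 * q)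

/-- The lower right entry of the matrix `M`, in the basis `(p, q)`, `(-q, p)` and up to a factor. -/
def eigD (M : Matrix (Fin 2) (Fin 2) ℝ) (p q : ℝ) : ℝ :=
  p * (M 1 1 * p - M 1 0 * q) - q * (M 0 1 * p - M 0 0 * q)

lemma eigA_mul_eigD {M : Matrix (Fin 2) (Fin 2) ℝ} {p q : ℝ} (h : IsEigen M p q) :
    eigA M p q * eigD M p q = (p ^ 2 + q ^ 2) ^ 2 * M.det := by
  unfold IsEigen at h
  rw [Matrix.det_fin_two, eigA, eigD]
  linear_combination (p * (M 0 1 * p - M 0 0 * q) + q * (M 1 1 * p - M 1 0 * q)) * h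

/-- The slope of the objective as an affine function of the upper right entry of the product. -/
def slope {n : ℕ} (I : OrderingInstance 2 n) (p q : ℝ) : ℝ :=
  (I.w 0 * p + I.w 1 * q) * (I.y 1 * p - I.y 0 * q)

/-- Computes the triangular form of the matrix number `i` and changes its sign if necessary. -/
def normalizeStep : Prog := block [
  .setReal 8 (nvar 2)
    (.add (.mul (rvar 6) (.add (.mul (real_ 0 2) (rvar 6)) (.mul (real_ 1 2) (rvar 7))))
      (.mul (rvar 7) (.add (.mul (real_ 2 2) (rvar 6)) (.mul (real_ 3 2) (rvar 7))))),
  .setReal 9 (nvar 2)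
    (.add (.mul (rvar 6) (.sub (.mul (real_ 1 2) (rvar 6)) (.mul (real_ 0 2) (rvar 7))))
      (.mul (rvar 7) (.sub (.mul (real_ 3 2) (rvar 6)) (.mul (real_ 2 2) (rvar 7))))),
  .setReal 10 (nvar 2)
    (.sub (.mul (rvar 6) (.sub (.mul (real_ 3 2) (rvar 6)) (.mul (real_ 2 2) (rvar 7))))
      (.mul (rvar 7) (.sub (.mul (real_ 1 2) (rvar 6)) (.mul (real_ 0 2) (rvar 7))))),
  .ite (.and (.realLe (.lit 0) (real_ 10 2))
      (.not (.and (.realLe (real_ 10 2) (.lit 0)) (.not (.realLe (.lit 0) (real_ 8 2))))))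
    .skip
    (block [
      .setReal 8 (nvar 2) (.sub (.lit 0) (real_ 8 2)),
      .setReal 9 (nvar 2) (.sub (.lit 0) (real_ 9 2)),
      .setReal 10 (nvar 2) (.sub (.lit 0) (real_ 10 2)),
      letReal 13 (.sub (.lit 0) (rvar 13))])]

/-- Computes the triangular forms of all matrices, normalised by signs; the variable 13 is the slope
of the objective. -/
def normalizeProg : Prog := .seq
  (letReal 13
    (.mul (.add (.mul (.get 4 (.lit 0)) (rvar 6)) (.mul (.get 4 (.lit 1)) (rvar 7)))
      (.sub (.mul (.get 5 (.lit 1)) (rvar 6)) (.mul (.get 5 (.lit 0)) (rvar 7)))))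
  (forLoop 2 (nvar 0) normalizeStep)

/-- The triangular forms of the first `i` matrices, multiplied by the signs `c`, are in the arrays
`A`, `B`, `D`, and `κ` is the slope multiplied by these signs. -/
def NormInv {n : ℕ} (I : OrderingInstance 2 n) (p q : ℝ) (i : ℕ) (A B D : ℕ → ℝ) (κ : ℝ) : Prop :=
  ∃ c : ℕ → ℝ, (∀ j, c j * c j = 1) ∧ κ = ((List.range i).map c).prod * slope I p q ∧
    ∀ j < i, A j = c j * eigA (mat I j) p q ∧ B j = c j * eigB (mat I j) p q ∧
      D j = c j * eigD (mat I j) p q ∧ 0 ≤ D j ∧ (D j = 0 → 0 ≤ A j)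

lemma NormInv.succ {n : ℕ} {I : OrderingInstance 2 n} {p q : ℝ} {i : ℕ} {A B D : ℕ → ℝ} {κ : ℝ}
    (h : NormInv I p q i A B D κ) (σ : ℝ) (hσ : σ * σ = 1) (h₁ : 0 ≤ σ * eigD (mat I i) p q)
    (h₂ : σ * eigD (mat I i) p q = 0 → 0 ≤ σ * eigA (mat I i) p q) :
    NormInv I p q (i + 1) (Function.update A i (σ * eigA (mat I i) p q))
      (Function.update B i (σ * eigB (mat I i) p q))
      (Function.update D i (σ * eigD (mat I i) p q)) (σ * κ) := by
  obtain ⟨c, hc, hκ, h⟩ := h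
  refine ⟨Function.update c i σ, fun j => ?_, ?_, fun j hj => ?_⟩
  · by_cases hj : j = i
    · subst hj; simpa using hσ
    · simpa [hj] using hc j
  · have : (List.range i).map (Function.update c i σ) = (List.range i).map c :=
      List.map_congr_left fun j hj =>
        Function.update_of_ne (List.mem_range.1 hj).ne _ _
    rw [List.range_succ, List.map_append, this, hκ]
    simp only [List.map_cons, List.map_nil, Function.update_self, List.prod_append,
      List.prod_singleton]
    ring
  · rcases Nat.lt_succ_iff_lt_or_eq.1 hj with hj | rfl
    · simpa [hj.ne] using h j hj
    · simp only [Function.update_self, true_and]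
      exact ⟨h₁, h₂⟩

lemma ends_normalizeStep {n : ℕ} {I : OrderingInstance 2 n} {s : State} {i : ℕ}
    (hs : Loaded I s) (hi : s.nat 2 0 = i)
    (h : NormInv I (s.real 6 0) (s.real 7 0) i (s.real 8) (s.real 9) (s.real 10) (s.real 13 0)) :
    normalizeStep.Ends 250 s fun s' =>
      NormInv I (s.real 6 0) (s.real 7 0) (i + 1) (s'.real 8) (s'.real 9) (s'.real 10)
        (s'.real 13 0) := by
  refine Prog.ends_of_wp ?_ (by decide)
  simp only [normalizeStep, block, Prog.wp, NExp.eval, RExp.eval, Test.Holds,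
    State.nat_setReal, State.real_setReal_same, State.real_setReal_of_ne, ne_eq,
    Nat.reduceEqDiff, not_false_eq_true, Function.update_self, Function.update_idem,
    hs.m00, hs.m01, hs.m10, hs.m11, hi, Rat.cast_zero, zero_sub]
  refine ⟨fun hk => ?_, fun hk => ?_⟩
  · have := h.succ 1 (by norm_num) (by rw [one_mul]; exact hk.1) (by
      rw [one_mul, one_mul]
      intro h0
      by_contra hA
      exact hk.2 ⟨h0.le, hA⟩)
    simpa only [one_mul, eigA, eigB, eigD] using this
  · have := h.succ (-1) (by norm_num)
      (by
        rw [neg_one_mul, neg_nonneg]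
        by_contra hA
        exact hk ⟨(not_le.1 hA).le, fun h' => hA h'.1⟩)
      (by
        rw [neg_one_mul, neg_one_mul, neg_eq_zero, neg_nonneg]
        intro h0
        by_contra hA
        exact hk ⟨h0.ge, fun h' => h'.2 (not_le.1 hA).le⟩)
    simpa only [neg_one_mul, eigA, eigB, eigD] using this

lemma ends_normalizeProg {n : ℕ} {I : OrderingInstance 2 n} {s₀ : State} (hI : Loaded I s₀) :
    normalizeProg.Ends (300 * (n + 1)) s₀ fun s =>
      NormInv I (s₀.real 6 0) (s₀.real 7 0) n (s.real 8) (s.real 9) (s.real 10) (s.real 13 0) := by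
  refine Prog.Ends.seq (T₁ := 50) (T₂ := 300 * n + 200)
    (Prog.ends_of_wp (Q := fun s => Loaded I s ∧ s.real 6 = s₀.real 6 ∧ s.real 7 = s₀.real 7 ∧
      s.real 13 0 = slope I (s₀.real 6 0) (s₀.real 7 0)) ?_ (by decide) |>.mono le_rfl ?_)
    (by omega)
  · refine ⟨hI.frame (Runs.setReal s₀ 13 (.lit 0) _).frame (by decide) (by decide), ?_⟩
    simp [slope, hI.w0, hI.w1, hI.y0, hI.y1]
  · rintro s₁ - ⟨hI₁, h6, h7, h13⟩
    have hL : ∀ s, Frame (forLoop 2 (nvar 0) normalizeStep) s₁ s → Loaded I s := fun s hF =>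
      hI₁.frame hF (by decide) (by decide)
    rw [← h6, ← h7]
    refine ends_forLoop_const n 250
      (fun i s => NormInv I (s₁.real 6 0) (s₁.real 7 0) i (s.real 8) (s.real 9) (s.real 10)
        (s.real 13 0)) (by decide) ?_ ?_ ?_ ?_ ?_
    · refine ⟨fun _ => 1, by simp, ?_, by simp⟩
      simp [h13, h6, h7]
    · intro i s _ hF _ _
      exact (hL s hF).size
    · intro i s _ hF hi h
      rw [← hF.real 6 (by decide), ← hF.real 7 (by decide)] at h
      refine (ends_normalizeStep (hL s hF) hi h).mono le_rfl fun s' _ h' => ?_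
      rw [hF.real 6 (by decide), hF.real 7 (by decide)] at h'
      simpa using h'
    · intro s _ _ h
      exact h
    · simp only [NExp.cost]
      omega

/-! ### Keys and classes -/

/-- The vector `(kb, kg)` is a positive direction of `(b, g)`, and `cl` is the number of its class.
A direction is chosen for the zero vector, too. -/
def IsKey (b g kb kg : ℝ) (cl : ℕ) : Prop :=
  (∃ t, 0 ≤ t ∧ b = t * kb ∧ g = t * kg) ∧
    (cl = 0 ∧ (0 < kg ∨ kg = 0 ∧ kb < 0) ∨ cl = 1 ∧ (kg < 0 ∨ kg = 0 ∧ 0 < kb))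

/-- The memory after the preparation: the arrays `8`, `9`, `10` represent the instance, the arrays
`11` and `12` and the natural array `9` hold the keys and classes, and the indices are divided into
those of positive type (natural array `6`) and those of negative type (natural array `8`). The
natural array `7` divides the array `6` into runs of length one. -/
structure Prepared {n : ℕ} (I : OrderingInstance 2 n) (s : State) : Prop where
  size : s.nat 0 0 = n
  represents : Represents I (s.real 8) (s.real 9) (s.real 10)
  nonneg : ∀ i < n, 0 ≤ s.real 8 i → 0 ≤ s.real 10 i
  pos : ∀ i < n, s.real 8 i < 0 → 0 < s.real 10 i
  det : ∀ i < n, s.real 8 i < 0 → (mat I i).det < 0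
  key : ∀ i < n, IsKey (s.real 9 i) (s.real 8 i - s.real 10 i) (s.real 11 i) (s.real 12 i)
    (s.nat 9 i)
  positives : seg (s.nat 6) 0 (s.nat 4 0) = (List.range n).filter (0 ≤ s.real 8 ·)
  negatives : seg (s.nat 8) 0 (s.nat 5 0) = (List.range n).filter (¬ 0 ≤ s.real 8 ·)
  runs : ∀ r ≤ s.nat 4 0, s.nat 7 r = r

/-- Computes the key of the matrix number `i` and its class. If the slope is negative, the upper right
entry is negated beforehand. -/
def keyStep : Prog := block [
  .ite (.realLe (.lit 0) (rvar 13)) .skip (.setReal 9 (nvar 2) (.sub (.lit 0) (real_ 9 2))),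
  .setReal 11 (nvar 2) (real_ 9 2),
  .setReal 12 (nvar 2) (.sub (real_ 8 2) (real_ 10 2)),
  .ite (.and (.isZero (real_ 11 2)) (.isZero (real_ 12 2))) (.setReal 11 (nvar 2) (.lit (-1)))
    .skip,
  .ite (.realLe (.lit 0) (real_ 12 2))
    (.ite (.and (.realLe (real_ 12 2) (.lit 0)) (.realLe (.lit 0) (real_ 11 2)))
      (.setNat 9 (nvar 2) (.lit 1)) (.setNat 9 (nvar 2) (.lit 0)))
    (.setNat 9 (nvar 2) (.lit 1))]

/-- Appends the index `i` to the list of its type. -/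
def divideStep : Prog :=
  .ite (.realLe (.lit 0) (real_ 8 2))
    (block [.setNat 6 (nvar 4) (nvar 2), .setNat 7 (nvar 4) (nvar 4),
      letNat 4 (.add (nvar 4) (.lit 1))])
    (block [.setNat 8 (nvar 5) (nvar 2), letNat 5 (.add (nvar 5) (.lit 1))])

/-- Computes all keys and divides the indices by their types. -/
def keyProg : Prog := .seq (forLoop 2 (nvar 0) (.seq keyStep divideStep))
  (.setNat 7 (nvar 4) (nvar 4))

lemma ends_keyStep {s : State} {i : ℕ} (hi : s.nat 2 0 = i) :
    keyStep.Ends 150 s fun s' => ∃ kb cl,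
      let b := if 0 ≤ s.real 13 0 then s.real 9 i else - s.real 9 i
      s'.real 9 = Function.update (s.real 9) i b ∧
      s'.real 11 = Function.update (s.real 11) i kb ∧
      s'.real 12 = Function.update (s.real 12) i (s.real 8 i - s.real 10 i) ∧
      s'.nat 9 = Function.update (s.nat 9) i cl ∧
      IsKey b (s.real 8 i - s.real 10 i) kb (s.real 8 i - s.real 10 i) cl := by
  have hkey : ∀ b g : ℝ, ¬ (b = 0 ∧ g = 0) → ∀ cl,
      (cl = 0 ∧ (0 < g ∨ g = 0 ∧ b < 0) ∨ cl = 1 ∧ (g < 0 ∨ g = 0 ∧ 0 < b)) →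
      IsKey b g b g cl := fun b g _ cl h => ⟨⟨1, by simp⟩, h⟩
  have hkey0 : ∀ b g : ℝ, (b = 0 ∧ g = 0) → IsKey b g (-1) g 0 := fun b g h =>
    ⟨⟨0, by simp [h.1, h.2]⟩, .inl ⟨rfl, .inr ⟨h.2, by norm_num⟩⟩⟩
  refine Prog.ends_of_wp ?_ (by decide)
  simp only [keyStep, block, Prog.wp, NExp.eval, RExp.eval, Test.Holds, Test.holds_isZero,
    State.nat_setReal, State.real_setReal_same, State.real_setReal_of_ne, ne_eq,
    Nat.reduceEqDiff, not_false_eq_true, Function.update_self, Function.update_idem,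
    hi, Rat.cast_zero, zero_sub, State.nat_setNat_same, State.real_setNat, Rat.cast_neg,
    Rat.cast_one]
  generalize s.real 8 i - s.real 10 i = g
  -- Both signs lead to the same case distinction.
  have main : ∀ b : ℝ, (b = 0 ∧ g = 0 → IsKey b g (-1) g 0 ∧ 0 ≤ g ∧ g ≤ 0) ∧
      (¬ (b = 0 ∧ g = 0) → (0 ≤ g → g ≤ 0 ∧ 0 ≤ b → IsKey b g b g 1) ∧
        (0 ≤ g → ¬ (g ≤ 0 ∧ 0 ≤ b) → IsKey b g b g 0) ∧ (¬ 0 ≤ g → IsKey b g b g 1)) := by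
    intro b
    refine ⟨fun h => ⟨hkey0 b g h, h.2.ge, h.2.le⟩, fun h => ⟨fun h₁ h₂ => hkey b g h 1 ?_,
      fun h₁ h₂ => hkey b g h 0 ?_, fun h₁ => hkey b g h 1 (.inr ⟨rfl, .inl (not_le.1 h₁)⟩)⟩⟩
    · have hg : g = 0 := le_antisymm h₂.1 h₁
      exact .inr ⟨rfl, .inr ⟨hg, lt_of_le_of_ne h₂.2 fun h0 => h ⟨h0.symm, hg⟩⟩⟩
    · refine .inl ⟨rfl, ?_⟩
      rcases h₁.lt_or_eq with hg | hg
      · exact .inl hg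
      · exact .inr ⟨hg.symm, not_le.1 fun hb => h₂ ⟨hg.ge, hb⟩⟩
  refine ⟨fun hκ => ?_, fun hκ => ?_⟩
  · simp only [hκ, if_true]
    obtain ⟨m₁, m₂⟩ := main (s.real 9 i)
    refine ⟨fun h => ⟨fun h₁ => ⟨fun h₂ => absurd h₂.2 (by norm_num), fun _ => ?_⟩, fun h₁ => ?_⟩,
      fun h => ⟨fun h₁ => ⟨fun h₂ => ?_, fun h₂ => ?_⟩, fun h₁ => ?_⟩⟩
    · exact ⟨_, _, by simp, rfl, trivial, rfl, (m₁ h).1⟩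
    · exact absurd (m₁ h).2.1 h₁
    · exact ⟨_, _, by simp, rfl, trivial, rfl, (m₂ h).1 h₁ h₂⟩
    · exact ⟨_, _, by simp, rfl, trivial, rfl, (m₂ h).2.1 h₁ h₂⟩
    · exact ⟨_, _, by simp, rfl, trivial, rfl, (m₂ h).2.2 h₁⟩
  · simp only [hκ, if_false]
    obtain ⟨m₁, m₂⟩ := main (-s.real 9 i)
    refine ⟨fun h => ⟨fun h₁ => ⟨fun h₂ => absurd h₂.2 (by norm_num), fun _ => ?_⟩, fun h₁ => ?_⟩,
      fun h => ⟨fun h₁ => ⟨fun h₂ => ?_, fun h₂ => ?_⟩, fun h₁ => ?_⟩⟩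
    · exact ⟨_, _, trivial, rfl, trivial, rfl, (m₁ h).1⟩
    · exact absurd (m₁ h).2.1 h₁
    · exact ⟨_, _, trivial, rfl, trivial, rfl, (m₂ h).1 h₁ h₂⟩
    · exact ⟨_, _, trivial, rfl, trivial, rfl, (m₂ h).2.1 h₁ h₂⟩
    · exact ⟨_, _, trivial, rfl, trivial, rfl, (m₂ h).2.2 h₁⟩

/-- The invariant of `divideStep`. -/
structure DivideInv (A : ℕ → ℝ) (i : ℕ) (s : State) : Prop where
  positives : seg (s.nat 6) 0 (s.nat 4 0) = (List.range i).filter (0 ≤ A ·)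
  negatives : seg (s.nat 8) 0 (s.nat 5 0) = (List.range i).filter (¬ 0 ≤ A ·)
  runs : ∀ r < s.nat 4 0, s.nat 7 r = r

lemma ends_divideStep {s : State} {i : ℕ} (hi : s.nat 2 0 = i)
    (h : DivideInv (s.real 8) i s) :
    divideStep.Ends 50 s fun s' => DivideInv (s.real 8) (i + 1) s' := by
  obtain ⟨h₁, h₂, h₃⟩ := h
  refine Prog.ends_of_wp ?_ (by decide)
  simp only [divideStep, block, Prog.wp, NExp.eval, RExp.eval, Test.Holds, hi, Rat.cast_zero,
    ne_eq, Nat.reduceEqDiff, not_false_eq_true, State.nat_setNat_of_ne]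
  have u₁ := seg_update_concat (s.nat 6) 0 (s.nat 4 0) i
  have u₂ := seg_update_concat (s.nat 8) 0 (s.nat 5 0) i
  rw [zero_add] at u₁ u₂
  refine ⟨fun hA => ⟨?_, ?_, ?_⟩, fun hA => ⟨?_, ?_, ?_⟩⟩ <;>
    simp only [State.nat_setNat_same, ne_eq, Nat.reduceEqDiff, not_false_eq_true,
      State.nat_setNat_of_ne, Function.update_self, List.range_succ, List.filter_append]
  · rw [u₁, h₁]; simp [hA]
  · rw [h₂]; simp [hA]
  · intro r hr
    rcases Nat.lt_succ_iff_lt_or_eq.1 hr with hr | rfl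
    · rw [Function.update_of_ne hr.ne, h₃ r hr]
    · simp
  · rw [h₁]; simp [hA]
  · rw [u₂, h₂]; simp [not_le.1 hA]
  · exact h₃

lemma NormInv.represents {n : ℕ} {I : OrderingInstance 2 n} {p q : ℝ} {A B D B' : ℕ → ℝ} {κ : ℝ}
    (h : NormInv I p q n A B D κ) (he : IsCommonEigen I p q)
    (hB : ∀ j < n, B' j = if 0 ≤ κ then B j else - B j) : Represents I A B' D := by
  by_cases hpq : p = 0 ∧ q = 0
  · exact represents_of_commute (he.2 hpq) _ _ _
  · obtain ⟨c, hc, hκ, h⟩ := h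
    refine represents_of_isEigen (p := p) (q := q) (a := fun i => eigA (mat I i) p q)
      (b := fun i => eigB (mat I i) p q) (d := fun i => eigD (mat I i) p q) (c := c)
      (s := if 0 ≤ κ then 1 else -1) hpq (fun _ => rfl) (fun _ => rfl) (fun _ => rfl)
      (he.1 hpq) hc ?_ ?_ (fun i hi => (h i hi).1) ?_ (fun i hi => (h i hi).2.2.1)
    · split_ifs <;> norm_num
    · change 0 ≤ (if 0 ≤ κ then (1 : ℝ) else -1) * (((List.range n).map c).prod * slope I p q)
      rw [← hκ]
      split_ifs with h0
      · rwa [one_mul]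
      · linarith
    · intro i hi
      rw [hB i hi, (h i hi).2.1]
      split_ifs <;> ring

lemma NormInv.det_neg {n : ℕ} {I : OrderingInstance 2 n} {p q : ℝ} {A B D : ℕ → ℝ} {κ : ℝ}
    (h : NormInv I p q n A B D κ) (he : IsCommonEigen I p q) {i : ℕ} (hi : i < n)
    (hA : A i < 0) : 0 < D i ∧ (mat I i).det < 0 := by
  obtain ⟨c, hc, hκ, h⟩ := h
  obtain ⟨h₁, -, h₂, h₃, h₄⟩ := h i hi
  have hD : 0 < D i := lt_of_le_of_ne h₃ fun h0 => absurd (h₄ h0.symm) (not_le.2 hA)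
  refine ⟨hD, ?_⟩
  have hpq : ¬ (p = 0 ∧ q = 0) := by
    rintro ⟨rfl, rfl⟩
    rw [h₁] at hA
    simp [eigA] at hA
  have hAD : A i * D i = (p ^ 2 + q ^ 2) ^ 2 * (mat I i).det := by
    rw [← eigA_mul_eigD (he.1 hpq i), h₁, h₂]
    linear_combination (eigA (mat I i) p q * eigD (mat I i) p q) * hc i
  by_contra hdet
  have := mul_neg_of_neg_of_pos hA hD
  rw [hAD] at this
  exact absurd this (not_lt.2 (mul_nonneg (by positivity) (not_lt.1 hdet)))

lemma ends_keyProg {n : ℕ} {I : OrderingInstance 2 n} {s₀ : State} {p q : ℝ}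
    (hn : s₀.nat 0 0 = n) (h4 : s₀.nat 4 0 = 0) (h5 : s₀.nat 5 0 = 0)
    (he : IsCommonEigen I p q)
    (h : NormInv I p q n (s₀.real 8) (s₀.real 9) (s₀.real 10) (s₀.real 13 0)) :
    keyProg.Ends (250 * (n + 1)) s₀ fun s => Prepared I s := by
  refine Prog.Ends.seq (T₁ := 220 * n + 100) (T₂ := 50) ?_ (by omega)
  refine ends_forLoop_const n 200 (fun i s => DivideInv (s₀.real 8) i s ∧
      (∀ j, i ≤ j → s.real 9 j = s₀.real 9 j) ∧
      (∀ j < i, s.real 9 j = (if 0 ≤ s₀.real 13 0 then s₀.real 9 j else - s₀.real 9 j) ∧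
        IsKey (s.real 9 j) (s₀.real 8 j - s₀.real 10 j) (s.real 11 j) (s.real 12 j) (s.nat 9 j)))
    (by decide) ?_ ?_ ?_ ?_ ?_
  · refine ⟨⟨?_, ?_, ?_⟩, ?_, ?_⟩ <;> simp [h4, h5]
  · intro i s _ hF _ _
    simpa [NExp.eval, hF.nat 0 (by decide)] using hn
  · rintro i s hi hF h2 ⟨hd, hB, hk⟩
    refine Prog.Ends.seq (T₁ := 150) (T₂ := 50) ((ends_keyStep h2).mono le_rfl ?_) le_rfl
    rintro s₁ hF₁ ⟨kb, cl, e₁, e₂, e₃, e₄, hkey⟩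
    have h8 : s₁.real 8 = s₀.real 8 := by rw [hF₁.real 8 (by decide), hF.real 8 (by decide)]
    have hd₁ : DivideInv (s₁.real 8) i s₁ := by
      rw [h8]
      constructor
      · rw [hF₁.nat 6 (by decide), hF₁.nat 4 (by decide), hd.positives]
      · rw [hF₁.nat 8 (by decide), hF₁.nat 5 (by decide), hd.negatives]
      · rw [hF₁.nat 4 (by decide), hF₁.nat 7 (by decide)]
        exact hd.runs
    refine (ends_divideStep (by rw [hF₁.nat 2 (by decide), h2]) hd₁).mono le_rfl ?_
    rintro s₂ hF₂ hd₂
    rw [h8] at hd₂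
    refine ⟨⟨?_, ?_, ?_⟩, ?_, ?_⟩
    · simpa using hd₂.positives
    · simpa using hd₂.negatives
    · simpa using hd₂.runs
    · intro j hj
      rw [State.real_setNat, hF₂.real 9 (by decide), e₁, Function.update_of_ne (by omega)]
      exact hB j (by omega)
    · intro j hj
      rw [State.real_setNat, hF₂.real 9 (by decide), hF₂.real 11 (by decide),
        hF₂.real 12 (by decide), State.nat_setNat_of_ne _ _ _ (by decide),
        hF₂.nat 9 (by decide), e₁, e₂, e₃, e₄]
      rcases Nat.lt_succ_iff_lt_or_eq.1 hj with hj | rfl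
      · simpa [hj.ne] using hk j hj
      · simp only [Function.update_self]
        rw [hF.real 8 (by decide), hF.real 10 (by decide), hF.real 13 (by decide),
          hB j le_rfl] at hkey
        rw [hF.real 8 (by decide), hF.real 10 (by decide), hF.real 13 (by decide), hB j le_rfl]
        exact ⟨rfl, hkey⟩
  · rintro s hF hs ⟨hd, -, hk⟩
    refine Prog.ends_of_wp ?_ (by decide)
    simp only [Prog.wp, NExp.eval]
    have r8 := hF.real 8 (by decide)
    have r10 := hF.real 10 (by decide)
    have hrep : Represents I (s.real 8) (s.real 9) (s.real 10) := by
      rw [r8, r10]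
      exact h.represents he fun j hj => (hk j hj).1
    constructor
    · simpa [hF.nat 0 (by decide)] using hn
    · exact hrep
    · intro i hi _
      obtain ⟨c, -, -, hc⟩ := h
      rw [State.real_setNat, r10]
      exact (hc i hi).2.2.2.1
    · intro i hi hA
      rw [State.real_setNat, r8] at hA
      rw [State.real_setNat, r10]
      exact (h.det_neg he hi hA).1
    · intro i hi hA
      rw [State.real_setNat, r8] at hA
      exact (h.det_neg he hi hA).2
    · intro i hi
      simpa [r8, r10] using (hk i hi).2
    · simpa [r8] using hd.positives
    · simpa [r8] using hd.negatives
    · intro r hr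
      rw [State.nat_setNat_of_ne _ _ _ (by decide)] at hr
      rcases hr.lt_or_eq with hr | hr
      · simpa [hr.ne] using hd.runs r hr
      · simp [hr]
  · simp only [NExp.cost]
    omega

/-- The computation before sorting. -/
def prepareProg : Prog := .seq eigenProg (.seq normalizeProg keyProg)

lemma ends_prepareProg {n : ℕ} {I : OrderingInstance 2 n}
    (hI : SimultaneouslyTriangularizable I.M) :
    prepareProg.Ends (750 * (n + 1)) (input I) (Prepared I) := by
  refine Prog.Ends.seq (T₁ := 200 * (n + 1)) (T₂ := 550 * (n + 1))
    ((ends_eigenProg hI).mono le_rfl ?_) (by omega)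
  rintro s hF ⟨hs, he⟩
  refine Prog.Ends.seq (T₁ := 300 * (n + 1)) (T₂ := 250 * (n + 1))
    ((ends_normalizeProg hs).mono le_rfl ?_) (by omega)
  intro s₁ hF₁ h₁
  refine ends_keyProg ?_ ?_ ?_ he h₁
  · rw [hF₁.nat 0 (by decide), hs.size]
  · rw [hF₁.nat 4 (by decide), hF.nat 4 (by decide)]; rfl
  · rw [hF₁.nat 5 (by decide), hF.nat 5 (by decide)]; rfl

/-! ### The order of the keys -/

/-- The keys are compared by class, and within a class by angle. -/
def KeyLe (cl : ℕ → ℕ) (kb kg : ℕ → ℝ) (x y : ℕ) : Prop :=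
  cl x < cl y ∨ cl x = cl y ∧ 0 ≤ kg x * kb y - kb x * kg y

/-- The index `x` has a key other than the zero vector, and its class is correct. -/
def HasKey (cl : ℕ → ℕ) (kb kg : ℕ → ℝ) (x : ℕ) : Prop :=
  cl x = 0 ∧ (0 < kg x ∨ kg x = 0 ∧ kb x < 0) ∨ cl x = 1 ∧ (kg x < 0 ∨ kg x = 0 ∧ 0 < kb x)

section
variable {cl : ℕ → ℕ} {kb kg : ℕ → ℝ}

lemma keyLe_total (x y : ℕ) : KeyLe cl kb kg x y ∨ KeyLe cl kb kg y x := by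
  unfold KeyLe
  rcases lt_trichotomy (cl x) (cl y) with h | h | h
  · exact .inl (.inl h)
  · rcases le_total 0 (kg x * kb y - kb x * kg y) with h' | h'
    · exact .inl (.inr ⟨h, h'⟩)
    · exact .inr (.inr ⟨h.symm, by linarith⟩)
  · exact .inr (.inl h)

lemma cross_nonneg_trans {x₁ x₂ y₁ y₂ z₁ z₂ : ℝ} (hx : 0 < x₂ ∨ x₂ = 0 ∧ x₁ < 0)
    (hy : 0 < y₂ ∨ y₂ = 0 ∧ y₁ < 0) (hz : 0 < z₂ ∨ z₂ = 0 ∧ z₁ < 0)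
    (hxy : 0 ≤ x₂ * y₁ - x₁ * y₂) (hyz : 0 ≤ y₂ * z₁ - y₁ * z₂) : 0 ≤ x₂ * z₁ - x₁ * z₂ := by
  have hx₂ : 0 ≤ x₂ := by rcases hx with h | h <;> linarith [h]
  have hz₂ : 0 ≤ z₂ := by rcases hz with h | h <;> linarith [h]
  rcases hy with hy | ⟨rfl, hy⟩
  · have h₁ := mul_nonneg hxy hz₂
    have h₂ := mul_nonneg hyz hx₂
    by_contra h
    nlinarith [mul_neg_of_neg_of_pos (not_le.1 h) hy]
  · have : x₂ = 0 := by
      refine le_antisymm ?_ hx₂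
      by_contra h
      nlinarith [mul_neg_of_pos_of_neg (not_le.1 h) hy]
    subst this
    have hx₁ : x₁ < 0 := by rcases hx with h | h <;> linarith [h]
    nlinarith [mul_nonneg (neg_nonneg.2 hx₁.le) hz₂]

lemma KeyLe.trans {x y z : ℕ} (hx : HasKey cl kb kg x) (hy : HasKey cl kb kg y)
    (hz : HasKey cl kb kg z) (hxy : KeyLe cl kb kg x y) (hyz : KeyLe cl kb kg y z) :
    KeyLe cl kb kg x z := by
  rcases hxy with hxy | ⟨hxy, cxy⟩
  · rcases hyz with hyz | ⟨hyz, -⟩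
    · exact .inl (hxy.trans hyz)
    · exact .inl (hyz ▸ hxy)
  · rcases hyz with hyz | ⟨hyz, cyz⟩
    · exact .inl (hxy ▸ hyz)
    · refine .inr ⟨hxy.trans hyz, ?_⟩
      rcases hx with ⟨hx₀, hx⟩ | ⟨hx₀, hx⟩
      · have hy' := hy.resolve_right fun h => by omega
        have hz' := hz.resolve_right fun h => by omega
        exact cross_nonneg_trans hx hy'.2 hz'.2 cxy cyz
      · have hy' := hy.resolve_left fun h => by omega
        have hz' := hz.resolve_left fun h => by omega
        have h := cross_nonneg_trans (x₁ := - kb x) (x₂ := - kg x) (y₁ := - kb y) (y₂ := - kg y)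
          (z₁ := - kb z) (z₂ := - kg z) (by simpa using hx) (by simpa using hy'.2)
          (by simpa using hz'.2) (by linarith) (by linarith)
        linarith

lemma pairwise_merge_of_mem {r : ℕ → ℕ → Prop} [DecidableRel r] {S : ℕ → Prop}
    (htrans : ∀ x y z, S x → S y → S z → r x y → r y z → r x z)
    (htotal : ∀ x y, r x y ∨ r y x) :
    ∀ {xs ys : List ℕ}, (∀ x ∈ xs, S x) → (∀ y ∈ ys, S y) → xs.Pairwise r → ys.Pairwise r →
      (xs.merge ys fun x y => decide (r x y)).Pairwise r
  | [], ys, _, _, _, hy => by simpa using hy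
  | x :: xs, [], _, _, hx, _ => by simpa using hx
  | x :: xs, y :: ys, sx, sy, hx, hy => by
    rw [List.cons_merge_cons]
    have hx' := List.pairwise_cons.1 hx
    have hy' := List.pairwise_cons.1 hy
    split_ifs with h
    · have h : r x y := by simpa using h
      refine List.pairwise_cons.2 ⟨fun z hz => ?_, pairwise_merge_of_mem htrans htotal
        (fun z hz => sx z (List.mem_cons_of_mem _ hz)) sy hx'.2 hy⟩
      rcases List.mem_merge.1 hz with hz | hz
      · exact hx'.1 z hz
      · rcases List.mem_cons.1 hz with rfl | hz
        · exact h
        · exact htrans x y z (sx x (by simp)) (sy y (by simp))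
            (sy z (List.mem_cons_of_mem _ hz)) h (hy'.1 z hz)
    · have h : r y x := (htotal x y).resolve_left (by simpa using h)
      refine List.pairwise_cons.2 ⟨fun z hz => ?_, pairwise_merge_of_mem htrans htotal
        sx (fun z hz => sy z (List.mem_cons_of_mem _ hz)) hx hy'.2⟩
      rcases List.mem_merge.1 hz with hz | hz
      · rcases List.mem_cons.1 hz with rfl | hz
        · exact h
        · exact htrans y x z (sy y (by simp)) (sx x (by simp))
            (sx z (List.mem_cons_of_mem _ hz)) h (hx'.1 z hz)
      · exact hy'.1 z hz

lemma eq_filter_append_of_pairwise {cl : ℕ → ℕ} {K : List ℕ} (h : K.Pairwise fun x y => cl x ≤ cl y) :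
    K = K.filter (cl · = 0) ++ K.filter (¬ cl · = 0) := by
  induction K with
  | nil => simp
  | cons x K ih =>
    rw [List.pairwise_cons] at h
    by_cases hx : cl x = 0
    · simpa [hx] using ih h.2
    · have : ∀ y ∈ K, cl y ≠ 0 := fun y hy => by have := h.1 y hy; omega
      rw [List.filter_cons_of_neg (by simpa using hx), List.filter_cons_of_pos (by simpa using hx),
        List.filter_eq_nil_iff.2 (by simpa using this), List.filter_eq_self.2 (by simpa using this),
        List.nil_append]

/-- Sorting the indices of positive type by their keys yields the order that the structure of the
optimal orderings refers to. -/
lemma hasStructuredMin_of_pairwise {A B D : ℕ → ℝ} {K negs : List ℕ} (hn : (K ++ negs).Nodup)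
    (hA : ∀ x ∈ K, 0 ≤ A x) (hD : ∀ x ∈ K, 0 ≤ D x) (hneg : ∀ x ∈ negs, A x < 0)
    (hneg' : ∀ x ∈ negs, 0 < D x)
    (hkey : ∀ x ∈ K, IsKey (B x) (A x - D x) (kb x) (kg x) (cl x))
    (hK : K.Pairwise (KeyLe cl kb kg)) : HasStructuredMin A B D K negs := by
  have hKe := eq_filter_append_of_pairwise (cl := cl)
    (hK.imp fun {x y} h => by rcases h with h | h <;> omega)
  set P := K.filter (cl · = 0)
  set N := K.filter (¬ cl · = 0)
  have hP : ∀ x ∈ P, x ∈ K ∧ cl x = 0 := fun x hx => by simpa [P] using hx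
  have hN : ∀ x ∈ N, x ∈ K ∧ cl x ≠ 0 := fun x hx => by simpa [N] using hx
  have ht : ∀ x, ∃ t, x ∈ K → 0 ≤ t ∧ B x = t * kb x ∧ A x - D x = t * kg x := fun x => by
    by_cases hx : x ∈ K
    · obtain ⟨t, ht⟩ := (hkey x hx).1
      exact ⟨t, fun _ => ht⟩
    · exact ⟨0, fun h => absurd h hx⟩
  choose t ht using ht
  have hcl : ∀ x ∈ K, ∀ y ∈ K, KeyLe cl kb kg x y → cl x = cl y →
      0 ≤ kg x * kb y - kb x * kg y := by
    rintro x - y - (h | h) h'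
    · omega
    · exact h.2
  rw [hKe] at hn hA hD hkey ht ⊢
  refine hasStructuredMin (t := t) hn hD hA hneg hneg' (fun x hx => (ht x hx).1)
    (fun x hx => (ht x hx).2.1) (fun x hx => (ht x hx).2.2) ⟨?_, ?_, ?_, ?_⟩
  · intro x hx
    rcases (hkey x (List.mem_append_left _ hx)).2 with h | h
    · exact h.2
    · exact absurd (hP x hx).2 (by omega)
  · intro x hx
    rcases (hkey x (List.mem_append_right _ hx)).2 with h | h
    · exact absurd h.1 (hN x hx).2
    · exact h.2
  · refine (hK.filter _).imp_of_mem fun {x y} hx hy h => ?_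
    exact hcl x (hP x hx).1 y (hP y hy).1 h ((hP x hx).2.trans (hP y hy).2.symm)
  · refine (hK.filter _).imp_of_mem fun {x y} hx hy h => ?_
    have h1 : ∀ x ∈ N, cl x = 1 := fun x hx => by
      rcases (hkey x (List.mem_append_right _ hx)).2 with h | h
      · exact absurd h.1 (hN x hx).2
      · exact h.1
    exact hcl x (hN x hx).1 y (hN y hy).1 h ((h1 x hx).trans (h1 y hy).symm)

/-! ### Sorting -/

/-- The starts of the runs in a queue of `p` elements that is sorted by merging: the runs `0`, …,
`p - 1` are the single elements, and the run `p + t` is the result of merging the runs `2 t` and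
`2 t + 1`. -/
def runStart (p r : ℕ) : ℕ :=
  if r ≤ p then r else if r < 2 * p then p + runStart p (2 * (r - p)) else 0
termination_by r
decreasing_by omega

lemma runStart_of_le {p r : ℕ} (h : r ≤ p) : runStart p r = r := by
  rw [runStart, if_pos h]

lemma runStart_add {p t : ℕ} (h : t < p) : runStart p (p + t) = p + runStart p (2 * t) := by
  rcases Nat.eq_zero_or_pos t with rfl | ht
  · rw [Nat.add_zero, runStart_of_le le_rfl, runStart_of_le (Nat.zero_le _)]; rfl
  · rw [runStart, if_neg (by omega), if_pos (by omega), Nat.add_sub_cancel_left]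

lemma runStart_mono {p : ℕ} : ∀ {r r' : ℕ}, r ≤ r' → r' < 2 * p → runStart p r ≤ runStart p r' := by
  intro r r'
  induction r' using Nat.strong_induction_on generalizing r with
  | _ r' ih =>
    intro h h'
    rcases le_or_gt r' p with hp | hp
    · rwa [runStart_of_le hp, runStart_of_le (h.trans hp)]
    · obtain ⟨t', rfl⟩ := Nat.exists_eq_add_of_le hp.le
      rw [runStart_add (by omega)]
      rcases le_or_gt r p with hr | hr
      · rw [runStart_of_le hr]; omega
      · obtain ⟨t, rfl⟩ := Nat.exists_eq_add_of_le hr.le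
        rw [runStart_add (by omega)]
        have := ih (2 * t') (by omega) (r := 2 * t) (by omega) (by omega)
        omega

lemma runStart_sub_le {p j d : ℕ} (hd : 1 ≤ d) (hdp : d ≤ 2 * p) (h : p ≤ 2 ^ j * d) :
    runStart p (2 * p - d) ≤ p * (j + 1) := by
  induction j generalizing d with
  | zero =>
    rw [runStart_of_le (by omega)]
    omega
  | succ j ih =>
    rcases le_or_gt (2 * p - d) p with hp | hp
    · rw [runStart_of_le hp]
      exact hp.trans (Nat.le_mul_of_pos_right p (by omega))
    · have e : 2 * p - d = p + (p - d) := by omega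
      rw [e, runStart_add (by omega), Nat.mul_sub]
      have := ih (d := 2 * d) (by omega) (by omega) (by rw [pow_succ] at h; linarith)
      rw [Nat.mul_add p, mul_one]
      omega

/-- The next element to be merged is taken from the first of the two runs: it is not exhausted, and
the second run is exhausted or its first element does not have a smaller key. -/
def mergeTest : Test :=
  .and (.not (.natLe (nvar 12) (nvar 11)))
    (.not (.and (.not (.natLe (nvar 14) (nvar 13)))
      (.and (.natLe (.get 9 (nat_ 6 13)) (.get 9 (nat_ 6 11)))
        (.not (.and (.natLe (.get 9 (nat_ 6 11)) (.get 9 (nat_ 6 13)))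
          (.realLe (.lit 0) (.sub (.mul (.get 12 (nat_ 6 11)) (.get 11 (nat_ 6 13)))
            (.mul (.get 11 (nat_ 6 11)) (.get 12 (nat_ 6 13))))))))))

/-- Appends the next element to the merged run. -/
def mergeStep : Prog := .seq
  (.ite mergeTest
    (block [.setNat 6 (nvar 15) (nat_ 6 11), letNat 11 (.add (nvar 11) (.lit 1))])
    (block [.setNat 6 (nvar 15) (nat_ 6 13), letNat 13 (.add (nvar 13) (.lit 1))]))
  (letNat 15 (.add (nvar 15) (.lit 1)))

/-- Merges the runs from 11 to 12 and from 13 to 14; the position of the output is 15. -/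
def mergeProg : Prog :=
  .while (.not (.and (.natLe (nvar 12) (nvar 11)) (.natLe (nvar 14) (nvar 13)))) mergeStep

open Classical in
/-- The lists are merged according to their keys. -/
noncomputable def keyMerge (cl : ℕ → ℕ) (kb kg : ℕ → ℝ) (xs ys : List ℕ) : List ℕ :=
  xs.merge ys fun x y => decide (KeyLe cl kb kg x y)

lemma mergeTest_holds {s : State} (i j : ℕ) (hi : s.nat 12 0 = s.nat 11 0 + i)
    (hj : s.nat 14 0 = s.nat 13 0 + j) : mergeTest.Holds s ↔ 0 < i ∧ (j = 0 ∨
      KeyLe (s.nat 9) (s.real 11) (s.real 12) (s.nat 6 (s.nat 11 0)) (s.nat 6 (s.nat 13 0))) := by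
  simp only [mergeTest, Test.Holds, NExp.eval, RExp.eval, hi, hj, Rat.cast_zero, KeyLe]
  have h₁ : ∀ x i : ℕ, ¬ x + i ≤ x ↔ 0 < i := fun x i => by omega
  rw [h₁, h₁]
  generalize s.nat 9 (s.nat 6 (s.nat 11 0)) = c
  generalize s.nat 9 (s.nat 6 (s.nat 13 0)) = c'
  refine and_congr_right fun _ => ?_
  by_cases hj0 : j = 0
  · simp [hj0]
  · have : 0 < j := by omega
    simp only [this, true_and, hj0, false_or]
    rcases lt_trichotomy c c' with h | h | h
    · simp [h, h.le, not_le.2 h]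
    · simp [h]
    · simp [h.le, not_le.2 h, h.ne', not_lt.2 h.le]

/-- The invariant of `mergeProg`: there remain `i` elements of the first and `j` elements of the
second run, and `m` elements have been written to the positions from `q` on. -/
def MergeInv (s₀ : State) (q xe ye : ℕ) (M : List ℕ) (k : ℕ) (s : State) : Prop :=
  ∃ i j m, i + j = k ∧ m + k = M.length ∧ s.nat 11 0 + i = xe ∧ s.nat 13 0 + j = ye ∧
    s.nat 12 0 = xe ∧ s.nat 14 0 = ye ∧ s.nat 15 0 = q + m ∧ s.nat 9 = s₀.nat 9 ∧
    s.real 11 = s₀.real 11 ∧ s.real 12 = s₀.real 12 ∧ (∀ r < q, s.nat 6 r = s₀.nat 6 r) ∧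
    seg (s.nat 6) q m ++ keyMerge (s₀.nat 9) (s₀.real 11) (s₀.real 12)
      (seg (s₀.nat 6) (s.nat 11 0) i) (seg (s₀.nat 6) (s.nat 13 0) j) = M

lemma ends_mergeStep {s₀ s : State} {q xe ye k : ℕ} {M : List ℕ} (hx : xe ≤ q) (hy : ye ≤ q)
    (h : MergeInv s₀ q xe ye M (k + 1) s) :
    mergeStep.Ends 100 s (MergeInv s₀ q xe ye M k) := by
  obtain ⟨i, j, m, hk, hm, h11, h13, h12, h14, h15, h9, r11, r12, h6, hM⟩ := h
  refine Prog.ends_of_wp ?_ (by decide)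
  have ht := mergeTest_holds (s := s) i j (by omega) (by omega)
  simp only [mergeStep, Prog.wp, block]
  rw [ht]
  have u : ∀ x, seg (Function.update (s.nat 6) (q + m) x) q (m + 1) = seg (s.nat 6) q m ++ [x] :=
    seg_update_concat _ _ _
  constructor
  · rintro ⟨hi, hle⟩
    obtain ⟨i, rfl⟩ : ∃ i', i = i' + 1 := ⟨i - 1, by omega⟩
    refine ⟨i, j, m + 1, by omega, by omega, ?_⟩
    have e : s.nat 6 (s.nat 11 0) = s₀.nat 6 (s.nat 11 0) := h6 _ (by omega)
    simp only [NExp.eval, h15, State.nat_setNat_same, ne_eq, Nat.reduceEqDiff, not_false_eq_true,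
      State.nat_setNat_of_ne, State.real_setNat, Function.update_self, u]
    refine ⟨by omega, h13, h12, h14, by omega, h9, r11, r12, ?_, ?_⟩
    · intro r hr
      rw [Function.update_of_ne (by omega), h6 r hr]
    · rw [← hM, List.append_assoc, List.singleton_append, e]
      congr 1
      rcases Nat.eq_zero_or_pos j with rfl | hj
      · simp [keyMerge, seg_succ]
      · obtain ⟨j, rfl⟩ : ∃ j', j = j' + 1 := ⟨j - 1, by omega⟩
        have e' : s.nat 6 (s.nat 13 0) = s₀.nat 6 (s.nat 13 0) := h6 _ (by omega)
        rw [e, e', h9, r11, r12] at hle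
        rw [seg_succ, seg_succ, keyMerge, keyMerge,
          List.cons_merge_cons_pos _ _ _ (by simpa using hle)]
  · intro hle
    obtain ⟨j, rfl⟩ : ∃ j', j = j' + 1 := ⟨j - 1, by
      have : ¬ (0 < i ∧ j = 0) := fun h => hle ⟨h.1, .inl h.2⟩
      omega⟩
    refine ⟨i, j, m + 1, by omega, by omega, ?_⟩
    have e' : s.nat 6 (s.nat 13 0) = s₀.nat 6 (s.nat 13 0) := h6 _ (by omega)
    simp only [NExp.eval, h15, State.nat_setNat_same, ne_eq, Nat.reduceEqDiff, not_false_eq_true,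
      State.nat_setNat_of_ne, State.real_setNat, Function.update_self, u]
    refine ⟨h11, by omega, h12, h14, by omega, h9, r11, r12, ?_, ?_⟩
    · intro r hr
      rw [Function.update_of_ne (by omega), h6 r hr]
    · rw [← hM, List.append_assoc, List.singleton_append, e']
      congr 1
      rcases Nat.eq_zero_or_pos i with rfl | hi
      · simp [keyMerge, seg_succ]
      · obtain ⟨i, rfl⟩ : ∃ i', i = i' + 1 := ⟨i - 1, by omega⟩
        have e : s.nat 6 (s.nat 11 0) = s₀.nat 6 (s.nat 11 0) := h6 _ (by omega)
        rw [e, e', h9, r11, r12] at hle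
        rw [seg_succ, seg_succ (s₀.nat 6) (s.nat 13 0), keyMerge, keyMerge,
          List.cons_merge_cons_neg]
        simpa using hle

lemma ends_mergeProg {s : State} {i j : ℕ} (hi : s.nat 12 0 = s.nat 11 0 + i)
    (hj : s.nat 14 0 = s.nat 13 0 + j) (hx : s.nat 12 0 ≤ s.nat 15 0)
    (hy : s.nat 14 0 ≤ s.nat 15 0) :
    mergeProg.Ends (120 * (i + j) + 20) s fun s' => s'.nat 15 0 = s.nat 15 0 + (i + j) ∧
      (∀ r < s.nat 15 0, s'.nat 6 r = s.nat 6 r) ∧ seg (s'.nat 6) (s.nat 15 0) (i + j) =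
        keyMerge (s.nat 9) (s.real 11) (s.real 12) (seg (s.nat 6) (s.nat 11 0) i)
          (seg (s.nat 6) (s.nat 13 0) j) := by
  set M := keyMerge (s.nat 9) (s.real 11) (s.real 12) (seg (s.nat 6) (s.nat 11 0) i)
          (seg (s.nat 6) (s.nat 13 0) j) with hM
  have hlen : M.length = i + j := by
    rw [hM, keyMerge, List.length_merge, length_seg, length_seg]
  refine Prog.ends_while (c := 100) (MergeInv s (s.nat 15 0) (s.nat 12 0) (s.nat 14 0) M) ?_ ?_
    (i + j) ?_ ?_
  · intro k s' h
    refine ⟨?_, ends_mergeStep hx hy h⟩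
    obtain ⟨i', j', m, hk, hm, h11, h13, h12, h14, -⟩ := h
    simp only [Test.Holds, NExp.eval]
    omega
  · rintro s' ⟨i', j', m, hk, hm, h11, h13, h12, h14, h15, -, -, -, h6, hS⟩
    obtain rfl : i' = 0 := by omega
    obtain rfl : j' = 0 := by omega
    obtain rfl : m = i + j := by omega
    refine ⟨?_, h15, h6, ?_⟩
    · simp only [Test.Holds, NExp.eval]
      omega
    · simpa [keyMerge] using hS
  · exact ⟨i, j, 0, rfl, by omega, hi.symm, hj.symm, rfl, rfl, rfl, rfl, rfl, rfl,
      fun _ _ => rfl, by simp [hM]⟩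
  · simp only [Test.cost, NExp.cost]
    omega

/-- Merges the runs `2 t` and `2 t + 1` to the run `p + t`; `t` is the variable 10. -/
def sortStep : Prog := .seq
  (block [letNat 11 (.get 7 (.add (nvar 10) (nvar 10))),
    letNat 12 (.get 7 (.add (.add (nvar 10) (nvar 10)) (.lit 1))),
    letNat 13 (.get 7 (.add (.add (nvar 10) (nvar 10)) (.lit 1))),
    letNat 14 (.get 7 (.add (.add (nvar 10) (nvar 10)) (.lit 2))),
    letNat 15 (.get 7 (.add (nvar 4) (nvar 10)))])
  (.seq mergeProg (.setNat 7 (.add (.add (nvar 4) (nvar 10)) (.lit 1)) (nvar 15)))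

/-- The invariant of the sorting loop: the runs from `2 t` on contain all elements. -/
structure SortInv (r : ℕ → ℕ → Prop) (P : List ℕ) (p t : ℕ) (S Q : ℕ → ℕ) : Prop where
  starts : ∀ i ≤ p + t, S i = runStart p i
  sorted : ∀ i < p + t,
    (seg Q (runStart p i) (runStart p (i + 1) - runStart p i)).Pairwise r
  perm : (seg Q (runStart p (2 * t)) p).Perm P

lemma ends_sortStep {s : State} {P : List ℕ} {p t : ℕ} (ht : t + 1 < p) (h4 : s.nat 4 0 = p)
    (h10 : s.nat 10 0 = t) (hP : ∀ x ∈ P, HasKey (s.nat 9) (s.real 11) (s.real 12) x)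
    (h : SortInv (KeyLe (s.nat 9) (s.real 11) (s.real 12)) P p t (s.nat 7) (s.nat 6)) :
    sortStep.Ends (120 * (runStart p (p + t + 1) - runStart p (p + t)) + 100) s fun s' =>
      SortInv (KeyLe (s.nat 9) (s.real 11) (s.real 12)) P p (t + 1) (s'.nat 7) (s'.nat 6) := by
  obtain ⟨hst, hso, hpe⟩ := h
  have e₀ : runStart p (p + t) = p + runStart p (2 * t) := runStart_add (by omega)
  have e₁ : runStart p (p + t + 1) = p + runStart p (2 * t + 2) :=
    runStart_add (t := t + 1) (by omega)
  have m₁ : runStart p (2 * t) ≤ runStart p (2 * t + 1) := runStart_mono (by omega) (by omega)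
  have m₂ : runStart p (2 * t + 1) ≤ runStart p (2 * t + 2) := runStart_mono (by omega) (by omega)
  have m₃ : runStart p (2 * t + 2) ≤ runStart p (p + t) := runStart_mono (by omega) (by omega)
  set q := runStart p (p + t) with hq
  obtain ⟨i, hi⟩ := Nat.exists_eq_add_of_le m₁
  obtain ⟨j, hj⟩ := Nat.exists_eq_add_of_le m₂
  obtain ⟨l, hl⟩ := Nat.exists_eq_add_of_le m₃
  have so₁ := hso (2 * t) (by omega)
  have so₂ := hso (2 * t + 1) (by omega)
  rw [hi, Nat.add_sub_cancel_left] at so₁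
  rw [add_assoc, hj, Nat.add_sub_cancel_left] at so₂
  refine Prog.Ends.seq (T₁ := 60) (T₂ := 120 * (runStart p (p + t + 1) - q) + 40)
    (Prog.ends_of_wp (Q := fun s' => s' = ((((s.setNat 11 0 (runStart p (2 * t))).setNat 12 0
      (runStart p (2 * t + 1))).setNat 13 0 (runStart p (2 * t + 1))).setNat 14 0
      (runStart p (2 * t + 2))).setNat 15 0 q) ?_ (by decide) |>.mono le_rfl ?_) (by omega)
  · simp only [block, Prog.wp, NExp.eval, h10, ne_eq, Nat.reduceEqDiff, not_false_eq_true,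
      State.nat_setNat_of_ne, h4]
    rw [← two_mul, hst _ (by omega), hst _ (by omega), hst _ (by omega), hst _ (by omega)]
  rintro s₁ - hs₁
  refine Prog.Ends.seq (T₁ := 120 * (i + j) + 20) (T₂ := 20)
    ((ends_mergeProg (i := i) (j := j) ?_ ?_ ?_ ?_).mono le_rfl ?_) (by omega)
  · simp [hs₁]; omega
  · simp [hs₁]; omega
  · simp [hs₁]; omega
  · simp [hs₁]; omega
  intro s₂ hF ⟨h15, h6, hseg⟩
  have x11 : s₁.nat 11 0 = runStart p (2 * t) := by simp [hs₁]
  have x13 : s₁.nat 13 0 = runStart p (2 * t + 1) := by simp [hs₁]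
  have x15 : s₁.nat 15 0 = q := by simp [hs₁]
  have x6 : s₁.nat 6 = s.nat 6 := by simp [hs₁]
  have x9 : s₁.nat 9 = s.nat 9 := by simp [hs₁]
  have x7 : s₂.nat 7 = s.nat 7 := by rw [hF.nat 7 (by decide)]; simp [hs₁]
  have y11 : s₁.real 11 = s.real 11 := by simp [hs₁]
  have y12 : s₁.real 12 = s.real 12 := by simp [hs₁]
  have z4 : s₂.nat 4 0 = p := by rw [hF.nat 4 (by decide)]; simp [hs₁, h4]
  have z10 : s₂.nat 10 0 = t := by rw [hF.nat 10 (by decide)]; simp [hs₁, h10]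
  rw [x15, x6] at h6
  rw [x15] at h15
  rw [x15, x6, x9, x11, x13, y11, y12] at hseg
  refine Prog.ends_of_wp ?_ (by decide)
  simp only [Prog.wp, NExp.eval, z4, z10, h15, State.nat_setNat_same, x7, ne_eq,
    Nat.reduceEqDiff, not_false_eq_true, State.nat_setNat_of_ne]
  have hmem : ∀ x ∈ seg (s.nat 6) (runStart p (2 * t)) p,
      HasKey (s.nat 9) (s.real 11) (s.real 12) x := fun x hx => hP x (hpe.subset hx)
  have hpsum : p = i + j + l := by omega
  have hsplit : seg (s.nat 6) (runStart p (2 * t)) p = seg (s.nat 6) (runStart p (2 * t)) i ++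
      seg (s.nat 6) (runStart p (2 * t + 1)) j ++ seg (s.nat 6) (runStart p (2 * t + 2)) l := by
    rw [show seg (s.nat 6) (runStart p (2 * t)) p = seg (s.nat 6) (runStart p (2 * t)) (i + j + l)
      by rw [← hpsum], seg_append, seg_append, ← add_assoc, ← hi, ← hj]
  constructor
  · intro r hr
    rcases Nat.lt_or_ge r (p + t + 1) with h | h
    · rw [Function.update_of_ne (by omega), hst r (by omega)]
    · obtain rfl : r = p + t + 1 := by omega
      rw [Function.update_self]
      omega
  · intro r hr
    rcases Nat.lt_or_ge r (p + t) with h | h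
    · have hle : runStart p (r + 1) ≤ q := runStart_mono (by omega) (by omega)
      have hle' : runStart p r ≤ runStart p (r + 1) := runStart_mono (by omega) (by omega)
      rw [seg_congr (g := s.nat 6) fun x _ hx => h6 x (by omega)]
      exact hso r h
    · obtain rfl : r = p + t := by omega
      have : runStart p (p + t + 1) - runStart p (p + t) = i + j := by omega
      rw [this, ← hq, hseg]
      classical
      refine pairwise_merge_of_mem (r := KeyLe (s.nat 9) (s.real 11) (s.real 12))
        (S := HasKey (s.nat 9) (s.real 11) (s.real 12))
        (fun x y z hx hy hz => KeyLe.trans hx hy hz) keyLe_total ?_ ?_ so₁ so₂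
      · exact fun x hx => hmem x (by rw [hsplit]; simp [hx])
      · exact fun x hx => hmem x (by rw [hsplit]; simp [hx])
  · refine List.Perm.trans ?_ hpe
    have e : seg (s₂.nat 6) (runStart p (2 * (t + 1))) p =
        seg (s.nat 6) (runStart p (2 * t + 2)) l ++ seg (s₂.nat 6) q (i + j) := by
      rw [show seg (s₂.nat 6) (runStart p (2 * (t + 1))) p =
        seg (s₂.nat 6) (runStart p (2 * t + 2)) (l + (i + j)) by
          rw [Nat.add_comm l, ← hpsum, Nat.mul_add], seg_append, ← hl]
      rw [seg_congr (g := s.nat 6) fun x _ hx => h6 x (by omega)]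
    rw [e, hseg, hsplit]
    exact (List.perm_append_comm.trans ((List.merge_perm_append _).append_right _))

/-- Sorts the indices of positive type by their keys and copies the last run to the array `16`. -/
def sortProg : Prog := .seq
  (forLoop 10 (.sub (nvar 4) (.lit 1)) sortStep)
  (forLoop 2 (nvar 4) (.setNat 16 (nvar 2)
    (.get 6 (.add (.get 7 (.sub (.add (nvar 4) (nvar 4)) (.lit 2))) (nvar 2)))))

lemma ends_sortProg {s : State} {p : ℕ} (h4 : s.nat 4 0 = p) (h7 : ∀ r ≤ p, s.nat 7 r = r)
    (hP : ∀ x ∈ seg (s.nat 6) 0 p, HasKey (s.nat 9) (s.real 11) (s.real 12) x) :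
    sortProg.Ends (250 * (p * (Nat.log 2 p + 2) + 1)) s fun s' =>
      (seg (s'.nat 16) 0 p).Perm (seg (s.nat 6) 0 p) ∧
      (seg (s'.nat 16) 0 p).Pairwise (KeyLe (s.nat 9) (s.real 11) (s.real 12)) := by
  set Z := p * (Nat.log 2 p + 2) with hZ
  have hpZ : 2 * p ≤ Z := by rw [hZ, mul_comm]; gcongr; omega
  refine Prog.Ends.seq (T₁ := 120 * Z + 120 * p + 20) (T₂ := 40 * p + 20) ?_ (by omega)
  refine ends_forLoop (p - 1)
    (fun t => 120 * (runStart p (p + t + 1) - runStart p (p + t)) + 100)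
    (fun t s' => SortInv (KeyLe (s.nat 9) (s.real 11) (s.real 12)) (seg (s.nat 6) 0 p) p t
      (s'.nat 7) (s'.nat 6)) (by decide) ?_ ?_ ?_ ?_ ?_
  · constructor
    · intro i hi
      rw [Nat.add_zero] at hi
      rw [runStart_of_le hi]
      simpa using h7 i hi
    · intro i hi
      rw [runStart_of_le (by omega : i ≤ p), runStart_of_le (by omega : i + 1 ≤ p),
        Nat.add_sub_cancel_left, seg_succ, seg_zero]
      exact List.pairwise_singleton _ _
    · rw [runStart_of_le (Nat.zero_le _)]
      simp
  · intro i s' _ hF _ _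
    simp [hF.nat 4 (by decide), h4]
  · intro t s' ht hF h10 h
    rw [← hF.nat 9 (by decide), ← hF.real 11 (by decide), ← hF.real 12 (by decide)] at h hP ⊢
    refine (ends_sortStep (by omega) (by rw [hF.nat 4 (by decide), h4]) h10 hP h).mono le_rfl ?_
    intro s₂ _ h₂
    simpa using h₂
  · intro s₁ hF _ h
    have h4' : s₁.nat 4 0 = p := by rw [hF.nat 4 (by decide), h4]
    refine ends_forLoop_const p 20 (fun i s' => seg (s'.nat 16) 0 i =
      seg (s₁.nat 6) (runStart p (p + p - 2)) i) (by decide) ?_ ?_ ?_ ?_ ?_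
    · simp
    · intro i s' _ hF' _ _
      simp [hF'.nat 4 (by decide), h4']
    · intro i s' hi hF' h2 hs'
      refine Prog.ends_of_wp ?_ (by decide)
      have e₁ : s'.nat 7 (p + p - 2) = runStart p (p + p - 2) := by
        rw [hF'.nat 7 (by decide), h.starts _ (by omega)]
      have u := seg_update_concat (s'.nat 16) 0 i
        (s₁.nat 6 (runStart p (p + p - 2) + i))
      rw [zero_add] at u
      simp [h2, hF'.nat 4 (by decide), h4', e₁, hF'.nat 6 (by decide), u, hs', seg_concat]
    · intro s' _ _ hs'
      rw [hs']
      rcases Nat.eq_zero_or_pos p with rfl | hp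
      · simp
      · have e : p + p - 2 = 2 * (p - 1) := by omega
        refine ⟨?_, ?_⟩
        · rw [e]; exact h.perm
        · have h₁ := h.sorted (p + p - 2) (by omega)
          have h₂ := runStart_add (p := p) (t := p - 1) (by omega)
          rw [← e] at h₂
          have e' : p + p - 2 + 1 = p + (p - 1) := by omega
          rwa [e', h₂, Nat.add_sub_cancel] at h₁
    · simp only [NExp.cost]
      omega
  · have key : ∀ N, N ≤ p - 1 → ∑ t ∈ Finset.range N,
        (120 * (runStart p (p + t + 1) - runStart p (p + t)) + 100) + 120 * p ≤
          120 * runStart p (p + N) + 100 * N := by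
      intro N
      induction N with
      | zero => intro _; simp [runStart_of_le]
      | succ N ih =>
        intro hN
        have := ih (by omega)
        have hm : runStart p (p + N) ≤ runStart p (p + N + 1) :=
          runStart_mono (by omega) (by omega)
        rw [Finset.sum_range_succ, ← add_assoc p N 1]
        omega
    have h₁ := key (p - 1) le_rfl
    have h₂ : runStart p (p + (p - 1)) ≤ Z := by
      rcases Nat.eq_zero_or_pos p with rfl | hp
      · simp [runStart_of_le]
      · have e : p + (p - 1) = 2 * p - 1 := by omega
        rw [e, hZ]
        exact runStart_sub_le le_rfl (by omega)
          (by rw [mul_one]; exact (Nat.lt_pow_succ_log_self (by norm_num) p).le)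
    simp only [NExp.cost]
    omega

/-! ### The sorted instance -/

/-- The indices of positive type in the order of their keys. -/
def State.positives (s : State) : List ℕ := seg (s.nat 16) 0 (s.nat 4 0)

/-- The indices of negative type. -/
def State.negatives (s : State) : List ℕ := seg (s.nat 8) 0 (s.nat 5 0)

/-- The memory after sorting: there is an optimal ordering that is structured with respect to the
sorted indices of positive type. -/
structure Ready {n : ℕ} (I : OrderingInstance 2 n) (s : State) : Prop where
  size : s.nat 0 0 = n
  represents : Represents I (s.real 8) (s.real 9) (s.real 10)
  perm : (s.positives ++ s.negatives).Perm (List.range n)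
  det : ∀ i ∈ s.negatives, (mat I i).det < 0
  nonneg : ∀ i < n, 0 ≤ s.real 10 i
  min : HasStructuredMin (s.real 8) (s.real 9) (s.real 10) s.positives s.negatives

/-- The part that the two programs have in common. -/
def readyProg : Prog := .seq prepareProg sortProg

lemma ends_readyProg {n : ℕ} {I : OrderingInstance 2 n}
    (hI : SimultaneouslyTriangularizable I.M) :
    readyProg.Ends (1000 * (n * (Nat.log 2 n + 2) + 1)) (input I) (Ready I) := by
  have hn : n ≤ n * (Nat.log 2 n + 2) := Nat.le_mul_of_pos_right n (by omega)
  refine Prog.Ends.seq (T₁ := 750 * (n + 1)) (T₂ := 250 * (n * (Nat.log 2 n + 2) + 1))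
    ((ends_prepareProg hI).mono le_rfl ?_) ?_
  swap
  · generalize n * (Nat.log 2 n + 2) = Z at *
    omega
  intro s _ hs
  have hlen : s.nat 4 0 ≤ n := by
    have := congrArg List.length hs.positives
    rw [length_seg] at this
    rw [this]
    exact (List.length_filter_le _ _).trans_eq List.length_range
  have hmemP : ∀ x ∈ seg (s.nat 6) 0 (s.nat 4 0), x < n ∧ 0 ≤ s.real 8 x := by
    rw [hs.positives]
    intro x hx
    simpa using hx
  have hmemN : ∀ x ∈ seg (s.nat 8) 0 (s.nat 5 0), x < n ∧ s.real 8 x < 0 := by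
    rw [hs.negatives]
    intro x hx
    simpa using hx
  refine (ends_sortProg rfl hs.runs fun x hx => (hs.key x (hmemP x hx).1).2).mono ?_ ?_
  · gcongr
  rintro s' hF ⟨hp, hso⟩
  have e₁ : s'.positives = seg (s'.nat 16) 0 (s.nat 4 0) := by
    rw [State.positives, hF.nat 4 (by decide)]
  have e₂ : s'.negatives = seg (s.nat 8) 0 (s.nat 5 0) := by
    rw [State.negatives, hF.nat 5 (by decide), hF.nat 8 (by decide)]
  have hperm : (s'.positives ++ s'.negatives).Perm (List.range n) := by
    rw [e₁, e₂]
    refine (hp.append_right _).trans ?_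
    rw [hs.positives, hs.negatives]
    simpa only [decide_not] using List.filter_append_perm (fun x => decide (0 ≤ s.real 8 x)) (List.range n)
  refine ⟨?_, ?_, hperm, ?_, ?_, ?_⟩
  · rw [hF.nat 0 (by decide), hs.size]
  · rw [hF.real 8 (by decide), hF.real 9 (by decide), hF.real 10 (by decide)]
    exact hs.represents
  · rw [e₂]
    exact fun i hi => hs.det i (hmemN i hi).1 (hmemN i hi).2
  · rw [hF.real 10 (by decide)]
    intro i hi
    rcases le_or_gt 0 (s.real 8 i) with h | h
    · exact hs.nonneg i hi h
    · exact (hs.pos i hi h).le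
  · rw [hF.real 8 (by decide), hF.real 9 (by decide), hF.real 10 (by decide)]
    have hnd := hperm.nodup_iff.2 List.nodup_range
    rw [e₁, e₂] at hnd ⊢
    have hm : ∀ x ∈ seg (s'.nat 16) 0 (s.nat 4 0), x < n ∧ 0 ≤ s.real 8 x := fun x hx =>
      hmemP x (hp.subset hx)
    exact hasStructuredMin_of_pairwise hnd (fun x hx => (hm x hx).2)
      (fun x hx => hs.nonneg x (hm x hx).1 (hm x hx).2) (fun x hx => (hmemN x hx).2)
      (fun x hx => hs.pos x (hmemN x hx).1 (hmemN x hx).2)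
      (fun x hx => hs.key x (hm x hx).1) hso

end

/-! ### Matrices with nonnegative determinant -/

lemma take_seg {f : ℕ → ℕ} {lo k i : ℕ} (h : i ≤ k) : (seg f lo k).take i = seg f lo i := by
  obtain ⟨j, rfl⟩ := Nat.exists_eq_add_of_le h
  rw [seg_append, List.take_left' (length_seg _ _ _)]

lemma drop_seg {f : ℕ → ℕ} {lo k i : ℕ} (h : i ≤ k) :
    (seg f lo k).drop i = seg f (lo + i) (k - i) := by
  obtain ⟨j, rfl⟩ := Nat.exists_eq_add_of_le h
  rw [seg_append, List.drop_left' (length_seg _ _ _), Nat.add_sub_cancel_left]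

/-- Without indices of negative type, a rotation of the sorted list is optimal. -/
lemma exists_rotate_isMinimal {A B D : ℕ → ℝ} {K : List ℕ} (h : HasStructuredMin A B D K []) :
    ∃ m ≤ K.length, IsMinimal A B D (K.rotate m) := by
  obtain ⟨W, ⟨hp, K₁, K₂, K₃, m, l, hK, hm, -, h₁, -, h₃⟩, hW⟩ := h
  obtain rfl := h₃ rfl
  rw [List.append_nil] at hp hK
  refine ⟨m, hm, ?_⟩
  rw [← hK, List.filter_eq_self.2 fun x hx => by simpa using hp.subset hx,
    List.filter_eq_self.2 fun x hx => by simpa using hx] at h₁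
  rwa [← h₁]

/-- The data of the products along an initial or a final segment are in the arrays `u`, `v`, `w`. -/
def HoldsProducts (s : State) (u v w r : ℕ) (L : List ℕ) : Prop :=
  s.real u r = (L.map (s.real 8)).prod ∧ s.real v r = offDiag (s.real 8) (s.real 9) (s.real 10) L ∧
    s.real w r = (L.map (s.real 10)).prod

/-- Computes the products along all initial segments of the sorted list. -/
def prefixProg : Prog := .seq
  (block [letReal 17 (.lit 1), letReal 18 (.lit 0), letReal 19 (.lit 1)])
  (forLoop 2 (nvar 4) (block [
    .setReal 17 (.add (nvar 2) (.lit 1)) (.mul (real_ 17 2) (.get 8 (nat_ 16 2))),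
    .setReal 18 (.add (nvar 2) (.lit 1)) (.add (.mul (.get 8 (nat_ 16 2)) (real_ 18 2))
      (.mul (.get 9 (nat_ 16 2)) (real_ 19 2))),
    .setReal 19 (.add (nvar 2) (.lit 1)) (.mul (real_ 19 2) (.get 10 (nat_ 16 2)))]))

lemma ends_prefixProg {s : State} {p : ℕ} (h4 : s.nat 4 0 = p) :
    prefixProg.Ends (100 * (p + 1)) s fun s' =>
      ∀ r ≤ p, HoldsProducts s' 17 18 19 r (seg (s.nat 16) 0 r) := by
  refine Prog.Ends.seq (T₁ := 20) (T₂ := 80 * p + 20) (Prog.ends_of_wp (Q := fun s' =>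
    HoldsProducts s' 17 18 19 0 []) (by simp [HoldsProducts]) (by decide) |>.mono le_rfl ?_)
    (by omega)
  intro s₁ hF h₀
  refine ends_forLoop_const p 60 (fun i s' => ∀ r ≤ i,
    HoldsProducts s' 17 18 19 r (seg (s.nat 16) 0 r)) (by decide) ?_ ?_ ?_ ?_ ?_
  · intro r hr
    obtain rfl : r = 0 := by omega
    simpa [HoldsProducts] using h₀
  · intro i s' _ hF' _ _
    rw [NExp.eval, NExp.eval, hF'.nat 4 (by decide), hF.nat 4 (by decide), h4]
  · intro i s' hi hF' h2 h
    refine Prog.ends_of_wp ?_ (by decide)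
    have h16 : s'.nat 16 = s.nat 16 := by rw [hF'.nat 16 (by decide), hF.nat 16 (by decide)]
    obtain ⟨e₁, e₂, e₃⟩ := h i le_rfl
    intro r hr
    rcases Nat.lt_succ_iff_lt_or_eq.1 (Nat.lt_succ_of_le hr) with hr | rfl
    · simpa [HoldsProducts, h2, h16, hr.ne] using h r (by omega)
    · rw [seg_concat]
      simp [HoldsProducts, h2, h16, e₁, e₂, e₃, offDiag_append]
  · intro s' _ _ h
    exact h
  · simp only [NExp.cost]
    omega

/-- Computes the products along all final segments of the sorted list. -/
def suffixProg : Prog := .seq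
  (block [letReal 20 (.lit 1), letReal 21 (.lit 0), letReal 22 (.lit 1)])
  (forLoop 2 (nvar 4) (block [
    letNat 18 (.get 16 (.sub (.sub (nvar 4) (.lit 1)) (nvar 2))),
    .setReal 20 (.add (nvar 2) (.lit 1)) (.mul (real_ 8 18) (real_ 20 2)),
    .setReal 21 (.add (nvar 2) (.lit 1)) (.add (.mul (real_ 20 2) (real_ 9 18))
      (.mul (real_ 21 2) (real_ 10 18))),
    .setReal 22 (.add (nvar 2) (.lit 1)) (.mul (real_ 10 18) (real_ 22 2))]))

lemma ends_suffixProg {s : State} {p : ℕ} (h4 : s.nat 4 0 = p) :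
    suffixProg.Ends (100 * (p + 1)) s fun s' =>
      ∀ r ≤ p, HoldsProducts s' 20 21 22 r (seg (s.nat 16) (p - r) r) := by
  refine Prog.Ends.seq (T₁ := 20) (T₂ := 80 * p + 20) (Prog.ends_of_wp (Q := fun s' =>
    HoldsProducts s' 20 21 22 0 []) (by simp [HoldsProducts]) (by decide) |>.mono le_rfl ?_)
    (by omega)
  intro s₁ hF h₀
  refine ends_forLoop_const p 65 (fun i s' => ∀ r ≤ i,
    HoldsProducts s' 20 21 22 r (seg (s.nat 16) (p - r) r)) (by decide) ?_ ?_ ?_ ?_ ?_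
  · intro r hr
    obtain rfl : r = 0 := by omega
    simpa [HoldsProducts] using h₀
  · intro i s' _ hF' _ _
    rw [NExp.eval, NExp.eval, hF'.nat 4 (by decide), hF.nat 4 (by decide), h4]
  · intro i s' hi hF' h2 h
    refine Prog.ends_of_wp ?_ (by decide)
    have h16 : s'.nat 16 = s.nat 16 := by rw [hF'.nat 16 (by decide), hF.nat 16 (by decide)]
    have h4' : s'.nat 4 0 = p := by rw [hF'.nat 4 (by decide), hF.nat 4 (by decide), h4]
    obtain ⟨e₁, e₂, e₃⟩ := h i le_rfl
    intro r hr
    rcases Nat.lt_succ_iff_lt_or_eq.1 (Nat.lt_succ_of_le hr) with hr | rfl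
    · simpa [HoldsProducts, h2, h16, hr.ne] using h r (by omega)
    · have e : p - i = p - (i + 1) + 1 := by omega
      have e' : p - 1 - i = p - (i + 1) := by omega
      rw [e] at e₁ e₂ e₃
      rw [seg_succ]
      simp [HoldsProducts, h2, h16, e₁, e₂, e₃, h4', e']
  · intro s' _ _ h
    exact h
  · simp only [NExp.cost]
    omega

/-- The value of the rotation by the number in the natural array `2`. -/
def rotationValue : RExp :=
  .add (.mul (real_ 17 2) (.get 21 (.sub (nvar 4) (nvar 2))))
    (.mul (real_ 18 2) (.get 22 (.sub (nvar 4) (nvar 2))))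

/-- Finds the best rotation. -/
def bestProg : Prog := .seq
  (block [letNat 2 (.lit 0), letNat 17 (.lit 0), letReal 23 rotationValue])
  (forLoop 2 (.add (nvar 4) (.lit 1))
    (.ite (.realLe (rvar 23) rotationValue) .skip
      (block [letNat 17 (nvar 2), letReal 23 rotationValue])))

lemma ends_bestProg {s : State} {p : ℕ} {v : ℕ → ℝ} (h4 : s.nat 4 0 = p)
    (h : ∀ s' : State, s'.nat 4 = s.nat 4 → (∀ a ≤ 22, s'.real a = s.real a) → s'.nat 2 0 ≤ p →
      rotationValue.eval s' = v (s'.nat 2 0)) :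
    bestProg.Ends (150 * (p + 1)) s fun s' =>
      s'.nat 17 0 ≤ p ∧ ∀ r ≤ p, v (s'.nat 17 0) ≤ v r := by
  refine Prog.Ends.seq (T₁ := 30) (T₂ := 100 * (p + 1) + 20) (Prog.ends_of_wp (Q := fun s' =>
    s'.nat 17 0 = 0 ∧ s'.real 23 0 = v 0) ?_ (by decide) |>.mono le_rfl ?_) (by omega)
  · have := h ((s.setNat 2 0 0).setNat 17 0 0) (by simp) (fun a _ => rfl) (by simp)
    refine ⟨by simp, ?_⟩
    simp only [State.real_setReal_same, NExp.eval, Function.update_self]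
    simpa using this
  rintro s₁ hF ⟨h17, h23⟩
  refine ends_forLoop_const (p + 1) 70 (fun i s' => s'.nat 17 0 ≤ p ∧
    s'.real 23 0 = v (s'.nat 17 0) ∧ ∀ r < i, v (s'.nat 17 0) ≤ v r) (by decide) ?_ ?_ ?_ ?_ ?_
  · simp [h17, h23]
  · intro i s' _ hF' _ _
    simp [hF'.nat 4 (by decide), hF.nat 4 (by decide), h4]
  · rintro i s' hi hF' h2 ⟨h₁, h₂, h₃⟩
    have hR : ∀ a ≤ 22, s'.real a = s.real a := by
      intro a ha
      have ha' : a ∉ [23] := by simp; omega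
      rw [hF'.real a ?_, hF.real a ?_]
      · simpa [block, Prog.realWrites] using ha'
      · simpa [block, forLoop, Prog.realWrites] using ha'
    have h4' : s'.nat 4 = s.nat 4 := by rw [hF'.nat 4 (by decide), hF.nat 4 (by decide)]
    have e := h s' h4' hR (by omega)
    have e' := h (s'.setNat 17 0 i) (by simpa using h4') hR (by simpa [h2] using Nat.le_of_lt_succ hi)
    rw [State.nat_setNat_of_ne _ _ _ (by decide), h2] at e'
    rw [h2] at e
    refine Prog.ends_of_wp ⟨fun hb => ?_, fun hb => ?_⟩ (by decide)
    · simp only [Test.Holds, e, RExp.eval, NExp.eval, h₂] at hb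
      refine ⟨by simpa using h₁, by simpa using h₂, fun r hr => ?_⟩
      rcases Nat.lt_succ_iff_lt_or_eq.1 hr with hr | rfl
      · simpa using h₃ r hr
      · simpa using hb
    · simp only [Test.Holds, e, RExp.eval, NExp.eval, h₂, not_le] at hb
      simp only [Prog.wp, block, NExp.eval, h2, e']
      refine ⟨by simpa using Nat.le_of_lt_succ hi, by simp, fun r hr => ?_⟩
      rcases Nat.lt_succ_iff_lt_or_eq.1 hr with hr | rfl
      · simpa using hb.le.trans (h₃ r hr)
      · simp
  · rintro s' _ _ ⟨h₁, -, h₃⟩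
    exact ⟨h₁, fun r hr => h₃ r (by omega)⟩
  · simp only [NExp.cost]
    omega

/-- Writes the rotation by the variable 17 to the output. -/
def outputProg : Prog :=
  forLoop 2 (nvar 4) (.ite (.natLe (nvar 4) (.add (nvar 17) (nvar 2)))
    (.setNat 1 (nvar 2) (.get 16 (.sub (.add (nvar 17) (nvar 2)) (nvar 4))))
    (.setNat 1 (nvar 2) (.get 16 (.add (nvar 17) (nvar 2)))))

lemma ends_outputProg {s : State} {p r : ℕ} (h4 : s.nat 4 0 = p) (h17 : s.nat 17 0 = r)
    (hr : r ≤ p) : outputProg.Ends (50 * (p + 1)) s fun s' =>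
      seg (s'.nat 1) 0 p = (seg (s.nat 16) 0 p).rotate r := by
  refine ends_forLoop_const p 35 (fun i s' => ∀ j < i, s'.nat 1 j = s.nat 16 ((r + j) % p))
    (by decide) (by simp) ?_ ?_ ?_ ?_
  · intro i s' _ hF _ _
    simp [hF.nat 4 (by decide), h4]
  · intro i s' hi hF h2 h
    have e₁ : s'.nat 4 0 = p := by rw [hF.nat 4 (by decide), h4]
    have e₂ : s'.nat 17 0 = r := by rw [hF.nat 17 (by decide), h17]
    have e₃ : s'.nat 16 = s.nat 16 := hF.nat 16 (by decide)
    refine Prog.ends_of_wp ?_ (by decide)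
    simp only [Prog.wp, Test.Holds, NExp.eval, e₁, e₂, h2, e₃]
    refine ⟨fun hb j hj => ?_, fun hb j hj => ?_⟩ <;>
      rcases Nat.lt_succ_iff_lt_or_eq.1 hj with hj | rfl
    · simpa [hj.ne] using h j hj
    · rw [Nat.mod_eq_sub_mod hb, Nat.mod_eq_of_lt (by omega)]
      simp
    · simpa [hj.ne] using h j hj
    · rw [Nat.mod_eq_of_lt (by omega)]
      simp
  · intro s' _ _ h
    have hlen : ((seg (s.nat 16) 0 p).rotate r).length = p := by simp
    conv_lhs => rw [← hlen]
    rw [seg_eq_iff]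
    intro i hi
    rw [hlen] at hi
    rw [zero_add, h i hi, List.getElem_rotate, getElem_seg, length_seg, zero_add, add_comm r]
  · simp only [NExp.cost]
    omega

/-- Finds the best rotation of the sorted list and writes it to the output. -/
def rotationProg : Prog :=
  .seq prefixProg (.seq suffixProg (.seq bestProg outputProg))

/-- The best rotation of the list in the natural array `16` is written to the output. -/
lemma ends_rotationProg {s : State} :
    rotationProg.Ends (400 * (s.nat 4 0 + 1)) s fun s' => ∃ r,
      seg (s'.nat 1) 0 (s.nat 4 0) = s.positives.rotate r ∧ ∀ m ≤ s.nat 4 0,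
        offDiag (s.real 8) (s.real 9) (s.real 10) (s.positives.rotate r) ≤
          offDiag (s.real 8) (s.real 9) (s.real 10) (s.positives.rotate m) := by
  generalize hp : s.nat 4 0 = p
  refine Prog.Ends.seq (T₁ := 100 * (p + 1)) (T₂ := 300 * (p + 1))
    ((ends_prefixProg hp).mono le_rfl ?_) (by omega)
  intro s₁ hF₁ h₁
  refine Prog.Ends.seq (T₁ := 100 * (p + 1)) (T₂ := 200 * (p + 1))
    ((ends_suffixProg (p := p) (by rw [hF₁.nat 4 (by decide), hp])).mono le_rfl ?_) (by omega)
  intro s₂ hF₂ h₂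
  have h4 : s₂.nat 4 = s.nat 4 := by rw [hF₂.nat 4 (by decide), hF₁.nat 4 (by decide)]
  have h16 : s₂.nat 16 = s.nat 16 := by rw [hF₂.nat 16 (by decide), hF₁.nat 16 (by decide)]
  have r8 : s₂.real 8 = s.real 8 := by rw [hF₂.real 8 (by decide), hF₁.real 8 (by decide)]
  have r9 : s₂.real 9 = s.real 9 := by rw [hF₂.real 9 (by decide), hF₁.real 9 (by decide)]
  have r10 : s₂.real 10 = s.real 10 := by rw [hF₂.real 10 (by decide), hF₁.real 10 (by decide)]
  refine Prog.Ends.seq (T₁ := 150 * (p + 1)) (T₂ := 50 * (p + 1)) ((ends_bestProg (p := p)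
    (v := fun r => offDiag (s.real 8) (s.real 9) (s.real 10) (s.positives.rotate r))
    (by rw [h4, hp]) ?_).mono le_rfl ?_) (by omega)
  · intro s' h4' hR h2
    obtain ⟨a₁, b₁, -⟩ := h₁ _ h2
    obtain ⟨-, b₂, d₂⟩ := h₂ (p - s'.nat 2 0) (by omega)
    rw [r9, r8, r10] at b₂
    rw [r10] at d₂
    rw [hF₁.nat 16 (by decide)] at b₂ d₂
    rw [hF₁.real 8 (by decide)] at a₁ b₁
    rw [hF₁.real 9 (by decide), hF₁.real 10 (by decide)] at b₁
    have e17 : s'.real 17 = s₁.real 17 := by rw [hR 17 (by decide), hF₂.real 17 (by decide)]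
    have e18 : s'.real 18 = s₁.real 18 := by rw [hR 18 (by decide), hF₂.real 18 (by decide)]
    simp only [rotationValue, RExp.eval, NExp.eval, h4', h4, hp, e17, e18, hR 21 (by decide),
      hR 22 (by decide), a₁, b₁, b₂, d₂]
    rw [Nat.sub_sub_self h2, List.rotate_eq_drop_append_take (by
      rw [State.positives, length_seg, hp]; exact h2), State.positives, hp, take_seg h2,
      drop_seg h2, offDiag_append, zero_add]
  · rintro s₃ hF₃ ⟨hr, hmin⟩
    refine (ends_outputProg (p := p) (by rw [hF₃.nat 4 (by decide), h4, hp]) rfl hr).mono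
      le_rfl ?_
    intro s₄ _ h₄
    refine ⟨s₃.nat 17 0, ?_, hmin⟩
    rw [h₄, hF₃.nat 16 (by decide), h16, State.positives, hp]

lemma solvesWithin_of_ends {n : ℕ} {I : OrderingInstance 2 n} {p : Prog} {T : ℕ} {T' : ℝ}
    (h : p.Ends T (input I) fun s => IsOptimalList I (seg (s.nat 1) 0 n)) (hT : (T : ℝ) ≤ T') :
    SolvesWithin p I T' := by
  obtain ⟨t, s, hr, ht, hs⟩ := h
  obtain ⟨σ, hσ, hopt⟩ := exists_perm_of_isOptimalList hs
  refine ⟨t, s, hr, le_trans (by exact_mod_cast ht) hT, σ, fun i => ?_, hopt⟩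
  have := hσ i
  rw [List.getElem?_eq_getElem (by simp), getElem_seg, zero_add] at this
  exact Option.some.inj this

lemma ends_rotation_isOptimalList {n : ℕ} {I : OrderingInstance 2 n}
    (hI : SimultaneouslyTriangularizable I.M) (hdet : ∀ i, 0 ≤ (I.M i).det) :
    (Prog.seq readyProg rotationProg).Ends (1500 * (n * (Nat.log 2 n + 2) + 1)) (input I)
      fun s => IsOptimalList I (seg (s.nat 1) 0 n) := by
  have hn : n ≤ n * (Nat.log 2 n + 2) := Nat.le_mul_of_pos_right n (by omega)
  refine Prog.Ends.seq (T₁ := 1000 * (n * (Nat.log 2 n + 2) + 1))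
    (T₂ := 500 * (n * (Nat.log 2 n + 2) + 1)) ((ends_readyProg hI).mono le_rfl ?_) (by omega)
  intro s _ hs
  have hneg : s.negatives = [] := by
    refine List.eq_nil_iff_forall_not_mem.2 fun i hi => ?_
    have hin : i < n := List.mem_range.1 (hs.perm.subset (List.mem_append_right _ hi))
    have := hs.det i hi
    rw [mat, dif_pos hin] at this
    exact absurd (hdet ⟨i, hin⟩) (not_le.2 this)
  have hperm := hs.perm
  have hmin := hs.min
  rw [hneg] at hmin hperm
  rw [List.append_nil] at hperm
  have h4 : s.nat 4 0 = n := by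
    have := hperm.length_eq
    rwa [State.positives, length_seg, List.length_range] at this
  refine ends_rotationProg.mono (by rw [h4]; omega) ?_
  rintro s' - ⟨r, h₁, h₂⟩
  rw [h4] at h₁ h₂
  rw [h₁]
  obtain ⟨m, hm, hopt⟩ := exists_rotate_isMinimal hmin
  have hrp : ∀ r, (s.positives.rotate r).Perm s.positives := fun r => List.rotate_perm _ _
  refine hs.represents _ ((hrp r).trans hperm) fun W' hW' => ?_
  refine (h₂ m ?_).trans (hopt W' (hW'.trans ((hrp r).trans (hrp m).symm)))
  rwa [hperm.length_eq, List.length_range] at hm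

/-- In terms of the natural logarithm, the number of steps of a program that sorts is of the order
of `n log n`. -/
lemma mul_log_le (n : ℕ) :
    ((n * (Nat.log 2 n + 2) + 1 : ℕ) : ℝ) ≤ 8 * (n * Real.log n + 1) := by
  rcases Nat.lt_or_ge n 2 with hn | hn
  · interval_cases n <;> norm_num
  · have h₂ : 0 < Real.log 2 := Real.log_pos (by norm_num)
    have hlog : (Nat.log 2 n : ℝ) * Real.log 2 ≤ Real.log n := by
      rw [← Real.log_pow]
      refine Real.log_le_log (by positivity) ?_
      exact_mod_cast Nat.pow_log_le_self 2 (by omega)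
    have hlog2 : Real.log 2 ≤ Real.log n := Real.log_le_log (by norm_num) (by exact_mod_cast hn)
    have hhalf : (1 : ℝ) / 2 ≤ Real.log 2 := by linarith [Real.log_two_gt_d9]
    have h₃ : (Nat.log 2 n : ℝ) + 2 ≤ 8 * Real.log n := by
      have : (0 : ℝ) ≤ Nat.log 2 n := by positivity
      nlinarith
    have h₄ := mul_le_mul_of_nonneg_left h₃ (by positivity : (0 : ℝ) ≤ n)
    push_cast
    linarith

end RealRAM

namespace OrderingProof

/-! ### Interleavings -/

/-- The list `L` is an interleaving of the sequences `sq 0`, …, `sq (R - 1)`, of which the first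
`d 0`, …, `d (R - 1)` elements are used. The elements of each sequence occur in `L` from the right
to the left. -/
def Fits (sq : ℕ → List ℕ) (R : ℕ) : (ℕ → ℕ) → List ℕ → Prop
  | d, [] => ∀ r < R, d r = 0
  | d, x :: L => ∃ r < R, ∃ e, d r = e + 1 ∧ (sq r)[e]? = some x ∧
      Fits sq R (Function.update d r e) L

variable {sq : ℕ → List ℕ} {R : ℕ}

lemma Fits.congr {L : List ℕ} : ∀ {d d' : ℕ → ℕ}, Fits sq R d L → (∀ r < R, d r = d' r) →
    Fits sq R d' L := by
  induction L with
  | nil => intro d d' h h' r hr; rw [← h' r hr]; exact h r hr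
  | cons x L ih =>
    rintro d d' ⟨r, hr, e, he, hx, h⟩ h'
    refine ⟨r, hr, e, by rw [← h' r hr, he], hx, ih h fun r' hr' => ?_⟩
    by_cases hrr : r' = r
    · subst hrr; simp
    · simp [hrr, h' r' hr']

lemma Fits.coe_eq {L : List ℕ} : ∀ {d : ℕ → ℕ}, Fits sq R d L →
    (L : Multiset ℕ) = ∑ r ∈ Finset.range R, ((sq r).take (d r) : Multiset ℕ) := by
  induction L with
  | nil =>
    intro d h
    rw [Finset.sum_eq_zero]
    · rfl
    · intro r hr
      rw [h r (Finset.mem_range.1 hr)]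
      simp
  | cons x L ih =>
    rintro d ⟨r, hr, e, he, hx, h⟩
    have hr' := Finset.mem_range.2 hr
    rw [← Multiset.cons_coe, ih h, ← Finset.add_sum_erase _ _ hr', ← Finset.add_sum_erase _ _ hr',
      he, List.take_add_one, hx, Function.update_self]
    have : ∑ i ∈ (Finset.range R).erase r,
        (((sq i).take (Function.update d r e i) : List ℕ) : Multiset ℕ) =
        ∑ i ∈ (Finset.range R).erase r, (((sq i).take (d i) : List ℕ) : Multiset ℕ) := by
      refine Finset.sum_congr rfl fun i hi => ?_
      rw [Function.update_of_ne (Finset.ne_of_mem_erase hi)]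
    rw [this, ← Multiset.cons_add, Multiset.cons_coe]
    congr 1
    exact Multiset.coe_eq_coe.2 (by simpa using (List.perm_append_singleton x _).symm)

lemma Fits.perm {d : ℕ → ℕ} {L L' : List ℕ} (h : Fits sq R d L) (h' : Fits sq R d L') :
    L.Perm L' :=
  Multiset.coe_eq_coe.1 (h.coe_eq.trans h'.coe_eq.symm)

/-- A list is an interleaving if its elements are distributed among the sequences by a function and
occur in the right order. -/
lemma fits_of_filter {own : ℕ → ℕ} {L : List ℕ} : ∀ {d : ℕ → ℕ}, (∀ x ∈ L, own x < R) →
    (∀ r < R, d r ≤ (sq r).length) →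
    (∀ r < R, (L.filter (own · = r)).reverse = (sq r).take (d r)) → Fits sq R d L := by
  induction L with
  | nil =>
    intro d _ hd h r hr
    have := congrArg List.length (h r hr)
    simp only [List.filter_nil, List.reverse_nil, List.length_nil, List.length_take] at this
    have := hd r hr
    omega
  | cons x L ih =>
    intro d hown hd h
    have hr := hown x (by simp)
    have hx := h _ hr
    rw [List.filter_cons_of_pos (by simp), List.reverse_cons] at hx
    have hlen := congrArg List.length hx
    simp only [List.length_append, List.length_singleton, List.length_take] at hlen
    have hd' := hd _ hr
    obtain ⟨e, he⟩ : ∃ e, d (own x) = e + 1 := ⟨d (own x) - 1, by omega⟩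
    obtain ⟨z, hz⟩ : ∃ z, (sq (own x))[e]? = some z :=
      ⟨_, List.getElem?_eq_getElem (by omega)⟩
    rw [he, List.take_add_one, hz, Option.toList_some] at hx
    obtain ⟨h₁, h₂⟩ := List.append_inj' hx rfl
    obtain rfl : x = z := by simpa using h₂
    refine ⟨own x, hr, e, he, hz, ih (fun y hy => hown y (List.mem_cons_of_mem _ hy)) ?_ ?_⟩
    · intro r hr'
      by_cases hrr : r = own x
      · subst hrr; rw [Function.update_self]; omega
      · rw [Function.update_of_ne hrr]; exact hd r hr'
    · intro r hr'
      by_cases hrr : r = own x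
      · subst hrr; rw [Function.update_self, h₁]
      · rw [Function.update_of_ne hrr, ← h r hr', List.filter_cons_of_neg]
        simpa using fun h => hrr h.symm

/-- The sequences that a structured ordering is composed of: the rotation by `m` without a block of
`K`, the rotation by `l` restricted to this block, and the indices of negative type one by one. -/
def seqs (K negs : List ℕ) (m l α β : ℕ) : ℕ → List ℕ
  | 0 => ((K.rotate m).filter (· ∉ (K.take β).drop α)).reverse
  | 1 => (K.rotate l).filter (· ∈ (K.take β).drop α)
  | r + 2 => negs[r]?.toList

lemma sum_seqs (K negs : List ℕ) (m l α β : ℕ) :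
    ∑ r ∈ Finset.range (negs.length + 2), (seqs K negs m l α β r : Multiset ℕ) =
      ((K ++ negs : List ℕ) : Multiset ℕ) := by
  have h : ∀ j, ∑ r ∈ Finset.range j, ((negs[r]?.toList : List ℕ) : Multiset ℕ) =
      (negs.take j : Multiset ℕ) := by
    intro j
    induction j with
    | zero => simp
    | succ j ih => rw [Finset.sum_range_succ, ih, List.take_add_one, Multiset.coe_add]
  rw [Finset.sum_range_succ', Finset.sum_range_succ']
  simp only [seqs]
  rw [h, List.take_length, Multiset.coe_add, Multiset.coe_add, Multiset.coe_eq_coe]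
  set P := (K.take β).drop α
  have h₁ : ((K.rotate l).filter (· ∈ P)).Perm (K.filter (· ∈ P)) :=
    (List.rotate_perm _ _).filter _
  have h₂ : ((K.rotate m).filter (· ∉ P)).reverse.Perm (K.filter (· ∉ P)) :=
    (List.reverse_perm _).trans ((List.rotate_perm _ _).filter _)
  refine ((h₁.append_left negs).append h₂).trans ?_
  rw [List.append_assoc]
  refine List.perm_append_comm.trans (List.Perm.append_right negs ?_)
  simpa only [decide_not] using List.filter_append_perm (fun x => decide (x ∈ P)) K

lemma Fits.perm_seqs {K negs : List ℕ} {m l α β : ℕ} {L : List ℕ}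
    (h : Fits (seqs K negs m l α β) (negs.length + 2)
      (fun r => (seqs K negs m l α β r).length) L) : L.Perm (K ++ negs) := by
  have := h.coe_eq
  simp only [List.take_length] at this
  rw [sum_seqs] at this
  exact Multiset.coe_eq_coe.1 this

/-- A structured ordering is an interleaving. -/
lemma Structured.exists_fits {K negs W : List ℕ} (hn : (K ++ negs).Nodup)
    (h : Structured K negs W) : ∃ m ≤ K.length, ∃ l ≤ K.length, ∃ α ≤ K.length, ∃ β ≤ K.length,
      Fits (seqs K negs m l α β) (negs.length + 2)
        (fun r => (seqs K negs m l α β r).length) W := by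
  obtain ⟨hp, K₁, K₂, K₃, m, l, hK, hm, hl, h₁, h₂, -⟩ := h
  refine ⟨m, hm, l, hl, K₁.length, by simp [hK], K₁.length + K₂.length, by simp [hK], ?_⟩
  have hblock : (K.take (K₁.length + K₂.length)).drop K₁.length = K₂ := by
    rw [hK, List.take_left' (by simp), List.drop_left' rfl]
  have hnd : W.Nodup := hp.nodup_iff.2 hn
  have hKneg : ∀ x ∈ K, x ∉ negs := fun x hx hx' =>
    (List.nodup_append.1 hn).2.2 x hx x hx' rfl
  have hKn := (List.nodup_append.1 hn).1
  have hnn := (List.nodup_append.1 hn).2.1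
  have hK₂ : ∀ x ∈ K, x ∈ K₁ ++ K₃ ↔ x ∉ K₂ := by
    rw [hK] at hKn ⊢
    intro x hx
    rw [List.append_assoc, List.nodup_append] at hKn
    obtain ⟨-, k₂, k₃⟩ := hKn
    rw [List.nodup_append] at k₂
    simp only [List.mem_append] at hx ⊢
    constructor
    · rintro (h | h) h'
      · exact k₃ x h x (by simp [h']) rfl
      · exact k₂.2.2 x h' x h rfl
    · tauto
  let own : ℕ → ℕ := fun x => if x ∈ K₂ then 1 else if x ∈ K then 0 else negs.idxOf x + 2
  have hown0 : ∀ x, own x = 0 ↔ x ∈ K ∧ x ∉ K₂ := by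
    intro x
    simp only [own]
    split_ifs <;> simp_all
  have hown1 : ∀ x, own x = 1 ↔ x ∈ K₂ := by
    intro x
    simp only [own]
    split_ifs <;> simp_all
  have hK₂K : ∀ x ∈ K₂, x ∈ K := fun x hx => by rw [hK]; simp [hx]
  have hown2 : ∀ x r, own x = r + 2 ↔ x ∉ K ∧ negs.idxOf x = r := by
    intro x r
    simp only [own]
    split_ifs with h₁ h₂
    · simp [hK₂K x h₁]
    · simp [h₂]
    · simp [h₂]
  refine fits_of_filter (own := own) ?_ (fun _ _ => le_rfl) ?_
  · intro x hx
    by_contra hlt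
    obtain ⟨r, hr⟩ := Nat.exists_eq_add_of_le (not_lt.1 hlt)
    have := (hown2 x (negs.length + r)).1 (by omega)
    have hx' : x ∈ negs := (List.mem_append.1 (hp.subset hx)).resolve_left this.1
    have := List.idxOf_lt_length_of_mem hx'
    omega
  · intro r hr
    rw [List.take_length]
    rcases r with _ | _ | r
    · simp only [seqs, hblock]
      congr 1
      have e : (K.rotate m).filter (· ∈ K₁ ++ K₃) = (K.rotate m).filter (· ∉ K₂) :=
        List.filter_congr fun x hx => by
          rw [decide_eq_decide]
          exact hK₂ x (List.mem_rotate.1 hx)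
      rw [← e, ← h₁]
      refine List.filter_congr fun x hx => ?_
      rw [decide_eq_decide, hown0]
      by_cases hxK : x ∈ K
      · rw [hK₂ x hxK]; tauto
      · have : x ∉ K₁ ++ K₃ := fun h => hxK (by rw [hK]; simp at h ⊢; tauto)
        tauto
    · simp only [seqs, hblock]
      rw [← h₂]
      congr 1
      refine List.filter_congr fun x hx => ?_
      rw [decide_eq_decide, hown1]
    · simp only [seqs]
      have hr' : r < negs.length := by omega
      rw [List.getElem?_eq_getElem hr', Option.toList_some]
      have : (W.filter (own · = r + 2)).Perm [negs[r]] := by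
        rw [List.perm_ext_iff_of_nodup (hnd.filter _) (by simp)]
        intro x
        simp only [List.mem_filter, decide_eq_true_eq, List.mem_singleton, hown2]
        constructor
        · rintro ⟨-, -, rfl⟩
          exact (List.getElem_idxOf hr').symm
        · rintro rfl
          have hmem : negs[r] ∈ negs := List.getElem_mem hr'
          exact ⟨hp.symm.subset (by simp), fun h => hKneg _ h hmem, hnn.idxOf_getElem r hr'⟩
      rw [List.perm_singleton.1 this]
      rfl

/-! ### Positions in the table -/

/-- The weights of the digits in the numbering of the vectors `d` with `d r ≤ (sq r).length`. -/
def stride (sq : ℕ → List ℕ) : ℕ → ℕ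
  | 0 => 1
  | r + 1 => stride sq r * ((sq r).length + 1)

/-- The number of the vector `d`. -/
def enc (sq : ℕ → List ℕ) (R : ℕ) (d : ℕ → ℕ) : ℕ :=
  ∑ r ∈ Finset.range R, d r * stride sq r

lemma stride_pos (r : ℕ) : 0 < stride sq r := by
  induction r with
  | zero => exact Nat.one_pos
  | succ r ih => exact Nat.mul_pos ih (Nat.succ_pos _)

lemma enc_lt {d : ℕ → ℕ} (hd : ∀ r < R, d r ≤ (sq r).length) : enc sq R d < stride sq R := by
  induction R with
  | zero => simp [enc, stride]
  | succ R ih =>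
    have h₁ := ih fun r hr => hd r (by omega)
    have h₂ := Nat.mul_le_mul_right (stride sq R) (hd R (by omega))
    rw [enc, Finset.sum_range_succ, stride, Nat.mul_add, mul_one, mul_comm (stride sq R)]
    unfold enc at h₁
    omega

lemma enc_inj {d d' : ℕ → ℕ} (hd : ∀ r < R, d r ≤ (sq r).length)
    (hd' : ∀ r < R, d' r ≤ (sq r).length) (h : enc sq R d = enc sq R d') :
    ∀ r < R, d r = d' r := by
  induction R with
  | zero => intro r hr; omega
  | succ R ih =>
    have h₁ := enc_lt (R := R) fun r hr => hd r (by omega)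
    have h₂ := enc_lt (R := R) fun r hr => hd' r (by omega)
    rw [enc, Finset.sum_range_succ, enc, Finset.sum_range_succ] at h
    change enc sq R d + _ = enc sq R d' + _ at h
    have hR : d R = d' R := by
      have := congrArg (· / stride sq R) h
      simpa [Nat.add_mul_div_right _ _ (stride_pos R), Nat.div_eq_of_lt h₁,
        Nat.div_eq_of_lt h₂] using this
    rw [hR] at h
    intro r hr
    rcases Nat.lt_succ_iff_lt_or_eq.1 hr with hr | rfl
    · exact ih (fun r hr => hd r (by omega)) (fun r hr => hd' r (by omega)) (by omega) r hr
    · exact hR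

lemma enc_update {d : ℕ → ℕ} {r : ℕ} (hr : r < R) (e : ℕ) :
    enc sq R (Function.update d r e) + d r * stride sq r = enc sq R d + e * stride sq r := by
  have hr' := Finset.mem_range.2 hr
  unfold enc
  rw [← Finset.add_sum_erase _ _ hr', ← Finset.add_sum_erase _ (fun r => d r * _) hr',
    Function.update_self]
  have : ∑ i ∈ (Finset.range R).erase r, Function.update d r e i * stride sq i =
      ∑ i ∈ (Finset.range R).erase r, d i * stride sq i :=
    Finset.sum_congr rfl fun i hi => by rw [Function.update_of_ne (Finset.ne_of_mem_erase hi)]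
  rw [this]
  ring

end OrderingProof

namespace RealRAM

open OrderingProof

/-! ### Dynamic programming over interleavings -/

/-- The list `L` is read off from the entry `q` of the table: the natural array `35` contains the
first elements, and `36` the positions of the remaining lists. -/
def Trace (s : State) : ℕ → List ℕ → Prop
  | _, [] => True
  | q, x :: L => s.nat 35 q = x ∧ s.nat 36 q < q ∧ Trace s (s.nat 36 q) L

lemma Trace.congr {s s' : State} {L : List ℕ} : ∀ {q : ℕ}, Trace s q L →
    (∀ i ≤ q, s'.nat 35 i = s.nat 35 i) → (∀ i ≤ q, s'.nat 36 i = s.nat 36 i) →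
    Trace s' q L := by
  induction L with
  | nil => intros; trivial
  | cons x L ih =>
    rintro q ⟨h₁, h₂, h₃⟩ h35 h36
    refine ⟨by rw [h35 q le_rfl, h₁], by rw [h36 q le_rfl]; exact h₂, ?_⟩
    rw [h36 q le_rfl]
    exact ih h₃ (fun i hi => h35 i (by omega)) fun i hi => h36 i (by omega)

/-- The entry `q` of the table describes the interleaving `L`: the real arrays `25` and `26` hold
the product of the upper left entries and the upper right entry of the product. -/
structure Entry (s : State) (q : ℕ) (L : List ℕ) : Prop where
  prod : s.real 25 q = (L.map (s.real 8)).prod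
  off : s.real 26 q = offDiag (s.real 8) (s.real 9) (s.real 10) L
  trace : Trace s q L

/-- The entry `q` of the table describes a best interleaving that uses the digits `d`. -/
def Good (sq : ℕ → List ℕ) (R : ℕ) (s : State) (d : ℕ → ℕ) (q : ℕ) : Prop :=
  ∃ L, Fits sq R d L ∧ Entry s q L ∧
    ∀ L', Fits sq R d L' → s.real 26 q ≤ offDiag (s.real 8) (s.real 9) (s.real 10) L'

/-- The memories agree on the triangular matrices and on the table up to the position `q`. -/
structure SameTable (s s' : State) (q : ℕ) : Prop where
  r8 : s'.real 8 = s.real 8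
  r9 : s'.real 9 = s.real 9
  r10 : s'.real 10 = s.real 10
  r25 : ∀ i ≤ q, s'.real 25 i = s.real 25 i
  r26 : ∀ i ≤ q, s'.real 26 i = s.real 26 i
  n35 : ∀ i ≤ q, s'.nat 35 i = s.nat 35 i
  n36 : ∀ i ≤ q, s'.nat 36 i = s.nat 36 i

lemma SameTable.mono {s s' : State} {q q' : ℕ} (h : SameTable s s' q) (hq : q' ≤ q) :
    SameTable s s' q' :=
  ⟨h.r8, h.r9, h.r10, fun i hi => h.r25 i (hi.trans hq), fun i hi => h.r26 i (hi.trans hq),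
    fun i hi => h.n35 i (hi.trans hq), fun i hi => h.n36 i (hi.trans hq)⟩

lemma SameTable.of_frame {s s' : State} {p : Prog} (hF : Frame p s s') (q : ℕ)
    (hr : ∀ a ∈ [8, 9, 10, 25, 26], a ∉ p.realWrites) (hn : ∀ a ∈ [35, 36], a ∉ p.natWrites) :
    SameTable s s' q := by
  have r : ∀ a ∈ [8, 9, 10, 25, 26], s'.real a = s.real a := fun a ha => hF.real a (hr a ha)
  have n : ∀ a ∈ [35, 36], s'.nat a = s.nat a := fun a ha => hF.nat a (hn a ha)
  constructor
  iterate 3 exact r _ (by decide)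
  iterate 2 intro i _; rw [r _ (by decide)]
  iterate 2 intro i _; rw [n _ (by decide)]

lemma SameTable.setNat (s : State) (v i x q : ℕ) (h : v ∉ [35, 36]) :
    SameTable s (s.setNat v i x) q := by
  simp only [List.mem_cons, List.not_mem_nil, or_false, not_or] at h
  constructor <;> intros <;> simp [Ne.symm h.1, Ne.symm h.2]

lemma Entry.congr {s s' : State} {q : ℕ} {L : List ℕ} (h : Entry s q L) (hs : SameTable s s' q) :
    Entry s' q L := by
  obtain ⟨h₁, h₂, h₃⟩ := h
  refine ⟨?_, ?_, h₃.congr hs.n35 hs.n36⟩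
  · rw [hs.r25 q le_rfl, hs.r8, h₁]
  · rw [hs.r26 q le_rfl, hs.r8, hs.r9, hs.r10, h₂]

lemma Good.congr {sq : ℕ → List ℕ} {R : ℕ} {s s' : State} {d : ℕ → ℕ} {q : ℕ}
    (h : Good sq R s d q) (hs : SameTable s s' q) : Good sq R s' d q := by
  obtain ⟨L, h₁, h₂, h₃⟩ := h
  refine ⟨L, h₁, h₂.congr hs, ?_⟩
  rw [hs.r26 q le_rfl, hs.r8, hs.r9, hs.r10]
  exact h₃

/-- Position and length of the sequences in the natural array `40`, and the weights of the digits. -/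
structure Layout (sq : ℕ → List ℕ) (R : ℕ) (s : State) : Prop where
  count : s.nat 30 0 = R
  elem : ∀ r < R, ∀ e x, (sq r)[e]? = some x → s.nat 40 (s.nat 44 r + e) = x
  length : ∀ r < R, s.nat 45 r = (sq r).length
  weight : ∀ r ≤ R, s.nat 28 r = stride sq r

lemma Layout.congr {sq : ℕ → List ℕ} {R : ℕ} {s s' : State} (h : Layout sq R s)
    (hs : ∀ a ∈ [28, 30, 40, 44, 45], s'.nat a = s.nat a) : Layout sq R s' := by
  obtain ⟨h₁, h₂, h₃, h₄⟩ := h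
  have e28 := hs 28 (by decide)
  have e30 := hs 30 (by decide)
  have e40 := hs 40 (by decide)
  have e44 := hs 44 (by decide)
  have e45 := hs 45 (by decide)
  exact ⟨by rwa [e30], by rwa [e40, e44], by rwa [e45], by rwa [e28]⟩

/-- Tries the element of the sequence number `r` as the last one to be added. -/
def relaxStep : Prog :=
  .ite (.natLe (.lit 1) (nat_ 31 24))
    (block [
      letNat 43 (.get 40 (.sub (.add (nat_ 44 24) (nat_ 31 24)) (.lit 1))),
      letNat 42 (.sub (nvar 29) (nat_ 28 24)),
      letReal 24 (.add (.mul (real_ 25 42) (real_ 9 43)) (.mul (real_ 26 42) (real_ 10 43))),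
      .ite (.and (.natLe (.lit 1) (nvar 37)) (.realLe (real_ 26 29) (rvar 24))) .skip
        (block [
          .setReal 25 (nvar 29) (.mul (real_ 8 43) (real_ 25 42)),
          .setReal 26 (nvar 29) (rvar 24),
          .setNat 35 (nvar 29) (nvar 43),
          .setNat 36 (nvar 29) (nvar 42),
          letNat 37 (.lit 1)])])
    .skip

/-- The invariant of the loop over the sequences: the candidates from the first `r` sequences have
been taken into account. -/
def RelaxInv (sq : ℕ → List ℕ) (R : ℕ) (d : ℕ → ℕ) (q r : ℕ) (s : State) : Prop :=
  s.nat 37 0 = 0 ∧ Entry s q [] ∧ (∀ r' < r, d r' = 0) ∨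
  s.nat 37 0 = 1 ∧ ∃ L, Fits sq R d L ∧ Entry s q L ∧ ∀ r' < r, ∀ e x L', d r' = e + 1 →
    (sq r')[e]? = some x → Fits sq R (Function.update d r' e) L' →
      s.real 26 q ≤ offDiag (s.real 8) (s.real 9) (s.real 10) (x :: L')

/-- Bellman's principle: the last step of a best interleaving extends a best interleaving. -/
lemma Good.le_cons {sq : ℕ → List ℕ} {R : ℕ} {s : State} {d : ℕ → ℕ} {q x : ℕ} {L' : List ℕ}
    (h : Good sq R s d q) (hx : 0 ≤ s.real 10 x) (hL' : Fits sq R d L') :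
    s.real 25 q * s.real 9 x + s.real 26 q * s.real 10 x ≤
      offDiag (s.real 8) (s.real 9) (s.real 10) (x :: L') := by
  obtain ⟨L, h₁, h₂, h₃⟩ := h
  rw [offDiag_cons, h₂.prod, ((h₁.perm hL').map (s.real 8)).prod_eq]
  have := mul_le_mul_of_nonneg_right (h₃ L' hL') hx
  linarith

lemma ends_relaxStep {sq : ℕ → List ℕ} {R : ℕ} {s : State} {q r : ℕ} (hl : Layout sq R s)
    (hr : r < R) (hrv : s.nat 24 0 = r) (hqv : s.nat 29 0 = q)
    (hd : ∀ r < R, s.nat 31 r ≤ (sq r).length) (henc : enc sq R (s.nat 31) = q)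
    (hnonneg : ∀ r < R, ∀ x ∈ sq r, 0 ≤ s.real 10 x)
    (htab : ∀ d, (∀ r < R, d r ≤ (sq r).length) → enc sq R d < q → Good sq R s d (enc sq R d))
    (h : RelaxInv sq R (s.nat 31) q r s) :
    relaxStep.Ends 150 s fun s' => RelaxInv sq R (s.nat 31) q (r + 1) s' ∧
      (0 < q → SameTable s s' (q - 1)) := by
  refine Prog.ends_of_wp ?_ (by decide)
  refine ⟨fun ht => ?_, fun ht => ?_⟩
  swap
  · -- The sequence is not used.
    have h0 : s.nat 31 r = 0 := by
      simp only [Test.Holds, NExp.eval, hrv] at ht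
      omega
    refine ⟨?_, fun _ => ⟨rfl, rfl, rfl, fun _ _ => rfl, fun _ _ => rfl, fun _ _ => rfl,
      fun _ _ => rfl⟩⟩
    rcases h with ⟨h₁, h₂, h₃⟩ | ⟨h₁, L, h₂, h₃, h₄⟩
    · refine .inl ⟨h₁, h₂, fun r' hr' => ?_⟩
      rcases Nat.lt_succ_iff_lt_or_eq.1 hr' with hr' | rfl
      · exact h₃ r' hr'
      · exact h0
    · refine .inr ⟨h₁, L, h₂, h₃, fun r' hr' e x L' he => ?_⟩
      rcases Nat.lt_succ_iff_lt_or_eq.1 hr' with hr' | rfl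
      · exact h₄ r' hr' e x L' he
      · omega
  · obtain ⟨e, he⟩ : ∃ e, s.nat 31 r = e + 1 := ⟨s.nat 31 r - 1, by
      simp only [Test.Holds, NExp.eval, hrv] at ht
      omega⟩
    have hlt : e < (sq r).length := by have := hd r hr; omega
    obtain ⟨x, hx⟩ : ∃ x, (sq r)[e]? = some x := ⟨_, List.getElem?_eq_getElem hlt⟩
    have hxn : 0 ≤ s.real 10 x := hnonneg r hr x (List.mem_of_getElem? hx)
    have hxm : s.nat 40 (s.nat 44 r + s.nat 31 r - 1) = x := by
      rw [he]
      exact hl.elem r hr e x hx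
    set d' := Function.update (s.nat 31) r e with hd'
    have hq' : enc sq R d' + stride sq r = q := by
      have := enc_update (sq := sq) (d := s.nat 31) hr e
      rw [← hd', he, henc, Nat.add_mul, one_mul] at this
      omega
    have hpos := stride_pos (sq := sq) r
    have hgood : Good sq R s d' (enc sq R d') := htab d' (fun r' hr' => by
      by_cases hrr : r' = r
      · subst hrr; rw [hd', Function.update_self]; omega
      · rw [hd', Function.update_of_ne hrr]; exact hd r' hr') (by omega)
    have hsub : q - s.nat 28 r = enc sq R d' := by rw [hl.weight r hr.le]; omega
    simp only [block, Prog.wp, NExp.eval, RExp.eval, Test.Holds, State.nat_setNat_same, ne_eq,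
      State.nat_setReal, State.real_setReal_same, State.real_setReal_of_ne,
      Nat.reduceEqDiff, not_false_eq_true, State.nat_setNat_of_ne, State.real_setNat,
      Function.update_self, hrv, hqv, hxm, hsub]
    have hcand := fun L' => hgood.le_cons (x := x) hxn (L' := L')
    obtain ⟨L, hL, hLe, hLmin⟩ := hgood
    set q' := enc sq R d' with hq'def
    set nb := s.real 25 q' * s.real 9 x + s.real 26 q' * s.real 10 x with hnb
    refine ⟨fun hk => ?_, fun hk => ?_⟩
    · -- The old entry is at least as good.
      have hst : SameTable s (((s.setNat 43 0 x).setNat 42 0 q').setReal 24 0 nb) q := by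
        constructor <;> intros <;> simp
      refine ⟨.inr ?_, fun _ => hst.mono (Nat.sub_le _ _)⟩
      rcases h with ⟨h₁, h₂, h₃⟩ | ⟨h₁, L, h₂, h₃, h₄⟩
      · omega
      · refine ⟨by simpa using h₁, L, h₂, h₃.congr hst, fun r' hr' e₁ x₁ L' he₁ hx₁ hL' => ?_⟩
        rw [hst.r8, hst.r9, hst.r10, hst.r26 q le_rfl]
        rcases Nat.lt_succ_iff_lt_or_eq.1 hr' with hr' | rfl
        · exact h₄ r' hr' e₁ x₁ L' he₁ hx₁ hL'
        · obtain rfl : e₁ = e := by omega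
          rw [hx] at hx₁
          cases hx₁
          exact hk.2.trans (hcand L' hL')
    · -- The new candidate is better, or it is the first one.
      set s' := (((((((s.setNat 43 0 x).setNat 42 0 q').setReal 24 0 nb).setReal 25 q
        (s.real 8 x * s.real 25 q')).setReal 26 q nb).setNat 35 q x).setNat 36 q q').setNat 37 0 1
        with hs'
      have hst : SameTable s s' (q - 1) := by
        constructor
        · simp [hs']
        · simp [hs']
        · simp [hs']
        all_goals
          intro i hi
          have : i ≠ q := by omega
          simp [hs', this]
      have e25 : s'.real 25 q = s.real 8 x * s.real 25 q' := by simp [hs']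
      have e26 : s'.real 26 q = nb := by simp [hs']
      refine ⟨.inr ⟨by simp [hs'], x :: L, ⟨r, hr, e, he, hx, hL⟩, ⟨?_, ?_, ?_⟩, ?_⟩,
        fun _ => hst⟩
      · rw [e25, hst.r8, List.map_cons, List.prod_cons, hLe.prod]
      · rw [e26, hst.r8, hst.r9, hst.r10, offDiag_cons, hnb, hLe.prod, hLe.off]
      · refine ⟨by simp [hs'], by simp [hs']; omega, ?_⟩
        have e36 : s'.nat 36 q = q' := by simp [hs']
        rw [e36]
        have hst' := hst.mono (q' := q') (by omega)
        exact hLe.trace.congr hst'.n35 hst'.n36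
      · intro r' hr' e₁ x₁ L' he₁ hx₁ hL'
        rw [hst.r8, hst.r9, hst.r10, e26]
        rcases Nat.lt_succ_iff_lt_or_eq.1 hr' with hr' | rfl
        · rcases h with ⟨h₁, h₂, h₃⟩ | ⟨h₁, L, h₂, h₃, h₄⟩
          · have := h₃ r' hr'
            omega
          · refine le_trans ?_ (h₄ r' hr' e₁ x₁ L' he₁ hx₁ hL')
            by_contra hlt
            exact hk ⟨h₁.ge, (not_le.1 hlt).le⟩
        · obtain rfl : e₁ = e := by omega
          rw [hx] at hx₁
          cases hx₁
          exact hcand L' hL'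

/-- Increases the digit number `r` of a mixed radix number if there is a carry. -/
def carryStep : Prog :=
  .ite (.natLe (.lit 1) (nvar 38))
    (.ite (.natLe (.add (nat_ 31 24) (.lit 1)) (nat_ 45 24))
      (block [.setNat 31 (nvar 24) (.add (nat_ 31 24) (.lit 1)), letNat 38 (.lit 0)])
      (.setNat 31 (nvar 24) (.lit 0)))
    .skip

/-- Increases the mixed radix number by one. -/
def carryProg : Prog := .seq (letNat 38 (.lit 1)) (forLoop 24 (nvar 30) carryStep)

lemma ends_carryProg {sq : ℕ → List ℕ} {R : ℕ} {s : State} (hl : Layout sq R s)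
    (hd : ∀ r < R, s.nat 31 r ≤ (sq r).length) :
    carryProg.Ends (60 * (R + 1)) s fun s' => enc sq R (s.nat 31) + 1 < stride sq R →
      enc sq R (s'.nat 31) = enc sq R (s.nat 31) + 1 ∧ ∀ r < R, s'.nat 31 r ≤ (sq r).length := by
  refine Prog.Ends.seq (T₁ := 10) (T₂ := 60 * R + 30) (Prog.ends_of_wp (Q := fun s' =>
    s'.nat 38 0 = 1) (by simp) (by decide) |>.mono le_rfl ?_) (by omega)
  intro s₁ hF h38
  refine ends_forLoop_const R 40 (fun r s' => s'.nat 38 0 ≤ 1 ∧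
    (∀ r < R, s'.nat 31 r ≤ (sq r).length) ∧
    enc sq R (s'.nat 31) + s'.nat 38 0 * stride sq r = enc sq R (s.nat 31) + 1)
    (by decide) ?_ ?_ ?_ ?_ ?_
  · refine ⟨by simp [h38], ?_, ?_⟩
    · simpa [hF.nat 31 (by decide)] using hd
    · simp [h38, hF.nat 31 (by decide), stride]
  · intro r s' _ hF' _ _
    rw [NExp.eval, NExp.eval, hF'.nat 30 (by decide), hF.nat 30 (by decide), hl.count]
  · rintro r s' hr hF' h24 ⟨h₁, h₂, h₃⟩
    have h45 : s'.nat 45 r = (sq r).length := by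
      rw [hF'.nat 45 (by decide), hF.nat 45 (by decide), hl.length r hr]
    refine Prog.ends_of_wp ?_ (by decide)
    simp only [carryStep, block, Prog.wp, NExp.eval, Test.Holds, h24, h45]
    have hv : ∀ x ≤ (sq r).length, ∀ r' < R, Function.update (s'.nat 31) r x r' ≤
        (sq r').length := by
      intro x hx r' hr'
      by_cases hrr : r' = r
      · subst hrr; rwa [Function.update_self]
      · rw [Function.update_of_ne hrr]; exact h₂ r' hr'
    refine ⟨fun hc => ⟨fun hle => ?_, fun hle => ?_⟩, fun hc => ?_⟩
    · obtain hc : s'.nat 38 0 = 1 := by omega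
      have := enc_update (sq := sq) (d := s'.nat 31) hr (s'.nat 31 r + 1)
      rw [Nat.add_mul] at this
      simp only [State.nat_setNat_same, ne_eq, Nat.reduceEqDiff, not_false_eq_true,
        State.nat_setNat_of_ne, Function.update_self, zero_mul]
      rw [hc] at h₃
      exact ⟨by omega, hv _ hle, by omega⟩
    · obtain hc : s'.nat 38 0 = 1 := by omega
      have h31 : s'.nat 31 r = (sq r).length := by have := h₂ r hr; omega
      have := enc_update (sq := sq) (d := s'.nat 31) hr 0
      simp only [State.nat_setNat_same, ne_eq, Nat.reduceEqDiff, not_false_eq_true,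
        State.nat_setNat_of_ne]
      rw [hc] at h₃
      refine ⟨h₁, hv _ (Nat.zero_le _), ?_⟩
      rw [h31, zero_mul] at this
      rw [hc, stride, Nat.mul_add, mul_one, mul_comm (stride sq r)]
      omega
    · obtain hc : s'.nat 38 0 = 0 := by omega
      rw [hc] at h₃
      simp only [ne_eq, Nat.reduceEqDiff, not_false_eq_true, State.nat_setNat_of_ne, hc]
      exact ⟨by omega, h₂, by omega⟩
  · rintro s' _ _ ⟨h₁, h₂, h₃⟩ hlt
    refine ⟨?_, h₂⟩
    rcases Nat.eq_zero_or_pos (s'.nat 38 0) with h0 | h0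
    · rw [h0] at h₃; omega
    · have := Nat.mul_le_mul_right (stride sq R) h0
      omega
  · simp only [NExp.cost]
    omega

/-- Computes the entry of the table at the position 29, of which the digits are in the array `31`, and
passes to the next digits. -/
def tableStep : Prog := .seq
  (block [.setReal 25 (nvar 29) (.lit 1), .setReal 26 (nvar 29) (.lit 0), letNat 37 (.lit 0)])
  (.seq (forLoop 24 (nvar 30) relaxStep) carryProg)

/-- The entries of the table before the position `q` are correct. -/
def TableInv (sq : ℕ → List ℕ) (R q : ℕ) (s : State) : Prop :=
  ∀ d, (∀ r < R, d r ≤ (sq r).length) → enc sq R d < q → Good sq R s d (enc sq R d)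

lemma ends_tableStep {sq : ℕ → List ℕ} {R : ℕ} {s : State} {q : ℕ} (hl : Layout sq R s)
    (hqv : s.nat 29 0 = q) (hd : ∀ r < R, s.nat 31 r ≤ (sq r).length)
    (henc : enc sq R (s.nat 31) = q) (hnonneg : ∀ r < R, ∀ x ∈ sq r, 0 ≤ s.real 10 x)
    (htab : TableInv sq R q s) :
    tableStep.Ends (250 * (R + 1)) s fun s' => TableInv sq R (q + 1) s' ∧
      (q + 1 < stride sq R → enc sq R (s'.nat 31) = q + 1 ∧
        ∀ r < R, s'.nat 31 r ≤ (sq r).length) := by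
  refine Prog.Ends.seq (T₁ := 20) (T₂ := 250 * R + 100) (Prog.ends_of_wp (Q := fun s' =>
    s' = ((s.setReal 25 q 1).setReal 26 q 0).setNat 37 0 0) (by simp [hqv]) (by decide)
      |>.mono le_rfl ?_) (by omega)
  intro s₁ hF₁ hs₁
  have hT₁ : ∀ i < q, SameTable s s₁ i := by
    intro i hi
    constructor
    · simp [hs₁]
    · simp [hs₁]
    · simp [hs₁]
    all_goals
      intro j hj
      have : j ≠ q := by omega
      simp [hs₁, this]
  have e31 : s₁.nat 31 = s.nat 31 := hF₁.nat 31 (by decide)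
  have hL₁ : ∀ s', Frame (forLoop 24 (nvar 30) relaxStep) s₁ s' → Layout sq R s' := by
    intro s' hF
    refine hl.congr fun a ha => ?_
    rw [hF.nat a (by revert a; decide), hF₁.nat a (by revert a; decide)]
  have htab₁ : TableInv sq R q s₁ := fun d hd hlt => (htab d hd hlt).congr (hT₁ _ hlt)
  refine Prog.Ends.seq (T₁ := 180 * R + 20) (T₂ := 60 * R + 60) ?_ (by omega)
  refine ends_forLoop_const R 150 (fun r s' => RelaxInv sq R (s.nat 31) q r s' ∧
    TableInv sq R q s') (by decide) ?_ ?_ ?_ ?_ ?_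
  · refine ⟨.inl ⟨by simp [hs₁], ⟨?_, ?_, trivial⟩, by simp⟩, ?_⟩
    · simp [hs₁]
    · simp [hs₁]
    · exact fun d hd hlt => (htab₁ d hd hlt).congr (.setNat _ _ _ _ _ (by decide))
  · intro r s' _ hF _ _
    exact (hL₁ s' hF).count
  · rintro r s' hr hF h24 ⟨h, ht⟩
    have e31' : s'.nat 31 = s.nat 31 := by rw [hF.nat 31 (by decide), e31]
    rw [← e31'] at h ⊢ hd henc
    refine (ends_relaxStep (hL₁ s' hF) hr h24 ?_ hd henc ?_ ht h).mono le_rfl ?_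
    · rw [hF.nat 29 (by decide), hF₁.nat 29 (by decide), hqv]
    · rw [hF.real 10 (by decide), hF₁.real 10 (by decide)]
      exact hnonneg
    · rintro s₂ - ⟨h₂, hst⟩
      have hset := SameTable.setNat s₂ 24 0 (r + 1) q (by decide)
      constructor
      · rcases h₂ with ⟨h₁, h₂, h₃⟩ | ⟨h₁, L, h₂, h₃, h₄⟩
        · exact .inl ⟨by simpa using h₁, h₂.congr hset, h₃⟩
        · refine .inr ⟨by simpa using h₁, L, h₂, h₃.congr hset, ?_⟩
          simpa using h₄
      · intro d hd hlt
        exact ((ht d hd hlt).congr ((hst (by omega)).mono (by omega))).congr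
          (hset.mono hlt.le)
  · rintro s₂ hF - ⟨h, ht⟩
    have e31' : s₂.nat 31 = s.nat 31 := by rw [hF.nat 31 (by decide), e31]
    have hgood : Good sq R s₂ (s.nat 31) q := by
      rcases h with ⟨-, h₂, h₃⟩ | ⟨-, L, h₂, h₃, h₄⟩
      · refine ⟨[], h₃, h₂, fun L' hL' => ?_⟩
        have : L'.Perm [] := hL'.perm (L := L') (L' := []) h₃
        rw [this.eq_nil, h₂.off]
      · refine ⟨L, h₂, h₃, fun L' hL' => ?_⟩
        cases L' with
        | nil =>
          have : L.Perm [] := h₂.perm hL'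
          rw [h₃.off, this.eq_nil]
        | cons x L' =>
          obtain ⟨r, hr, e, he, hx, hL'⟩ := hL'
          exact h₄ r hr e x L' he hx hL'
    rw [← e31'] at hd henc
    refine (ends_carryProg (hL₁ s₂ hF) hd).mono (by omega) ?_
    intro s₃ hF₃ h₃
    rw [henc] at h₃
    refine ⟨fun d hd' hlt => ?_, h₃⟩
    have hst := SameTable.of_frame hF₃ (enc sq R d) (by decide) (by decide)
    refine Good.congr ?_ hst
    rcases Nat.lt_succ_iff_lt_or_eq.1 hlt with hlt | heq
    · exact ht d hd' hlt
    · have hdd := enc_inj hd' hd (heq.trans henc.symm)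
      rw [e31'] at hdd
      obtain ⟨L, h₁, h₂, h₄⟩ := hgood
      rw [heq]
      exact ⟨L, h₁.congr fun r hr => (hdd r hr).symm, h₂, fun L' hL' => h₄ L' (hL'.congr hdd)⟩
  · simp only [NExp.cost]
    omega

/-- Computes the table, in the order of the positions. -/
def tableProg : Prog := .seq
  (forLoop 24 (nvar 30) (.setNat 31 (nvar 24) (.lit 0)))
  (forLoop 29 (.get 28 (nvar 30)) tableStep)

/-- The last entry of the table describes a best complete interleaving. -/
lemma ends_tableProg {sq : ℕ → List ℕ} {R : ℕ} {s : State} (hl : Layout sq R s)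
    (hnonneg : ∀ r < R, ∀ x ∈ sq r, 0 ≤ s.real 10 x) :
    tableProg.Ends (400 * ((R + 1) * stride sq R)) s fun s' =>
      Good sq R s' (fun r => (sq r).length) (stride sq R - 1) ∧ s'.nat 29 0 = stride sq R := by
  have hpos := stride_pos (sq := sq) R
  have hR : R + 1 ≤ (R + 1) * stride sq R := Nat.le_mul_of_pos_right _ hpos
  refine Prog.Ends.seq (T₁ := 30 * R + 20) (T₂ := 300 * ((R + 1) * stride sq R) + 20) ?_
    (by omega)
  refine ends_forLoop_const R 10 (fun r s' => ∀ r' < r, s'.nat 31 r' = 0) (by decide) (by simp)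
    ?_ ?_ ?_ ?_
  · intro r s' _ hF _ _
    rw [NExp.eval, NExp.eval, hF.nat 30 (by decide), hl.count]
  · intro r s' _ _ h24 h
    refine Prog.ends_of_wp ?_ (by decide)
    intro r' hr'
    rcases Nat.lt_succ_iff_lt_or_eq.1 hr' with hr' | rfl
    · simpa [h24, hr'.ne] using h r' hr'
    · simp [h24]
  · intro s₁ hF₁ _ h31
    have hL₁ : ∀ s', Frame (forLoop 29 (.get 28 (nvar 30)) tableStep) s₁ s' → Layout sq R s' := by
      intro s' hF
      refine hl.congr fun a ha => ?_
      rw [hF.nat a (by revert a; decide), hF₁.nat a (by revert a; decide)]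
    refine ends_forLoop_const (stride sq R) (250 * (R + 1)) (fun q s' => TableInv sq R q s' ∧
      (q < stride sq R → enc sq R (s'.nat 31) = q ∧ ∀ r < R, s'.nat 31 r ≤ (sq r).length))
      (by decide) ?_ ?_ ?_ ?_ ?_
    · refine ⟨fun d _ h => absurd h (Nat.not_lt_zero _), fun _ => ⟨?_, fun r hr => ?_⟩⟩
      · refine Finset.sum_eq_zero fun r hr => ?_
        simp [h31 r (Finset.mem_range.1 hr)]
      · simp [h31 r hr]
    · intro q s' _ hF _ _
      have := hL₁ s' hF
      rw [NExp.eval, NExp.eval, NExp.eval, this.count, this.weight R le_rfl]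
    · rintro q s' hq hF h29 ⟨ht, hd⟩
      refine (ends_tableStep (hL₁ s' hF) h29 (hd hq).2 (hd hq).1 ?_ ht).mono le_rfl ?_
      · rw [hF.real 10 (by decide), hF₁.real 10 (by decide)]
        exact hnonneg
      · rintro s₂ - ⟨h₁, h₂⟩
        refine ⟨fun d hd hlt => (h₁ d hd hlt).congr (.setNat _ _ _ _ _ (by decide)), ?_⟩
        simpa using h₂
    · rintro s' _ h29 ⟨ht, -⟩
      refine ⟨?_, h29⟩
      have hlast : ∀ R, enc sq R (fun r => (sq r).length) + 1 = stride sq R := by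
        intro R
        induction R with
        | zero => simp [enc, stride]
        | succ R ih =>
          rw [enc, Finset.sum_range_succ, stride, Nat.mul_add, mul_one, ← ih]
          unfold enc
          ring
      have := hlast R
      have h := ht _ (fun _ _ => le_rfl) (by omega : enc sq R (fun r => (sq r).length) < _)
      rwa [show enc sq R (fun r => (sq r).length) = stride sq R - 1 by omega] at h
    · simp only [NExp.cost]
      have e : stride sq R * (250 * (R + 1) + (1 + 1 + 1) + 11) =
        250 * ((R + 1) * stride sq R) + 14 * stride sq R := by ring
      have : stride sq R ≤ (R + 1) * stride sq R := Nat.le_mul_of_pos_left _ (by omega)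
      omega
  · simp only [NExp.cost]
    omega

/-! ### The layout of the sequences -/

lemma getElem_mem_block {K : List ℕ} (hn : K.Nodup) {i α β : ℕ} (hi : i < K.length) :
    K[i] ∈ (K.take β).drop α ↔ α ≤ i ∧ i < β := by
  rw [List.mem_iff_getElem]
  constructor
  · rintro ⟨j, hj, h⟩
    rw [List.getElem_drop, List.getElem_take, hn.getElem_inj_iff] at h
    simp only [List.length_drop, List.length_take] at hj
    omega
  · rintro ⟨h₁, h₂⟩
    refine ⟨i - α, by simp; omega, ?_⟩
    rw [List.getElem_drop, List.getElem_take]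
    congr 1
    omega

/-- Reduces the position in the natural array `18` modulo the length of the list. -/
def wrap : Prog := .ite (.natLe (nvar 4) (nvar 18)) (letNat 18 (.sub (nvar 18) (nvar 4))) .skip

/-- The position in the natural array `18` belongs to the block. -/
def inBlock : Test := .and (.natLe (nvar 22) (nvar 18)) (.not (.natLe (nvar 23) (nvar 18)))

/-- Appends an element to the natural array `40`. -/
def push : Prog := block [.setNat 40 (nvar 41) (nat_ 16 18), letNat 41 (.add (nvar 41) (.lit 1))]

/-- The state contains the parameters of a structured ordering. -/
structure Params (s : State) (p k m l α β : ℕ) : Prop where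
  p : s.nat 4 0 = p
  k : s.nat 5 0 = k
  m : s.nat 20 0 = m
  l : s.nat 21 0 = l
  α : s.nat 22 0 = α
  β : s.nat 23 0 = β

lemma Params.frame {s s' : State} {p k m l α β : ℕ} {c : Prog} (h : Params s p k m l α β)
    (hF : Frame c s s') (hc : ∀ a ∈ [4, 5, 20, 21, 22, 23], a ∉ c.natWrites) :
    Params s' p k m l α β := by
  have e : ∀ a ∈ [4, 5, 20, 21, 22, 23], s'.nat a = s.nat a := fun a ha => hF.nat a (hc a ha)
  constructor
  all_goals rw [e _ (by decide)]
  exacts [h.p, h.k, h.m, h.l, h.α, h.β]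

/-- Appends the element at the position `e`, taken modulo the length of the list, if it passes the
test. -/
def selectStep (e : NExp) (b : Test) : Prog := .seq (letNat 18 e) (.seq wrap (.ite b push .skip))

lemma wrap_eq {p j : ℕ} (h : j < 2 * p) : (if p ≤ j then j - p else j) = j % p := by
  split_ifs with hp
  · rw [Nat.mod_eq_sub_mod hp, Nat.mod_eq_of_lt (by omega)]
  · rw [Nat.mod_eq_of_lt (by omega)]

lemma wp_wrap {s : State} {Q : State → Prop} {p j : ℕ} (h4 : s.nat 4 0 = p) (hj : s.nat 18 0 = j)
    (hlt : j < 2 * p)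
    (h : ∀ s', s'.real = s.real → (∀ a ≠ 18, s'.nat a = s.nat a) → s'.nat 18 0 = j % p → Q s') :
    wrap.wp Q s := by
  simp only [wrap, Prog.wp, Test.Holds, NExp.eval, h4, hj]
  refine ⟨fun hp => h _ rfl (fun a ha => by simp [ha]) ?_, fun hp => h s rfl (fun _ _ => rfl) ?_⟩
  · rw [State.nat_setNat_same, Function.update_self, ← wrap_eq hlt, if_pos hp]
  · rw [hj, ← wrap_eq hlt, if_neg hp]

open Classical in
lemma ends_selectStep {s : State} {e : NExp} {b : Test} {p j T : ℕ} {cond : ℕ → Prop}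
    (h4 : s.nat 4 0 = p) (he : e.eval s = j) (hj : j < 2 * p)
    (hb : ∀ s' : State, s'.nat 22 = s.nat 22 → s'.nat 23 = s.nat 23 → s'.nat 18 0 = j % p →
      (b.Holds s' ↔ cond (s.nat 16 (j % p)))) (hT : (selectStep e b).steps ≤ T) :
    (selectStep e b).Ends T s fun s' => seg (s'.nat 40) 0 (s'.nat 41 0) =
      seg (s.nat 40) 0 (s.nat 41 0) ++ [s.nat 16 (j % p)].filter (cond ·) := by
  refine Prog.ends_of_wp ?_ hT
  simp only [selectStep, Prog.wp, he, NExp.eval]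
  refine wp_wrap (p := p) (j := j) (by simp [h4]) (by simp) hj fun s' hr hn h18 => ?_
  have e4 : ∀ a, a ≠ 18 → s'.nat a = s.nat a := fun a ha => by rw [hn a ha]; simp [ha]
  have hb' := hb s' (e4 22 (by decide)) (e4 23 (by decide)) h18
  rw [hb']
  refine ⟨fun hc => ?_, fun hc => ?_⟩
  · have u := seg_update_concat (s.nat 40) 0 (s.nat 41 0) (s.nat 16 (j % p))
    rw [zero_add] at u
    simp [push, h18, e4, hc, u]
  · simp [e4, hc]

/-- Writes the sequences to the natural array `40`, their positions to `44`, and their lengths to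
`45`. -/
def fillProg : Prog := .seq (letNat 41 (.lit 0))
  (.seq (forLoop 24 (nvar 4)
    (selectStep (.sub (.sub (.add (nvar 20) (nvar 4)) (.lit 1)) (nvar 24)) (.not inBlock)))
  (.seq (block [letNat 44 (.lit 0), letNat 45 (nvar 41), .setNat 44 (.lit 1) (nvar 41)])
  (.seq (forLoop 24 (nvar 4) (selectStep (.add (nvar 21) (nvar 24)) inBlock))
  (.seq (.setNat 45 (.lit 1) (.sub (nvar 41) (nvar 45)))
  (.seq (forLoop 24 (nvar 5) (block [
    .setNat 40 (nvar 41) (nat_ 8 24),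
    .setNat 45 (.add (nvar 24) (.lit 2)) (.lit 1),
    .setNat 44 (.add (nvar 24) (.lit 2)) (nvar 41),
    letNat 41 (.add (nvar 41) (.lit 1))]))
  (letNat 30 (.add (nvar 5) (.lit 2))))))))

lemma ends_fillProg {s₀ : State} {p k m l α β : ℕ} {K negs : List ℕ}
    (hp : Params s₀ p k m l α β) (hK : seg (s₀.nat 16) 0 p = K) (hN : seg (s₀.nat 8) 0 k = negs)
    (hnd : K.Nodup) (hm : m ≤ p) (hl : l ≤ p) :
    fillProg.Ends (250 * (p + k + 1)) s₀ fun s => s.nat 30 0 = k + 2 ∧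
      (∀ r < k + 2, ∀ e x, (seqs K negs m l α β r)[e]? = some x →
        s.nat 40 (s.nat 44 r + e) = x) ∧
      ∀ r < k + 2, s.nat 45 r = (seqs K negs m l α β r).length := by
  have hKlen : K.length = p := by rw [← hK, length_seg]
  have hNlen : negs.length = k := by rw [← hN, length_seg]
  have hKget : ∀ i (hi : i < K.length), s₀.nat 16 i = K[i] := by
    intro i hi
    subst hK
    rw [getElem_seg, zero_add]
  have hmemb : ∀ (s : State) (i : ℕ), s.nat 22 0 = α → s.nat 23 0 = β → s.nat 18 0 = i → i < p →
      (inBlock.Holds s ↔ s₀.nat 16 i ∈ (K.take β).drop α) := by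
    intro s i hα hβ h18 hi
    rw [hKget i (by omega), getElem_mem_block hnd]
    simp [inBlock, hα, hβ, h18]
  set P := (K.take β).drop α with hP
  refine Prog.Ends.seq (T₁ := 10) (T₂ := 250 * p + 250 * k + 200) (Prog.ends_of_wp (Q := fun s =>
    s.nat 41 0 = 0) (by simp) (by decide) |>.mono le_rfl ?_) (by omega)
  intro s₁ hF₁ h41
  refine Prog.Ends.seq (T₁ := 100 * p + 10) (T₂ := 150 * p + 250 * k + 150) ?_ (by omega)
  refine ends_forLoop_const p 85 (fun t s => seg (s.nat 40) 0 (s.nat 41 0) =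
    (((K.rotate m).drop (p - t)).filter (· ∉ P)).reverse) (by decide) ?_ ?_ ?_ ?_ ?_
  · rw [Nat.sub_zero, List.drop_of_length_le (by simp [hKlen])]
    simp [h41]
  · intro t s _ hF _ _
    rw [NExp.eval, NExp.eval, hF.nat 4 (by decide), hF₁.nat 4 (by decide), hp.p]
  · intro t s ht hF h24 h
    have hp₁ := (hp.frame hF₁ (by decide)).frame hF (by decide)
    have e16 : s.nat 16 = s₀.nat 16 := by rw [hF.nat 16 (by decide), hF₁.nat 16 (by decide)]
    refine (ends_selectStep (cond := (· ∉ P)) (j := m + p - 1 - t) hp₁.p ?_ (by omega) ?_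
      (by decide)).mono le_rfl ?_
    · simp [hp₁.m, hp₁.p, h24]
    · intro s' h22 h23 h18
      rw [Test.Holds, e16, hmemb s' _ (by rw [h22, hp₁.α]) (by rw [h23, hp₁.β]) h18
        (Nat.mod_lt _ (by omega))]
    · intro s' _ h'
      simp only [State.nat_setNat_of_ne _ _ _ (show 40 ≠ 24 by decide),
        State.nat_setNat_of_ne _ _ _ (show 41 ≠ 24 by decide)]
      have hlt : p - (t + 1) < (K.rotate m).length := by rw [List.length_rotate, hKlen]; omega
      rw [h', h, List.drop_eq_getElem_cons hlt, show p - (t + 1) + 1 = p - t by omega,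
        List.getElem_rotate, e16, hKget _ (by rw [hKlen]; exact Nat.mod_lt _ (by omega))]
      have ej : (p - (t + 1) + m) % K.length = (m + p - 1 - t) % p := by
        rw [hKlen]; congr 1; omega
      simp only [ej]
      by_cases hx : K[(m + p - 1 - t) % p]'(by rw [hKlen]; exact Nat.mod_lt _ (by omega)) ∈ P <;>
        simp [hx]
  swap
  · simp only [NExp.cost]
    omega
  intro s₂ hF₂ _ h₂
  rw [Nat.sub_self, List.drop_zero] at h₂
  set X := seqs K negs m l α β 0 with hX
  change seg (s₂.nat 40) 0 (s₂.nat 41 0) = X at h₂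
  have hu : s₂.nat 41 0 = X.length := by rw [← h₂, length_seg]
  refine Prog.Ends.seq (T₁ := 20) (T₂ := 150 * p + 250 * k + 130) (Prog.ends_of_wp (Q := fun s =>
    s.nat 44 0 = 0 ∧ s.nat 44 1 = X.length ∧ s.nat 45 0 = X.length) (by simp [hu])
    (by decide) |>.mono le_rfl ?_) (by omega)
  intro s₃ hF₃ h₃
  refine Prog.Ends.seq (T₁ := 100 * p + 10) (T₂ := 250 * k + 120) ?_ (by omega)
  refine ends_forLoop_const p 85 (fun t s => seg (s.nat 40) 0 (s.nat 41 0) =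
    X ++ ((K.rotate l).take t).filter (· ∈ P)) (by decide) ?_ ?_ ?_ ?_ ?_
  · simp [hF₃.nat 40 (by decide), hF₃.nat 41 (by decide), h₂]
  · intro t s _ hF _ _
    rw [NExp.eval, NExp.eval, hF.nat 4 (by decide), hF₃.nat 4 (by decide), hF₂.nat 4 (by decide),
      hF₁.nat 4 (by decide), hp.p]
  · intro t s ht hF h24 h
    have hp₁ := (((hp.frame hF₁ (by decide)).frame hF₂ (by decide)).frame hF₃ (by decide)).frame hF
      (by decide)
    have e16 : s.nat 16 = s₀.nat 16 := by
      rw [hF.nat 16 (by decide), hF₃.nat 16 (by decide), hF₂.nat 16 (by decide),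
        hF₁.nat 16 (by decide)]
    refine (ends_selectStep (cond := (· ∈ P)) (j := l + t) hp₁.p ?_ (by omega) ?_
      (by decide)).mono le_rfl ?_
    · simp [hp₁.l, h24]
    · intro s' h22 h23 h18
      rw [e16, hmemb s' _ (by rw [h22, hp₁.α]) (by rw [h23, hp₁.β]) h18
        (Nat.mod_lt _ (by omega))]
    · intro s' _ h'
      simp only [State.nat_setNat_of_ne _ _ _ (show 40 ≠ 24 by decide),
        State.nat_setNat_of_ne _ _ _ (show 41 ≠ 24 by decide)]
      have hlt : t < (K.rotate l).length := by rw [List.length_rotate, hKlen]; omega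
      rw [h', h, ← List.take_append_getElem hlt, List.getElem_rotate, e16,
        hKget _ (by rw [hKlen]; exact Nat.mod_lt _ (by omega)), List.filter_append,
        List.append_assoc]
      have ej : (t + l) % K.length = (l + t) % p := by
        rw [hKlen, add_comm]
      simp only [ej]
      by_cases hx : K[(l + t) % p]'(by rw [hKlen]; exact Nat.mod_lt _ (by omega)) ∈ P <;>
        simp [hx]
  swap
  · simp only [NExp.cost]
    omega
  intro s₄ hF₄ _ h₄
  rw [List.take_of_length_le (by rw [List.length_rotate, hKlen])] at h₄
  set Y := seqs K negs m l α β 1 with hY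
  change seg (s₄.nat 40) 0 (s₄.nat 41 0) = X ++ Y at h₄
  have hv : s₄.nat 41 0 = X.length + Y.length := by
    rw [← List.length_append, ← h₄, length_seg]
  refine Prog.Ends.seq (T₁ := 20) (T₂ := 250 * k + 100) (Prog.ends_of_wp (Q := fun s =>
    s.nat 45 0 = X.length ∧ s.nat 45 1 = Y.length) (by
      simp [hv, hF₄.nat 45 (by decide), h₃]) (by decide) |>.mono le_rfl ?_) (by omega)
  intro s₅ hF₅ h₅
  refine Prog.Ends.seq (T₁ := 100 * k + 10) (T₂ := 50) ?_ (by omega)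
  have e44 : s₅.nat 44 = s₃.nat 44 := by rw [hF₅.nat 44 (by decide), hF₄.nat 44 (by decide)]
  have hF₆ : ∀ {c : Prog} {s}, Frame c s₅ s → (∀ a ∈ [4, 5, 20, 21, 22, 23], a ∉ c.natWrites) →
      Params s p k m l α β := fun hF hc =>
    (((((hp.frame hF₁ (by decide)).frame hF₂ (by decide)).frame hF₃ (by decide)).frame hF₄
      (by decide)).frame hF₅ (by decide)).frame hF hc
  refine ends_forLoop_const k 60 (fun t s => s.nat 41 0 = X.length + Y.length + t ∧
    seg (s.nat 40) 0 (X.length + Y.length + t) = X ++ Y ++ seg (s₀.nat 8) 0 t ∧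
    (s.nat 44 0 = 0 ∧ s.nat 44 1 = X.length) ∧ (s.nat 45 0 = X.length ∧ s.nat 45 1 = Y.length) ∧
    ∀ r < t, s.nat 44 (r + 2) = X.length + Y.length + r ∧ s.nat 45 (r + 2) = 1)
    (by decide) ?_ ?_ ?_ ?_ ?_
  · refine ⟨?_, ?_, ?_, ?_, by simp⟩
    · simp [hF₅.nat 41 (by decide), hv]
    · simp [hF₅.nat 40 (by decide), ← hv, h₄]
    · simp [e44, h₃]
    · simp [h₅]
  · intro t s _ hF _ _
    rw [NExp.eval, NExp.eval, (hF₆ hF (by decide)).k]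
  · rintro t s ht hF h24 ⟨g₁, g₂, g₃, g₄, g₅⟩
    have e8 : s.nat 8 = s₀.nat 8 := by
      rw [hF.nat 8 (by decide), hF₅.nat 8 (by decide), hF₄.nat 8 (by decide),
        hF₃.nat 8 (by decide), hF₂.nat 8 (by decide), hF₁.nat 8 (by decide)]
    refine Prog.ends_of_wp ?_ (by decide)
    have u := seg_update_concat (s.nat 40) 0 (X.length + Y.length + t) (s₀.nat 8 t)
    rw [zero_add] at u
    refine ⟨?_, ?_, ?_, ?_, ?_⟩
    · simp [g₁, add_assoc]
    · rw [← add_assoc, seg_concat (s₀.nat 8), ← List.append_assoc, ← g₂, zero_add, ← u]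
      simp [g₁, h24, e8]
    · simpa [h24] using g₃
    · simpa [h24] using g₄
    · intro r hr
      rcases Nat.lt_succ_iff_lt_or_eq.1 hr with hr | rfl
      · simpa [h24, hr.ne] using g₅ r hr
      · simp [h24, g₁]
  · rintro s₆ hF _ ⟨g₁, g₂, g₃, g₄, g₅⟩
    refine Prog.ends_of_wp ?_ (by decide)
    have hk := (hF₆ hF (by decide)).k
    have hZ : ∀ i (hi : i < (X ++ Y ++ negs).length), s₆.nat 40 i = (X ++ Y ++ negs)[i] := by
      rw [hN] at g₂
      have hlen : (X ++ Y ++ negs).length = X.length + Y.length + k := by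
        simp [hNlen, add_assoc]
      rw [← hlen, seg_eq_iff] at g₂
      simpa using g₂
    simp only [Prog.wp, NExp.eval, hk, State.nat_setNat_same, Function.update_self, ne_eq,
      Nat.reduceEqDiff, not_false_eq_true, State.nat_setNat_of_ne]
    refine ⟨trivial, ?_, ?_⟩
    · intro r hr e x hx
      rcases r with _ | _ | r
      · obtain ⟨he, hx⟩ := List.getElem?_eq_some_iff.1 hx
        change e < X.length at he
        rw [g₃.1, zero_add, hZ e (by simp; omega), ← hx,
          List.getElem_append_left (by simp; omega), List.getElem_append_left he]
      · obtain ⟨he, hx⟩ := List.getElem?_eq_some_iff.1 hx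
        change e < Y.length at he
        rw [zero_add, g₃.2, hZ (X.length + e) (by simp; omega), ← hx, List.getElem_append_left
          (by simp; omega), List.getElem_append_right (by omega)]
        simp only [Nat.add_sub_cancel_left]
        rfl
      · have hr' : r < negs.length := by omega
        simp only [seqs, List.getElem?_eq_getElem hr', Option.toList_some] at hx
        obtain ⟨he, hx⟩ := List.getElem?_eq_some_iff.1 hx
        obtain rfl : e = 0 := by simpa using he
        rw [(g₅ r (by omega)).1, hZ _ (by simp; omega), ← hx, List.getElem_append_right
          (by simp)]
        simp
    · intro r hr
      rcases r with _ | _ | r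
      · exact g₄.1
      · exact g₄.2
      · have hr' : r < negs.length := by omega
        rw [(g₅ r (by omega)).2]
        simp [seqs, List.getElem?_eq_getElem hr']
  · simp only [NExp.cost]
    omega

/-- Computes the weights of the digits by repeated addition. -/
def weightProg : Prog := .seq (letNat 28 (.lit 1))
  (forLoop 24 (nvar 30) (.seq (.setNat 28 (.add (nvar 24) (.lit 1)) (.lit 0))
    (forLoop 27 (.add (nat_ 45 24) (.lit 1))
      (.setNat 28 (.add (nvar 24) (.lit 1))
        (.add (.get 28 (.add (nvar 24) (.lit 1))) (nat_ 28 24))))))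

lemma ends_weightProg {sq : ℕ → List ℕ} {R N : ℕ} {s : State} (h30 : s.nat 30 0 = R)
    (h45 : ∀ r < R, s.nat 45 r = (sq r).length) (hN : ∀ r < R, (sq r).length ≤ N) :
    weightProg.Ends (100 * ((R + 1) * (N + 1))) s fun s' => ∀ r ≤ R, s'.nat 28 r = stride sq r := by
  have e₀ : (R + 1) * (N + 1) = R * N + R + N + 1 := by ring
  refine Prog.Ends.seq (T₁ := 10) (T₂ := 100 * (R * N) + 100 * R + 50) (Prog.ends_of_wp
    (Q := fun s' => s'.nat 28 0 = 1) (by simp) (by decide) |>.mono le_rfl ?_) (by omega)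
  intro s₁ hF₁ h₁
  refine ends_forLoop_const R (40 * N + 80) (fun r s' => ∀ r' ≤ r, s'.nat 28 r' = stride sq r')
    (by decide) ?_ ?_ ?_ ?_ ?_
  · intro r hr
    obtain rfl : r = 0 := by omega
    simpa [stride] using h₁
  · intro r s' _ hF _ _
    rw [NExp.eval, NExp.eval, hF.nat 30 (by decide), hF₁.nat 30 (by decide), h30]
  · intro r s' hr hF h24 h
    have e45 : s'.nat 45 r = (sq r).length := by
      rw [hF.nat 45 (by decide), hF₁.nat 45 (by decide), h45 r hr]
    refine Prog.Ends.seq (T₁ := 10) (T₂ := 40 * N + 70) (Prog.ends_of_wp (Q := fun s₂ =>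
      s₂.nat 28 (r + 1) = 0 ∧ ∀ r' ≤ r, s₂.nat 28 r' = stride sq r') ?_ (by decide)
      |>.mono le_rfl ?_) (by omega)
    · refine ⟨by simp [h24], fun r' hr' => ?_⟩
      have : r' ≠ r + 1 := by omega
      simpa [h24, this] using h r' hr'
    · rintro s₂ hF₂ ⟨g₁, g₂⟩
      refine ends_forLoop_const ((sq r).length + 1) 20 (fun t s₃ =>
        s₃.nat 28 (r + 1) = stride sq r * t ∧ ∀ r' ≤ r, s₃.nat 28 r' = stride sq r')
        (by decide) ?_ ?_ ?_ ?_ ?_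
      · simpa [g₁] using g₂
      · intro t s₃ _ hF₃ _ _
        simp [hF₃.nat 45 (by decide), hF₂.nat 45 (by decide), hF₃.nat 24 (by decide),
          hF₂.nat 24 (by decide), h24, e45]
      · rintro t s₃ _ hF₃ _ ⟨k₁, k₂⟩
        have e24 : s₃.nat 24 0 = r := by rw [hF₃.nat 24 (by decide), hF₂.nat 24 (by decide), h24]
        refine Prog.ends_of_wp ?_ (by decide)
        refine ⟨by simp [e24, k₁, k₂ r le_rfl, Nat.mul_add], fun r' hr' => ?_⟩
        have : r' ≠ r + 1 := by omega
        simpa [e24, this] using k₂ r' hr'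
      · rintro s₃ _ _ ⟨k₁, k₂⟩ r' hr'
        rw [State.nat_setNat_of_ne _ _ _ (by decide)]
        rcases Nat.lt_or_ge r r' with hlt | hge
        · obtain rfl : r' = r + 1 := by omega
          exact k₁
        · exact k₂ r' hge
      · have := hN r hr
        simp only [NExp.cost]
        omega
  · intro s' _ _ h
    exact h
  · simp only [NExp.cost]
    have : R * (40 * N + 80 + (1 + 1) + 11) = 40 * (R * N) + 93 * R := by ring
    omega

/-! ### The search over the parameters -/

/-- Writes to the output the list that is traced from the entry of the table whose number is in
register 39. -/
def traceProg : Prog := forLoop 24 (nvar 0) (block [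
  .setNat 1 (nvar 24) (nat_ 35 39), letNat 39 (nat_ 36 39)])

lemma ends_traceProg {s : State} {n : ℕ} {L : List ℕ} (hn : s.nat 0 0 = n) (hL : L.length = n)
    (h : Trace s (s.nat 39 0) L) :
    traceProg.Ends (50 * (n + 1)) s fun s' => seg (s'.nat 1) 0 n = L := by
  refine ends_forLoop_const n 30 (fun t s' => seg (s'.nat 1) 0 t = L.take t ∧
    Trace s (s'.nat 39 0) (L.drop t)) (by decide) ?_ ?_ ?_ ?_ ?_
  · simpa using h
  · intro t s' _ hF _ _
    rw [NExp.eval, NExp.eval, hF.nat 0 (by decide), hn]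
  · rintro t s' ht hF h24 ⟨h₁, h₂⟩
    have hlt : t < L.length := by omega
    rw [List.drop_eq_getElem_cons hlt] at h₂
    obtain ⟨g₁, -, g₃⟩ := h₂
    have u := seg_update_concat (s'.nat 1) 0 t L[t]
    rw [zero_add] at u
    refine Prog.ends_of_wp ?_ (by decide)
    refine ⟨?_, ?_⟩
    · rw [← List.take_append_getElem hlt, ← h₁, ← u]
      simp [h24, hF.nat 35 (by decide), g₁]
    · simpa [h24, hF.nat 36 (by decide)] using g₃
  · rintro s' - - ⟨h₁, -⟩
    rw [h₁, List.take_of_length_le hL.le]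
  · simp only [NExp.cost]
    omega

/-- Replaces the output by the list that is traced from the last entry of the table, if this list is
better. -/
def updateOutput : Prog := .seq (letNat 39 (.sub (nvar 29) (.lit 1)))
  (.ite (.and (.natLe (.lit 1) (nvar 46)) (.realLe (rvar 23) (real_ 26 39))) .skip
    (.seq (block [letNat 46 (.lit 1), letReal 23 (real_ 26 39)]) traceProg))

/-- The step for one choice of the parameters. -/
def searchStep : Prog := .seq fillProg (.seq weightProg (.seq tableProg updateOutput))

/-- Tries all parameters `m`, `l`, `α`, `β` between `0` and the number of indices of positive type.
The variable 46 tells whether the output has been written, and 23 is its value. -/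
def searchProg : Prog := .seq (letNat 46 (.lit 0))
  (forLoop 20 (.add (nvar 4) (.lit 1)) (forLoop 21 (.add (nvar 4) (.lit 1))
    (forLoop 22 (.add (nvar 4) (.lit 1)) (forLoop 23 (.add (nvar 4) (.lit 1)) searchStep))))

/-- The part of the memory `s` that the search does not change is as in the memory `s₀`. -/
structure SameInput (s₀ s : State) : Prop where
  n0 : s.nat 0 = s₀.nat 0
  n4 : s.nat 4 = s₀.nat 4
  n5 : s.nat 5 = s₀.nat 5
  n8 : s.nat 8 = s₀.nat 8
  n16 : s.nat 16 = s₀.nat 16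
  r8 : s.real 8 = s₀.real 8
  r9 : s.real 9 = s₀.real 9
  r10 : s.real 10 = s₀.real 10

lemma SameInput.frame {s₀ s s' : State} {c : Prog} (h : SameInput s₀ s) (hF : Frame c s s')
    (hn : ∀ a ∈ [0, 4, 5, 8, 16], a ∉ c.natWrites) (hr : ∀ a ∈ [8, 9, 10], a ∉ c.realWrites) :
    SameInput s₀ s' := by
  have e : ∀ a ∈ [0, 4, 5, 8, 16], s'.nat a = s.nat a := fun a ha => hF.nat a (hn a ha)
  have e' : ∀ a ∈ [8, 9, 10], s'.real a = s.real a := fun a ha => hF.real a (hr a ha)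
  obtain ⟨h₁, h₂, h₃, h₄, h₅, h₆, h₇, h₈⟩ := h
  constructor
  iterate 5 rw [e _ (by decide)]; assumption
  iterate 3 rw [e' _ (by decide)]; assumption

/-- The output is at least as good as all lists with the property `P`. -/
structure Covers (s₀ : State) (P : List ℕ → Prop) (s : State) : Prop where
  same : SameInput s₀ s
  out : 1 ≤ s.nat 46 0 → (seg (s.nat 1) 0 (s₀.nat 0 0)).Perm (s₀.positives ++ s₀.negatives) ∧
    s.real 23 0 = offDiag (s₀.real 8) (s₀.real 9) (s₀.real 10) (seg (s.nat 1) 0 (s₀.nat 0 0))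
  le : ∀ L, P L → 1 ≤ s.nat 46 0 ∧ s.real 23 0 ≤ offDiag (s₀.real 8) (s₀.real 9) (s₀.real 10) L

lemma Covers.setNat {s₀ s : State} {P : List ℕ → Prop} (h : Covers s₀ P s) (v i x : ℕ)
    (hv : v ∉ [0, 1, 4, 5, 8, 16, 46]) : Covers s₀ P (s.setNat v i x) := by
  simp only [List.mem_cons, List.not_mem_nil, or_false, not_or] at hv
  obtain ⟨⟨h₁, h₂, h₃, h₄, h₅, h₆, h₇, h₈⟩, g₁, g₂⟩ := h
  have e : ∀ a, v ≠ a → (s.setNat v i x).nat a = s.nat a := fun a ha =>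
    State.nat_setNat_of_ne _ _ _ (Ne.symm ha)
  refine ⟨⟨?_, ?_, ?_, ?_, ?_, h₆, h₇, h₈⟩, ?_, ?_⟩
  · rwa [e 0 (by tauto)]
  · rwa [e 4 (by tauto)]
  · rwa [e 5 (by tauto)]
  · rwa [e 8 (by tauto)]
  · rwa [e 16 (by tauto)]
  · rwa [e 46 (by tauto), e 1 (by tauto)]
  · rwa [e 46 (by tauto)]

lemma Covers.congr {s₀ s : State} {P P' : List ℕ → Prop} (h : Covers s₀ P s)
    (hP : ∀ L, P' L → P L) : Covers s₀ P' s :=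
  ⟨h.same, h.out, fun L hL => h.le L (hP L hL)⟩

/-- The rule for a loop of which each iteration covers further lists. -/
lemma ends_forLoop_covers {v c T : ℕ} {p : Prog} {s₀ s : State} {P : List ℕ → Prop}
    {F : ℕ → List ℕ → Prop} (hv : v ∉ p.natWrites) (hv' : v ∉ [0, 1, 4, 5, 8, 16, 46])
    (h : Covers s₀ P s)
    (hstep : ∀ i < s₀.nat 4 0 + 1, ∀ P s', Frame (forLoop v (.add (nvar 4) (.lit 1)) p) s s' →
      s'.nat v 0 = i → Covers s₀ P s' → p.Ends c s' (Covers s₀ fun L => P L ∨ F i L))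
    (hT : (s₀.nat 4 0 + 1) * (c + 30) ≤ T) :
    (forLoop v (.add (nvar 4) (.lit 1)) p).Ends T s
      (Covers s₀ fun L => P L ∨ ∃ i ≤ s₀.nat 4 0, F i L) := by
  refine ends_forLoop_const (s₀.nat 4 0 + 1) c
    (fun i s' => Covers s₀ (fun L => P L ∨ ∃ j < i, F j L) s') hv ?_ ?_ ?_ ?_ ?_
  · refine (h.setNat v 0 0 hv').congr fun L hL => ?_
    rcases hL with hL | ⟨j, hj, -⟩
    · exact hL
    · omega
  · intro i s' _ _ _ h'
    simp [h'.same.n4]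
  · intro i s' hi hF hvi h'
    refine (hstep i hi _ s' hF hvi h').mono le_rfl fun s₂ _ h₂ => ?_
    refine (h₂.setNat v 0 (i + 1) hv').congr fun L hL => ?_
    rcases hL with hL | ⟨j, hj, hL⟩
    · exact .inl (.inl hL)
    · rcases Nat.lt_succ_iff_lt_or_eq.1 hj with hj | rfl
      · exact .inl (.inr ⟨j, hj, hL⟩)
      · exact .inr hL
  · intro s' _ _ h'
    refine h'.congr fun L hL => ?_
    rcases hL with hL | ⟨i, hi, hL⟩
    · exact .inl hL
    · exact .inr ⟨i, by omega, hL⟩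
  · simp only [NExp.cost]
    refine le_trans ?_ hT
    have h₁ : (s₀.nat 4 0 + 1) * (c + (1 + 1 + 1 + 1) + 11) =
      (s₀.nat 4 0 + 1) * c + 15 * (s₀.nat 4 0 + 1) := by ring
    have h₂ : (s₀.nat 4 0 + 1) * (c + 30) = (s₀.nat 4 0 + 1) * c + 30 * (s₀.nat 4 0 + 1) := by ring
    omega

/-- The lists that are composed according to the parameters. -/
def Composed (s : State) (m l α β : ℕ) (L : List ℕ) : Prop :=
  Fits (seqs s.positives s.negatives m l α β) (s.negatives.length + 2)
    (fun r => (seqs s.positives s.negatives m l α β r).length) L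

lemma stride_seqs_le (K negs : List ℕ) (m l α β r : ℕ) :
    stride (seqs K negs m l α β) (r + 2) ≤ 2 ^ r * (K.length + 1) ^ 2 := by
  induction r with
  | zero =>
    have h₁ : (seqs K negs m l α β 0).length ≤ K.length := by
      simp only [seqs, List.length_reverse]
      exact (List.length_filter_le _ _).trans_eq (List.length_rotate _ _)
    have h₂ : (seqs K negs m l α β 1).length ≤ K.length :=
      (List.length_filter_le _ _).trans_eq (List.length_rotate _ _)
    simp only [stride, pow_zero, one_mul, pow_two]
    exact Nat.mul_le_mul (Nat.succ_le_succ h₁) (Nat.succ_le_succ h₂)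
  | succ r ih =>
    rw [stride, pow_succ, mul_assoc, mul_comm 2, ← mul_assoc]
    refine Nat.mul_le_mul ih (Nat.succ_le_succ ?_)
    simp only [seqs]
    cases negs[r]? <;> simp

lemma ends_searchStep {s₀ s : State} {P : List ℕ → Prop} {m l α β n : ℕ}
    (hperm : (s₀.positives ++ s₀.negatives).Perm (List.range n)) (hn : s₀.nat 0 0 = n)
    (hnonneg : ∀ x < n, 0 ≤ s₀.real 10 x) (h : Covers s₀ P s)
    (hp : Params s (s₀.nat 4 0) (s₀.nat 5 0) m l α β) (hm : m ≤ s₀.nat 4 0) (hl : l ≤ s₀.nat 4 0) :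
    searchStep.Ends (2000 * ((s₀.nat 5 0 + 3) * (2 ^ s₀.nat 5 0 * (s₀.nat 4 0 + 1) ^ 2))) s
      (Covers s₀ fun L => P L ∨ Composed s₀ m l α β L) := by
  generalize hp' : s₀.nat 4 0 = p at *
  generalize hk' : s₀.nat 5 0 = k at *
  set K := s₀.positives with hK
  set negs := s₀.negatives with hnegs
  have hKlen : K.length = p := by rw [hK, State.positives, length_seg, hp']
  have hNlen : negs.length = k := by rw [hnegs, State.negatives, length_seg, hk']
  have hlen : p + k = n := by
    rw [← hKlen, ← hNlen, ← List.length_append, hperm.length_eq, List.length_range]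
  set sq := seqs K negs m l α β with hsq
  set Y := 2 ^ k * (p + 1) ^ 2 with hY
  have hst : stride sq (k + 2) ≤ Y := by
    have := stride_seqs_le K negs m l α β k
    rwa [hKlen] at this
  have hk2 : k + 1 ≤ 2 ^ k := Nat.lt_two_pow_self
  have hnY : n + 1 ≤ Y := by
    have h₁ : n + 1 ≤ (k + 1) * (p + 1) := by
      rw [← hlen, Nat.add_mul, Nat.mul_add]; omega
    have h₂ : (k + 1) * (p + 1) ≤ 2 ^ k * (p + 1) := Nat.mul_le_mul_right _ hk2
    have h₃ : 2 ^ k * (p + 1) ≤ 2 ^ k * (p + 1) ^ 2 :=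
      Nat.mul_le_mul_left _ (Nat.le_self_pow (by norm_num) _)
    omega
  have hYZ : Y ≤ (k + 3) * Y := Nat.le_mul_of_pos_left _ (by omega)
  have hnd : (K ++ negs).Nodup := hperm.nodup_iff.2 List.nodup_range
  refine Prog.Ends.seq (T₁ := 250 * ((k + 3) * Y)) (T₂ := 1000 * ((k + 3) * Y)) ?_ (by omega)
  refine (ends_fillProg (K := K) (negs := negs) hp ?_ ?_ (List.nodup_append.1 hnd).1 hm hl).mono
    (by rw [hlen]; omega) ?_
  · rw [h.same.n16, hK, State.positives, hp']
  · rw [h.same.n8, hnegs, State.negatives, hk']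
  rintro s₁ hF₁ ⟨h30, h40, h45⟩
  have hS₁ := h.same.frame hF₁ (by decide) (by decide)
  refine Prog.Ends.seq (T₁ := 100 * ((k + 3) * Y)) (T₂ := 900 * ((k + 3) * Y)) ?_ (by omega)
  have hsum : (∑ r ∈ Finset.range (k + 2), (sq r : Multiset ℕ)) = ((K ++ negs : List ℕ)) := by
    rw [← hNlen]
    exact sum_seqs K negs m l α β
  have hmem : ∀ r < k + 2, (sq r : Multiset ℕ) ≤ ((K ++ negs : List ℕ)) := by
    intro r hr
    rw [← hsum]
    exact Finset.single_le_sum (f := fun r => (sq r : Multiset ℕ)) (fun _ _ => Multiset.zero_le _)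
      (Finset.mem_range.2 hr)
  have hlenle : ∀ r < k + 2, (sq r).length ≤ n := by
    intro r hr
    have := Multiset.card_le_card (hmem r hr)
    rwa [Multiset.coe_card, Multiset.coe_card, hperm.length_eq, List.length_range] at this
  refine (ends_weightProg (sq := sq) (R := k + 2) (N := n) h30 h45 hlenle).mono ?_ ?_
  · gcongr
  intro s₂ hF₂ h28
  have hS₂ := hS₁.frame hF₂ (by decide) (by decide)
  have hlay : Layout sq (k + 2) s₂ := by
    refine ⟨?_, ?_, ?_, h28⟩
    · rw [hF₂.nat 30 (by decide), h30]
    · rw [hF₂.nat 40 (by decide), hF₂.nat 44 (by decide)]; exact h40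
    · rw [hF₂.nat 45 (by decide)]; exact h45
  refine Prog.Ends.seq (T₁ := 400 * ((k + 3) * Y)) (T₂ := 500 * ((k + 3) * Y)) ?_ (by omega)
  refine (ends_tableProg hlay ?_).mono ?_ ?_
  · intro r hr x hx
    rw [hS₂.r10]
    refine hnonneg x (List.mem_range.1 (hperm.subset ?_))
    exact Multiset.mem_coe.1 (Multiset.mem_of_le (hmem r hr) (Multiset.mem_coe.2 hx))
  · gcongr
  rintro s₃ hF₃ ⟨⟨L, hL, hLe, hLmin⟩, h29⟩
  have hS₃ := hS₂.frame hF₃ (by decide) (by decide)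
  rw [hS₃.r8, hS₃.r9, hS₃.r10] at hLmin
  have hoff := hLe.off
  rw [hS₃.r8, hS₃.r9, hS₃.r10] at hoff
  have hLperm : L.Perm (K ++ negs) := by
    rw [← hNlen] at hL
    exact hL.perm_seqs
  have hLlen : L.length = n := by rw [hLperm.length_eq, hperm.length_eq, List.length_range]
  have hcomp : ∀ L', Composed s₀ m l α β L' ↔ Fits sq (k + 2) (fun r => (sq r).length) L' := by
    intro L'
    rw [Composed, ← hnegs, hNlen]
  -- The output and its value have not been changed so far.
  have e1 : s₃.nat 1 = s.nat 1 := by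
    rw [hF₃.nat 1 (by decide), hF₂.nat 1 (by decide), hF₁.nat 1 (by decide)]
  have e46 : s₃.nat 46 = s.nat 46 := by
    rw [hF₃.nat 46 (by decide), hF₂.nat 46 (by decide), hF₁.nat 46 (by decide)]
  have e23 : s₃.real 23 = s.real 23 := by
    rw [hF₃.real 23 (by decide), hF₂.real 23 (by decide), hF₁.real 23 (by decide)]
  set q := stride sq (k + 2) - 1 with hq
  refine Prog.Ends.seq (T₁ := 10) (T₂ := 400 * (n + 1)) (Prog.ends_of_wp (Q := fun s' =>
    s' = s₃.setNat 39 0 q) (by simp [h29, hq]) (by decide) |>.mono le_rfl ?_) (by omega)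
  intro s₄ hF₄ hs₄
  have hS₄ := hS₃.frame hF₄ (by decide) (by decide)
  have f39 : s₄.nat 39 0 = q := by simp [hs₄]
  have f46 : s₄.nat 46 = s.nat 46 := by rw [hF₄.nat 46 (by decide), e46]
  have f23 : s₄.real 23 = s.real 23 := by rw [hF₄.real 23 (by decide), e23]
  have f26 : s₄.real 26 = s₃.real 26 := hF₄.real 26 (by decide)
  refine Prog.Ends.ite (T := 100 * (n + 1)) (fun hb => ?_) (fun hb => ?_) ?_
  · -- The output is kept.
    simp only [Test.Holds, NExp.eval, RExp.eval, f39, f46, f23, f26] at hb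
    refine Prog.ends_of_wp ?_ (by simp [Prog.steps]; omega)
    refine ⟨hS₄, ?_, ?_⟩
    · rw [f46, f23, hF₄.nat 1 (by decide), e1]
      exact h.out
    · rw [f46, f23]
      rintro L' (hL' | hL')
      · exact h.le L' hL'
      · exact ⟨hb.1, hb.2.trans (hLmin L' ((hcomp L').1 hL'))⟩
  · simp only [Test.Holds, NExp.eval, RExp.eval, f39, f46, f23, f26] at hb
    refine Prog.Ends.seq (T₁ := 20) (T₂ := 50 * (n + 1)) (Prog.ends_of_wp (Q := fun s' =>
      s' = (s₄.setNat 46 0 1).setReal 23 0 (s₃.real 26 q)) (by simp [f39, f26]) (by decide)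
      |>.mono le_rfl ?_) (by omega)
    intro s₅ hF₅ hs₅
    have hS₅ := hS₄.frame hF₅ (by decide) (by decide)
    refine (ends_traceProg (n := n) (L := L) ?_ hLlen ?_).mono le_rfl ?_
    · rw [hS₅.n0, hn]
    · rw [hF₅.nat 39 (by decide), f39]
      refine hLe.trace.congr ?_ ?_
      · intro i _
        rw [hF₅.nat 35 (by decide), hF₄.nat 35 (by decide)]
      · intro i _
        rw [hF₅.nat 36 (by decide), hF₄.nat 36 (by decide)]
    intro s₆ hF₆ h₆
    have g46 : s₆.nat 46 0 = 1 := by rw [hF₆.nat 46 (by decide), hs₅]; simp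
    have g23 : s₆.real 23 0 = s₃.real 26 q := by rw [hF₆.real 23 (by decide), hs₅]; simp
    refine ⟨hS₅.frame hF₆ (by decide) (by decide), fun _ => ?_, ?_⟩
    · rw [hn, h₆, g23]
      exact ⟨hLperm, hoff⟩
    · rw [g46, g23]
      rintro L' (hL' | hL')
      · obtain ⟨h₁, h₂⟩ := h.le L' hL'
        refine ⟨le_rfl, le_trans ?_ h₂⟩
        by_contra hlt
        exact hb ⟨h₁, (not_le.1 hlt).le⟩
      · exact ⟨le_rfl, hLmin L' ((hcomp L').1 hL')⟩
  · simp only [Test.cost, NExp.cost, RExp.cost]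
    omega

lemma ends_searchProg {s : State} {n : ℕ}
    (hperm : (s.positives ++ s.negatives).Perm (List.range n)) (hn : s.nat 0 0 = n)
    (hnonneg : ∀ x < n, 0 ≤ s.real 10 x)
    (hmin : HasStructuredMin (s.real 8) (s.real 9) (s.real 10) s.positives s.negatives) :
    searchProg.Ends (3000 * ((s.nat 5 0 + 3) * (2 ^ s.nat 5 0 * (s.nat 4 0 + 1) ^ 6))) s fun s' =>
      (seg (s'.nat 1) 0 n).Perm (List.range n) ∧
        IsMinimal (s.real 8) (s.real 9) (s.real 10) (seg (s'.nat 1) 0 n) := by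
  set X := (s.nat 5 0 + 3) * (2 ^ s.nat 5 0 * (s.nat 4 0 + 1) ^ 2) with hX
  set N := s.nat 4 0 + 1 with hN
  have hX1 : 1 ≤ X := by rw [hX]; exact Nat.succ_le_of_lt (by positivity)
  have hT : ∀ c Z : ℕ, 1 ≤ Z → N * (c * Z + 30) ≤ (c + 30) * (N * Z) := by
    intro c Z hZ
    have : N * 30 ≤ N * 30 * Z := Nat.le_mul_of_pos_right _ hZ
    calc N * (c * Z + 30) = c * (N * Z) + N * 30 := by ring
      _ ≤ c * (N * Z) + N * 30 * Z := by omega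
      _ = (c + 30) * (N * Z) := by ring
  have hN1 : 1 ≤ N := by omega
  have h1 : 1 ≤ N * X := Nat.mul_pos hN1 hX1
  have h2 : 1 ≤ N * (N * X) := Nat.mul_pos hN1 h1
  have h3 : 1 ≤ N * (N * (N * X)) := Nat.mul_pos hN1 h2
  have h4 : 1 ≤ N * (N * (N * (N * X))) := Nat.mul_pos hN1 h3
  have hpow : (s.nat 5 0 + 3) * (2 ^ s.nat 5 0 * N ^ 6) = N * (N * (N * (N * X))) := by
    rw [hX]; ring
  rw [hpow]
  refine Prog.Ends.seq (T₁ := 10) (T₂ := 2120 * (N * (N * (N * (N * X))))) (Prog.ends_of_wp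
    (Q := fun s' => s'.nat 46 0 = 0) (by simp) (by decide) |>.mono le_rfl ?_) (by omega)
  intro s₁ hF₁ h46
  have h₀ : Covers s (fun _ => False) s₁ := by
    refine ⟨SameInput.frame ⟨rfl, rfl, rfl, rfl, rfl, rfl, rfl, rfl⟩ hF₁ (by decide) (by decide),
      fun h => ?_, fun L h => h.elim⟩
    omega
  refine (ends_forLoop_covers (c := 2090 * (N * (N * (N * X))))
    (F := fun m L => ∃ l ≤ s.nat 4 0, ∃ α ≤ s.nat 4 0, ∃ β ≤ s.nat 4 0, Composed s m l α β L)
    (by decide) (by decide) h₀ ?_ (hT _ _ h3)).mono le_rfl ?_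
  · intro m hm P₁ s₂ _ hs₂ h₂
    refine ends_forLoop_covers (c := 2060 * (N * (N * X)))
      (F := fun l L => ∃ α ≤ s.nat 4 0, ∃ β ≤ s.nat 4 0, Composed s m l α β L)
      (by decide) (by decide) h₂ ?_ (hT _ _ h2)
    intro l hl P₂ s₃ hF₃ hs₃ h₃
    refine ends_forLoop_covers (c := 2030 * (N * X))
      (F := fun α L => ∃ β ≤ s.nat 4 0, Composed s m l α β L)
      (by decide) (by decide) h₃ ?_ (hT _ _ h1)
    intro α hα P₃ s₄ hF₄ hs₄ h₄
    refine ends_forLoop_covers (c := 2000 * X) (F := fun β L => Composed s m l α β L)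
      (by decide) (by decide) h₄ ?_ (hT _ _ hX1)
    intro β hβ P₄ s₅ hF₅ hs₅ h₅
    refine ends_searchStep hperm hn hnonneg h₅ ⟨?_, ?_, ?_, ?_, ?_, hs₅⟩ (by omega) (by omega)
    · rw [h₅.same.n4]
    · rw [h₅.same.n5]
    · rw [hF₅.nat 20 (by decide), hF₄.nat 20 (by decide), hF₃.nat 20 (by decide), hs₂]
    · rw [hF₅.nat 21 (by decide), hF₄.nat 21 (by decide), hs₃]
    · rw [hF₅.nat 22 (by decide), hs₄]
  · intro s' _ h'
    obtain ⟨W, hW, hopt⟩ := hmin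
    have hKlen : s.positives.length = s.nat 4 0 := by rw [State.positives, length_seg]
    have hnd : (s.positives ++ s.negatives).Nodup := hperm.nodup_iff.2 List.nodup_range
    obtain ⟨m, hm, l, hl, α, hα, β, hβ, hfit⟩ := hW.exists_fits hnd
    rw [hKlen] at hm hl hα hβ
    obtain ⟨hf, hle⟩ := h'.le W (.inr ⟨m, hm, l, hl, α, hα, β, hβ, hfit⟩)
    obtain ⟨hp, heq⟩ := h'.out hf
    rw [hn] at hp heq
    refine ⟨hp.trans hperm, fun W' hW' => ?_⟩
    rw [← heq]
    exact hle.trans (hopt W' (hW'.trans (hp.trans hW.1.symm)))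

/-! ### The running times -/

lemma length_negatives_le {n : ℕ} {I : OrderingInstance 2 n} {s : State} (h : Ready I s) :
    s.nat 5 0 ≤ numNegDet I.M := by
  have hnd := (List.nodup_append.1 (h.perm.nodup_iff.2 List.nodup_range)).2.1
  have hsub : (s.negatives.toFinset : Set ℕ) ⊆ Fin.val '' {i : Fin n | (I.M i).det < 0} := by
    intro i hi
    have hi : i ∈ s.negatives := by simpa using hi
    have hin : i < n := List.mem_range.1 (h.perm.subset (List.mem_append_right _ hi))
    have := h.det i hi
    rw [mat, dif_pos hin] at this
    exact ⟨⟨i, hin⟩, this, rfl⟩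
  have hcard := Set.ncard_le_ncard hsub (Set.toFinite _)
  rw [Set.ncard_coe_finset, List.toFinset_card_of_nodup hnd,
    Set.ncard_image_of_injective _ Fin.val_injective, State.negatives, length_seg] at hcard
  exact hcard

lemma ends_search_isOptimalList {n : ℕ} {I : OrderingInstance 2 n}
    (hI : SimultaneouslyTriangularizable I.M) (hdet : ∃ i, (I.M i).det < 0) :
    (Prog.seq readyProg searchProg).Ends
      (1000000 * (numNegDet I.M * 2 ^ numNegDet I.M * n ^ 6)) (input I)
      fun s => IsOptimalList I (seg (s.nat 1) 0 n) := by
  obtain ⟨i₀, hi₀⟩ := hdet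
  have hn : 1 ≤ n := by have := i₀.2; omega
  have hκ : 1 ≤ numNegDet I.M :=
    Nat.succ_le_of_lt ((Set.ncard_pos (Set.toFinite _)).2 ⟨i₀, hi₀⟩)
  set κ := numNegDet I.M with hκd
  set Z := κ * 2 ^ κ * n ^ 6 with hZ
  have hnZ : n ^ 6 ≤ Z := Nat.le_mul_of_pos_left _ (Nat.mul_pos hκ (Nat.two_pow_pos _))
  refine Prog.Ends.seq (T₁ := 4000 * Z) (T₂ := 900000 * Z)
    ((ends_readyProg hI).mono ?_ ?_) (by omega)
  · have h₁ : n * (Nat.log 2 n + 2) ≤ n * (3 * n) :=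
      Nat.mul_le_mul_left _ (by have := Nat.log_le_self 2 n; omega)
    have h₂ : n * (3 * n) = 3 * n ^ 2 := by ring
    have h₃ : n ^ 2 ≤ n ^ 6 := Nat.pow_le_pow_right hn (by norm_num)
    have h₄ : 1 ≤ n ^ 6 := Nat.one_le_pow _ _ hn
    omega
  intro s _ hs
  have hk : s.nat 5 0 ≤ κ := length_negatives_le hs
  have hp : s.nat 4 0 ≤ n := by
    have := hs.perm.length_eq
    rw [List.length_append, State.positives, length_seg, List.length_range] at this
    omega
  refine (ends_searchProg hs.perm hs.size hs.nonneg hs.min).mono ?_ ?_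
  · have h₁ : s.nat 5 0 + 3 ≤ 4 * κ := by omega
    have h₂ : 2 ^ s.nat 5 0 ≤ 2 ^ κ := Nat.pow_le_pow_right (by norm_num) hk
    have h₃ : (s.nat 4 0 + 1) ^ 6 ≤ (2 * n) ^ 6 := Nat.pow_le_pow_left (by omega) 6
    calc 3000 * ((s.nat 5 0 + 3) * (2 ^ s.nat 5 0 * (s.nat 4 0 + 1) ^ 6))
        ≤ 3000 * (4 * κ * (2 ^ κ * (2 * n) ^ 6)) := by gcongr
      _ = 768000 * Z := by rw [hZ]; ring
      _ ≤ 900000 * Z := by omega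
  · rintro s' - ⟨h₁, h₂⟩
    exact hs.represents _ h₁ h₂

end RealRAM

theorem mainTheorem3 :
    (∃ (p : RealRAM.Prog) (C : ℝ), ∀ (n : ℕ) (I : OrderingInstance 2 n),
      SimultaneouslyTriangularizable I.M → (∀ i, 0 ≤ (I.M i).det) →
        RealRAM.SolvesWithin p I (C * ((n : ℝ) * Real.log (n : ℝ) + 1))) ∧
    (∃ (p : RealRAM.Prog) (C : ℝ), ∀ (n : ℕ) (I : OrderingInstance 2 n),
      SimultaneouslyTriangularizable I.M → (∃ i, (I.M i).det < 0) →
        RealRAM.SolvesWithin p I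
          (C * ((numNegDet I.M : ℝ) * 2 ^ numNegDet I.M * (n : ℝ) ^ 6))) := by
  refine ⟨⟨.seq RealRAM.readyProg RealRAM.rotationProg, 12000, fun n I hI hdet => ?_⟩,
    ⟨.seq RealRAM.readyProg RealRAM.searchProg, 1000000, fun n I hI hdet => ?_⟩⟩
  · refine RealRAM.solvesWithin_of_ends (RealRAM.ends_rotation_isOptimalList hI hdet) ?_
    have := RealRAM.mul_log_le n
    rw [Nat.cast_mul]
    push_cast at this ⊢
    linarith
  · refine RealRAM.solvesWithin_of_ends (RealRAM.ends_search_isOptimalList hI hdet) ?_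
    push_cast
    exact le_rfl
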